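/- Let $c\in(0,\infty)$ be fixed. Run the greedy independent set algorithm on the random graph $\mathcal G(n,c/n)$: $A_0=[n]$, and in step $k\ge 1$ a uniformly random vertex $v_k\in A_{k-1}$ is selected, and $A_k$ is obtained from $A_{k-1}$ by removing $v_k$ and its neighbours. Let $S_g=\min\{k\ge0: A_k=\emptyset\}$ be the size of the independent set found, and let $s_c=\frac1c\log(1+c)$. For $t\ne s_c$ let $D_t=D_t^{(n)}$ be the event $\{S_g\le tn\}$ if $t<s_c$ and $\{S_g\ge tn\}$ if $t>s_c$, and $P_t=\mathbb P(D_t)$. Fix $s\in(0,1)$, $s\ne s_c$. There is a unique $a=a_s\in(0,\infty)\setminus\{1\}$ with $s=\frac1c\log\frac{b-1}{a-1}$, where $b=ae^{c(1-1/a)}$. Put \[ \hat y_s(x)=\frac{1+(a_s-1)e^{cx}}{e^{cx}}\Big[\frac1{a_s}-\frac1{c(a_s-1)}\log\frac{1+(a_s-1)e^{cx}}{a_s}\Big],\qquad 0\le x\le s . \] For a trajectory $y$ that decreases (weakly) from $y(0)=1$ to $y(s)=0$ over $[0,s]$, let its cost be $\int_0^s\Gamma^*_{c y(x)}\big(-(1+y'(x))\big)\,dx\in[0,\infty]$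 if $y$ is absolutely continuous, and $\infty$ otherwise, where $\Gamma^*_\lambda(\xi)=\sup_{\vartheta\in\mathbb R}[\vartheta\xi-\lambda(e^\vartheta-1)]$ is the Legendre--Fenchel transform of the cumulant-generating function of a Poisson variable of rate $\lambda$. Then: (1) $\hat y_s$ strictly decreases from $1$ to $0$ over $[0,s]$, and it is the unique trajectory of least cost among those decreasing from $1$ to $0$ over $[0,s]$. With \[ \ell_s(x)=-(1+\hat y_s'(x))\Big[1+\frac{c\hat y_s(x)}{1+\hat y_s'(x)}+\log\Big(-\frac{c\hat y_s(x)}{1+\hat y_s'(x)}\Big)\Big] \] we have, for $0\le x<s$, $\ell_s(x)=-\Gamma^*_{c\hat y_s(x)}(-(1+\hat y_s'(x)))$ and \[ \ell_s(x)=\Big[\log\frac{1+(a_s-1)e^{cx}}{a_s}-\frac{c(a_s-1)}{a_s}\Big]\Big[1-\frac{\log(1+(a_s-1)e^{cx})}{(a_s-1)e^{cx}}\Big], \] so that $\ell_s$ is integrable on $[0,s]$ and the least cost is $-\int_0^s\ell_s(x)\,dx$. (2) If $s_n\to s$ as $n\to\infty$, then $P_{s_n}>0$ for all large $n$ and \[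 \lim_{n\to\infty}\frac1n\log P_{s_n}=\int_0^s\ell_s(x)\,dx . \] Moreover, $\hat y_s$ is asymptotically the optimal trajectory for $|A_{xn}|/n$: for every $\varepsilon>0$ there is $\delta>0$ such that, for all large $n$, \[ \mathbb P\Big(D_{s_n}\ \text{and}\ \big||A_{\lfloor xn\rfloor}|/n-\hat y_s(x)\big|\ge\varepsilon\ \text{for some } x\in[0,s]\Big)\le e^{-\delta n}P_{s_n}. \] -/

import Mathlib

open Set Filter Topology MeasureTheory

noncomputable section

/-! ### The greedy independent set algorithm on the binomial random graph -/

/-- The available vertices once the vertices of the list `l` have been selected: those that are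
not selected and have no selected neighbour. -/
def greedyAvail {n : ℕ} (G : SimpleGraph (Fin n)) (l : List (Fin n)) : Finset (Fin n) := by
  classical
  exact Finset.univ.filter fun w => w ∉ l ∧ ∀ v ∈ l, ¬ G.Adj v w

/-- One step of the greedy algorithm on `G`: append a uniformly random available vertex to the
list of selected vertices; do nothing if no vertex is available. -/
def greedyStep {n : ℕ} (G : SimpleGraph (Fin n)) (l : List (Fin n)) : PMF (List (Fin n)) := by
  classical
  exact if h : (greedyAvail G l).Nonempty then
      (PMF.uniformOfFinset (greedyAvail G l) h).map fun v => l ++ [v]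
    else PMF.pure l

/-- The law of the list of selected vertices, in order of selection, after `k` steps on `G`. -/
def greedyRun {n : ℕ} (G : SimpleGraph (Fin n)) : ℕ → PMF (List (Fin n))
  | 0 => PMF.pure []
  | k + 1 => (greedyRun G k).bind (greedyStep G)

/-- The edge probability `c / n`, as an element of `[0,1]` (so it is `c / n` as soon as
`c ≤ n`). -/
def edgeProb (c : ℝ) (n : ℕ) : unitInterval := Set.projIcc 0 1 zero_le_one (c / n)

instance simpleGraphMeasurableSingletonClass (n : ℕ) :
    MeasurableSingletonClass (SimpleGraph (Fin n)) where
  measurableSet_singleton G := by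
    rw [← SimpleGraph.measurableEmbedding_edgeSet.measurableSet_image, Set.image_singleton]
    exact measurableSet_singleton _

/-- The joint law of the random graph `𝒢(n, c/n)` and of the list `[v₁, v₂, …]` of all the vertices
selected by the greedy algorithm on it. Each effective step selects a new vertex, so the
algorithm has stopped after `n` steps. -/
def greedyLaw (c : ℝ) (n : ℕ) : PMF (SimpleGraph (Fin n) × List (Fin n)) :=
  (SimpleGraph.binomialRandom (Fin n) (edgeProb c n)).toPMF.bind fun G =>
    (greedyRun G n).map fun l => (G, l)

/-- The probability of an event under the greedy algorithm on `𝒢(n, c/n)`. -/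
def greedyProb (c : ℝ) (n : ℕ) (E : Set (SimpleGraph (Fin n) × List (Fin n))) : ℝ :=
  ((greedyLaw c n).toOuterMeasure E).toReal

/-- `|A_k|`, the number of vertices that are available after `k` steps. -/
def numAvail {n : ℕ} (ω : SimpleGraph (Fin n) × List (Fin n)) (k : ℕ) : ℕ :=
  (greedyAvail ω.1 (ω.2.take k)).card

/-- `S_g = min {k ≥ 0 : A_k = ∅}`, the size of the independent set that is found. -/
def greedySize {n : ℕ} (ω : SimpleGraph (Fin n) × List (Fin n)) : ℕ :=
  sInf {k : ℕ | numAvail ω k = 0}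

/-- The typical density `s_c = (1/c) log (1 + c)`. -/
def sCrit (c : ℝ) : ℝ := (1 / c) * Real.log (1 + c)

/-- The deviation event: `S_g ≤ t n` if `t < s_c`, and `S_g ≥ t n` if `t > s_c`. -/
def devEvent (c : ℝ) (n : ℕ) (t : ℝ) : Set (SimpleGraph (Fin n) × List (Fin n)) :=
  {ω | if t < sCrit c then (greedySize ω : ℝ) ≤ t * n else t * n ≤ (greedySize ω : ℝ)}

/-- The event that the rescaled trajectory `x ↦ |A_{⌊x n⌋}| / n` is at uniform distance at least
`ε` from `y` over `[0, s]`. -/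
def farEvent (n : ℕ) (s ε : ℝ) (y : ℝ → ℝ) : Set (SimpleGraph (Fin n) × List (Fin n)) :=
  {ω | ∃ x ∈ Icc 0 s, ε ≤ |(numAvail ω ⌊x * n⌋₊ : ℝ) / n - y x|}

/-! ### The cost of a trajectory -/

/-- The Legendre–Fenchel transform `Γ*_lam(ξ) = sup_θ [θ ξ - lam (e^θ - 1)]` of the
cumulant-generating function of a Poisson variable of rate `lam`. -/
def poissonLegendre (lam ξ : ℝ) : EReal :=
  ⨆ θ : ℝ, ((θ * ξ - lam * (Real.exp θ - 1) : ℝ) : EReal)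

open Classical in
/-- The cost `∫₀ˢ Γ*_{c y(x)} (-(1 + y'(x))) dx ∈ [0, ∞]` of a trajectory `y` over `[0, s]`;
it is infinite if `y` is not absolutely continuous. -/
def trajCost (c s : ℝ) (y : ℝ → ℝ) : ENNReal :=
  if AbsolutelyContinuousOnInterval y 0 s then
    ∫⁻ x in Icc 0 s, (poissonLegendre (c * y x) (-(1 + deriv y x))).toENNReal
  else ⊤

/-- `y` decreases from `1` to `0` over `[0, s]`. -/
def IsTrajectory (s : ℝ) (y : ℝ → ℝ) : Prop :=
  y 0 = 1 ∧ y s = 0 ∧ AntitoneOn y (Icc 0 s)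

/-- `b = a e^{c (1 - 1/a)}`. -/
def bParam (c a : ℝ) : ℝ := a * Real.exp (c * (1 - 1 / a))

/-- `a` is a solution `a_s` of `s = (1/c) log ((b - 1) / (a - 1))`. -/
def IsParam (c s a : ℝ) : Prop :=
  0 < a ∧ a ≠ 1 ∧ s = (1 / c) * Real.log ((bParam c a - 1) / (a - 1))

/-- The trajectory `ŷ_s`, with `a = a_s`. -/
def yHat (c a x : ℝ) : ℝ :=
  (1 + (a - 1) * Real.exp (c * x)) / Real.exp (c * x) *
    (1 / a - 1 / (c * (a - 1)) * Real.log ((1 + (a - 1) * Real.exp (c * x)) / a))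

/-- The cost function `ℓ_s` associated with `ŷ_s`, with `a = a_s`. -/
def ellHat (c a x : ℝ) : ℝ :=
  -(1 + deriv (yHat c a) x) *
    (1 + c * yHat c a x / (1 + deriv (yHat c a) x)
      + Real.log (-(c * yHat c a x / (1 + deriv (yHat c a) x))))

end

/-! Revealing edges only when a vertex is selected makes `|A_k|` a Markov chain: from `v + 1` it
moves to a binomial variable with parameters `v` and `1 - c/n`, and `0` is absorbing. The deviation
says that this chain is, or is not, absorbed at a time close to `sn`.

With `u_j = 1 + (a-1)(1-p)^(-j)` one has `p + (1-p) u_{j+1} = u_j`, so `h_k(v) = u_k^v ∏_{j<k} u_j`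
is harmonic away from `0`. It is superharmonic everywhere once it is set to `0` at `0` when `a > 1`.
At the deciding time `m` it is at least `∏_{j<m} u_j` on the deviation, and `h_0(n) = a^n`; hence `P
≤ a^n / ∏_{j<m} u_j`, with rate `log a - ∫₀ˢ log u`, where `u(x) = 1 + (a-1)e^{cx}`.

Concentration comes from comparing two such weights. On a tail at time `xn`, `h` for `a` is
dominated by a multiple of `h` for `a'`. The resulting rate `tiltRate` at level `v` has at `a` a
derivative in the parameter of the sign of `ŷ(x) - v`. So a small change of `a` gains an exponential
factor on either side of `ŷ(x)` (`exists_tilt_gt`, `exists_tilt_lt`). Used upwards and downwards,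
this also gives the lower bound: the law tilted by `a'` near `a` keeps the chain alive and low just
before its own absorption time, which forces the deviation when `a'` lies on the proper side of `a`
(`exists_near_optimal`). A finite grid and monotonicity turn concentration at fixed times into
uniform concentration.

The variational part is a calibration. The choice `θ = -log u(x)` in the supremum bounds the
integrand from below by `log u + (y log u)'`, whose integral `∫ log u - log a` is the same for all
trajectories. The bound is attained along `ŷ`, since `-(1 + ŷ') = c ŷ / u`. This identifies the
least cost with minus the probabilistic rate, and a first-order variation of `θ` gives uniqueness.
-/

noncomputable section

/-! ### The chain of the numbers of available vertices -/

/-- The transition operator of the Markov chain on `ℕ` that is absorbed at `0` and moves from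
`v + 1` to a binomial variable with parameters `v` and `1 - p`. -/
def stepOp (p : ℝ) (f : ℕ → ℝ) : ℕ → ℝ
  | 0 => f 0
  | v + 1 => ∑ i ∈ Finset.range (v + 1), (v.choose i : ℝ) * (1 - p) ^ i * p ^ (v - i) * f i

lemma stepOp_mono {p : ℝ} (h0 : 0 ≤ p) (h1 : p ≤ 1) {f g : ℕ → ℝ} (h : f ≤ g) :
    stepOp p f ≤ stepOp p g := by
  intro v
  cases v with
  | zero => exact h 0
  | succ v =>
    refine Finset.sum_le_sum fun i _ => mul_le_mul_of_nonneg_left (h i) ?_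
    have : 0 ≤ 1 - p := by linarith
    positivity

lemma stepOp_geom (p z : ℝ) (v : ℕ) :
    stepOp p (fun i => z ^ i) (v + 1) = (p + (1 - p) * z) ^ v := by
  rw [add_comm p, add_pow]
  refine Finset.sum_congr rfl fun i _ => ?_
  rw [mul_pow]; ring

lemma stepOp_sub (p : ℝ) (f g : ℕ → ℝ) :
    stepOp p (fun v => f v - g v) = fun v => stepOp p f v - stepOp p g v := by
  funext v
  cases v with
  | zero => rfl
  | succ v => simp only [stepOp, mul_sub, Finset.sum_sub_distrib]

lemma stepOp_smul (p r : ℝ) (f : ℕ → ℝ) :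
    stepOp p (fun v => r * f v) = fun v => r * stepOp p f v := by
  funext v
  cases v with
  | zero => rfl
  | succ v =>
    simp only [stepOp, Finset.mul_sum]
    exact Finset.sum_congr rfl fun i _ => by ring

lemma stepOp_one (p : ℝ) : stepOp p (fun _ => 1) = fun _ => 1 := by
  funext v
  cases v with
  | zero => rfl
  | succ v =>
    have := stepOp_geom p 1 v
    simpa using this

lemma stepOp_iterate_mono {p : ℝ} (h0 : 0 ≤ p) (h1 : p ≤ 1) (k : ℕ) {f g : ℕ → ℝ} (h : f ≤ g) :
    (stepOp p)^[k] f ≤ (stepOp p)^[k] g :=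
  Monotone.iterate (fun _ _ h => stepOp_mono h0 h1 h) k h

lemma stepOp_iterate_smul (p r : ℝ) (k : ℕ) (f : ℕ → ℝ) :
    (stepOp p)^[k] (fun v => r * f v) = fun v => r * (stepOp p)^[k] f v := by
  induction k generalizing f with
  | zero => rfl
  | succ k ih => rw [Function.iterate_succ_apply, stepOp_smul, ih, Function.iterate_succ_apply]

lemma stepOp_iterate_one (p : ℝ) (k : ℕ) : (stepOp p)^[k] (fun _ => 1) = fun _ => 1 :=
  Function.iterate_fixed (stepOp_one p) k

lemma stepOp_iterate_zero (p : ℝ) (k : ℕ) (f : ℕ → ℝ) : (stepOp p)^[k] f 0 = f 0 := by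
  induction k generalizing f with
  | zero => rfl
  | succ k ih => rw [Function.iterate_succ_apply, ih]; rfl

/-- Every step from a positive state loses at least one, so the chain is absorbed in time. -/
lemma stepOp_iterate_absorbed (p : ℝ) {r v : ℕ} (h : v ≤ r) :
    (stepOp p)^[r] (indicator {0} 1) v = 1 := by
  induction r generalizing v with
  | zero => obtain rfl : v = 0 := by omega
            simp
  | succ r ih =>
    rw [Function.iterate_succ_apply']
    cases v with
    | zero => rw [stepOp, stepOp_iterate_zero]; simp
    | succ v =>
      have := congrFun (stepOp_one p) (v + 1)
      simp only [stepOp] at this ⊢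
      refine (Finset.sum_congr rfl fun i hi => ?_).trans this
      rw [ih (by simp at hi; omega)]

lemma stepOp_iterate_indicator_antitone {p : ℝ} (h0 : 0 ≤ p) (h1 : p ≤ 1) (r : ℕ) :
    (stepOp p)^[r] (indicator {0}ᶜ 1) ≤ indicator {0}ᶜ (1 : ℕ → ℝ) := by
  intro v
  by_cases hv : v = 0
  · subst hv; rw [stepOp_iterate_zero]
  · have : (stepOp p)^[r] (indicator {0}ᶜ 1) v ≤ (stepOp p)^[r] (fun _ => 1) v :=
      stepOp_iterate_mono h0 h1 r (fun i => indicator_le_self' (fun _ _ => zero_le_one) i) v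
    rw [stepOp_iterate_one] at this
    simpa [hv] using this

/-! ### Exponential tilting -/

/-- The base of the exponential weight at time `j`. -/
def tiltBase (p a : ℝ) (j : ℕ) : ℝ := 1 + (a - 1) * ((1 - p)⁻¹) ^ j

/-- The logarithm of the product of the first `k` bases. -/
def tiltLog (p a : ℝ) (k : ℕ) : ℝ := ∑ j ∈ Finset.range k, Real.log (tiltBase p a j)

/-- The exponential weight at time `k`, harmonic for the chain away from `0`. -/
def tiltWeight (p a : ℝ) (k v : ℕ) : ℝ := Real.exp (v * Real.log (tiltBase p a k) + tiltLog p a k)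

/-- The affine map `z ↦ p + (1-p) z` fixes `1` and contracts distances to `1` by `1 - p`; the bases
are a backward orbit of it. -/
lemma tiltBase_rec {p : ℝ} (h1 : p < 1) (a : ℝ) (j : ℕ) :
    p + (1 - p) * tiltBase p a (j + 1) = tiltBase p a j := by
  have : 1 - p ≠ 0 := by linarith
  simp only [tiltBase, pow_succ]
  field_simp
  ring

lemma tiltBase_mono {p : ℝ} (h1 : p < 1) (j : ℕ) {a a' : ℝ} (h : a ≤ a') :
    tiltBase p a j ≤ tiltBase p a' j := by
  have : 0 < (1 - p)⁻¹ := inv_pos.2 (by linarith)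
  unfold tiltBase
  gcongr

lemma tiltBase_le_one {p : ℝ} (h1 : p < 1) (j : ℕ) {a : ℝ} (h : a ≤ 1) : tiltBase p a j ≤ 1 := by
  simpa [tiltBase] using tiltBase_mono h1 j h

lemma one_le_tiltBase {p : ℝ} (h1 : p < 1) (j : ℕ) {a : ℝ} (h : 1 ≤ a) : 1 ≤ tiltBase p a j := by
  simpa [tiltBase] using tiltBase_mono h1 j h

lemma tiltWeight_eq {p a : ℝ} {k : ℕ} (h : 0 < tiltBase p a k) (v : ℕ) :
    tiltWeight p a k v = Real.exp (tiltLog p a k) * tiltBase p a k ^ v := by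
  rw [tiltWeight, add_comm, Real.exp_add, mul_comm (v : ℝ), Real.exp_mul, Real.exp_log h,
    Real.rpow_natCast]

lemma tiltWeight_pos (p a : ℝ) (k v : ℕ) : 0 < tiltWeight p a k v := Real.exp_pos _

lemma tiltWeight_zero_left {p a : ℝ} (h : 0 < a) (v : ℕ) : tiltWeight p a 0 v = a ^ v := by
  have : tiltBase p a 0 = a := by simp [tiltBase]
  rw [tiltWeight_eq (by rwa [this]), this]; simp [tiltLog]

lemma tiltWeight_zero_right (p a : ℝ) (k : ℕ) :
    tiltWeight p a k 0 = Real.exp (tiltLog p a k) := by simp [tiltWeight]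

lemma exp_tiltLog_succ {p a : ℝ} {k : ℕ} (h : 0 < tiltBase p a k) :
    Real.exp (tiltLog p a (k + 1)) = Real.exp (tiltLog p a k) * tiltBase p a k := by
  rw [tiltLog, Finset.sum_range_succ, Real.exp_add, Real.exp_log h, tiltLog]

/-- The step turns `u_{k+1}^i` into `u_k^v`; the additional factor `u_k` in the product of the bases
restores the exponent `v + 1`. -/
lemma stepOp_tiltWeight {p a : ℝ} (h1 : p < 1) {k : ℕ} (hk : 0 < tiltBase p a k)
    (hk' : 0 < tiltBase p a (k + 1)) (v : ℕ) :
    stepOp p (tiltWeight p a (k + 1)) (v + 1) = tiltWeight p a k (v + 1) := by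
  rw [funext (tiltWeight_eq hk'), stepOp_smul]
  dsimp only
  rw [stepOp_geom, tiltBase_rec h1, exp_tiltLog_succ hk, tiltWeight_eq hk]
  ring

/-- The weight, set to `0` at the absorbing state if `1 < a`. -/
def cutWeight (p a : ℝ) (k v : ℕ) : ℝ := if v = 0 ∧ 1 < a then 0 else tiltWeight p a k v

lemma cutWeight_nonneg (p a : ℝ) (k v : ℕ) : 0 ≤ cutWeight p a k v := by
  unfold cutWeight; split_ifs
  · exact le_rfl
  · exact (tiltWeight_pos _ _ _ _).le

lemma cutWeight_le (p a : ℝ) (k v : ℕ) : cutWeight p a k v ≤ tiltWeight p a k v := by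
  unfold cutWeight; split_ifs
  · exact (tiltWeight_pos _ _ _ _).le
  · exact le_rfl

/-- At `0` the weight is the product of the bases, which decreases in time for `a ≤ 1` but increases
for `a > 1`. Hence the cut, which costs nothing since only survival matters in that case. -/
lemma stepOp_cutWeight_le {p a : ℝ} (h0 : 0 ≤ p) (h1 : p < 1) {k : ℕ} (hk : 0 < tiltBase p a k)
    (hk' : 0 < tiltBase p a (k + 1)) :
    stepOp p (cutWeight p a (k + 1)) ≤ cutWeight p a k := by
  intro v
  cases v with
  | zero =>
    simp only [stepOp, cutWeight, true_and]
    split_ifs with h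
    · exact le_rfl
    · rw [tiltWeight_zero_right, tiltWeight_zero_right, exp_tiltLog_succ hk]
      exact mul_le_of_le_one_right (Real.exp_pos _).le (tiltBase_le_one h1 k (not_lt.1 h))
  | succ v =>
    have := stepOp_mono h0 h1.le (cutWeight_le p a (k + 1)) (v + 1)
    rw [stepOp_tiltWeight h1 hk hk'] at this
    simpa [cutWeight] using this

lemma stepOp_iterate_cutWeight_le {p a : ℝ} (h0 : 0 ≤ p) (h1 : p < 1) (k r : ℕ)
    (hpos : ∀ j ≤ k + r, 0 < tiltBase p a j) :
    (stepOp p)^[r] (cutWeight p a (k + r)) ≤ cutWeight p a k := by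
  induction r with
  | zero => exact le_rfl
  | succ r ih =>
    rw [Function.iterate_succ_apply]
    refine le_trans (stepOp_iterate_mono h0 h1.le r ?_) (ih fun j hj => hpos j (by omega))
    exact stepOp_cutWeight_le h0 h1 (hpos (k + r) (by omega)) (hpos (k + r + 1) (by omega))

/-- The states that realize the deviation: absorption if `a < 1`, survival if `1 < a`. -/
def devStates (a : ℝ) : Set ℕ := {v | v = 0 ↔ a < 1}

/-- Equality holds at `0` if `a < 1`. If `a > 1`, the base at time `m` is at least `1`, and so are
its powers at the live states. -/
lemma indicator_devStates_le {p a : ℝ} (h1 : p < 1) (m : ℕ) (ha : a ≠ 1)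
    (hm : 0 < tiltBase p a m) (v : ℕ) :
    indicator (devStates a) 1 v ≤ Real.exp (-tiltLog p a m) * cutWeight p a m v := by
  have hE : Real.exp (-tiltLog p a m) * Real.exp (tiltLog p a m) = 1 := by
    rw [← Real.exp_add]; simp
  by_cases hv : v ∈ devStates a
  · rw [indicator_of_mem hv]
    rcases lt_or_gt_of_ne ha with h | h
    · have hv0 : v = 0 := hv.2 h
      subst hv0
      rw [cutWeight, if_neg (by simp [h.le]), tiltWeight_zero_right, hE]; rfl
    · have hv0 : v ≠ 0 := fun h' => absurd (hv.1 h') (not_lt.2 h.le)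
      rw [cutWeight, if_neg (by simp [hv0]), tiltWeight_eq hm, ← mul_assoc, hE, one_mul]
      exact one_le_pow₀ (one_le_tiltBase h1 m h.le)
  · rw [indicator_of_notMem hv]
    exact mul_nonneg (Real.exp_pos _).le (cutWeight_nonneg _ _ _ _)

lemma stepOp_iterate_devStates_le {p a : ℝ} (h0 : 0 ≤ p) (h1 : p < 1) (ha : a ≠ 1) {k m : ℕ}
    (hkm : k ≤ m) (hpos : ∀ j ≤ m, 0 < tiltBase p a j) :
    (stepOp p)^[m - k] (indicator (devStates a) 1) ≤
      fun v => Real.exp (-tiltLog p a m) * cutWeight p a k v := by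
  refine le_trans (stepOp_iterate_mono h0 h1.le _
    (indicator_devStates_le h1 m ha (hpos m le_rfl))) ?_
  rw [stepOp_iterate_smul]
  intro v
  refine mul_le_mul_of_nonneg_left ?_ (Real.exp_pos _).le
  have := stepOp_iterate_cutWeight_le h0 h1 k (m - k) (a := a) (by
    intro j hj; exact hpos j (by omega)) v
  rwa [Nat.add_sub_cancel' hkm] at this

/-- The deviation probability of the chain is at most exponentially small. -/
lemma stepOp_iterate_devStates_le_pow {p a : ℝ} (h0 : 0 ≤ p) (h1 : p < 1) (ha0 : 0 < a)
    (ha : a ≠ 1) (m n : ℕ) (hpos : ∀ j ≤ m, 0 < tiltBase p a j) :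
    (stepOp p)^[m] (indicator (devStates a) 1) n ≤ Real.exp (-tiltLog p a m) * a ^ n := by
  have := stepOp_iterate_devStates_le h0 h1 ha (Nat.zero_le m) hpos n
  refine this.trans (mul_le_mul_of_nonneg_left ?_ (Real.exp_pos _).le)
  rw [← tiltWeight_zero_left (p := p) ha0]
  exact cutWeight_le _ _ _ _

/-- The ratio of two weights on a tail. -/
def tiltRatio (p a a' r : ℝ) (k : ℕ) : ℝ :=
  Real.exp (r * (Real.log (tiltBase p a k) - Real.log (tiltBase p a' k)) +
    (tiltLog p a k - tiltLog p a' k))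

/-- `v` lies beyond `r`, on the side to which `a'` tilts more than `a`. -/
def InTail (a a' r : ℝ) (v : ℕ) : Prop := (a < a' ∧ r ≤ v) ∨ (a' < a ∧ (v : ℝ) ≤ r)

lemma tiltWeight_le_of_inTail {p a a' r : ℝ} (h1 : p < 1) {k v : ℕ} (hk : 0 < tiltBase p a k)
    (hk' : 0 < tiltBase p a' k) (hv : InTail a a' r v) :
    tiltWeight p a k v ≤ tiltRatio p a a' r k * tiltWeight p a' k v := by
  rw [tiltWeight, tiltRatio, tiltWeight, ← Real.exp_add, Real.exp_le_exp]
  rcases hv with ⟨h, hv⟩ | ⟨h, hv⟩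
  · have := Real.log_le_log hk (tiltBase_mono h1 k h.le)
    nlinarith
  · have := Real.log_le_log hk' (tiltBase_mono h1 k h.le)
    nlinarith

/-- The probability of the deviation together with a tail at time `k`. -/
lemma stepOp_iterate_tail_le {p a a' r : ℝ} (h0 : 0 ≤ p) (h1 : p < 1) (ha : a ≠ 1) (ha' : 0 < a')
    (hside : 1 < a ↔ 1 < a') {k m : ℕ} (n : ℕ) (hkm : k ≤ m)
    (hpos : ∀ j ≤ m, 0 < tiltBase p a j) (hpos' : ∀ j ≤ k, 0 < tiltBase p a' j) :
    (stepOp p)^[k] (indicator {v | InTail a a' r v}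
        ((stepOp p)^[m - k] (indicator (devStates a) 1))) n ≤
      Real.exp (-tiltLog p a m) * (tiltRatio p a a' r k * a' ^ n) := by
  have key : indicator {v | InTail a a' r v} ((stepOp p)^[m - k] (indicator (devStates a) 1)) ≤
      fun v => (Real.exp (-tiltLog p a m) * tiltRatio p a a' r k) * cutWeight p a' k v := by
    intro v
    have hR : 0 < tiltRatio p a a' r k := Real.exp_pos _
    by_cases hv : InTail a a' r v
    · rw [indicator_of_mem (show v ∈ {v | InTail a a' r v} from hv)]
      refine (stepOp_iterate_devStates_le h0 h1 ha hkm hpos v).trans ?_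
      dsimp only
      rw [mul_assoc]
      refine mul_le_mul_of_nonneg_left ?_ (Real.exp_pos _).le
      unfold cutWeight
      -- Both parameters are on the same side of `1`, so the two cut weights vanish together at `0`.
      simp only [← hside]
      split_ifs
      · simp
      · exact tiltWeight_le_of_inTail h1 (hpos k hkm) (hpos' k le_rfl) hv
    · rw [indicator_of_notMem (show v ∉ {v | InTail a a' r v} from hv)]
      exact mul_nonneg (mul_pos (Real.exp_pos _) hR).le (cutWeight_nonneg _ _ _ _)
  refine (stepOp_iterate_mono h0 h1.le k key n).trans ?_
  rw [stepOp_iterate_smul]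
  dsimp only
  rw [mul_assoc]
  refine mul_le_mul_of_nonneg_left (mul_le_mul_of_nonneg_left ?_ (Real.exp_pos _).le)
    (Real.exp_pos _).le
  have := stepOp_iterate_cutWeight_le h0 h1 0 k (a := a') (by simpa using hpos') n
  rw [zero_add] at this
  refine this.trans ((cutWeight_le _ _ _ _).trans ?_)
  rw [tiltWeight_zero_left ha']

/-- Under the tilted law, the chain is alive and below `r` at time `m` up to two error terms. -/
lemma le_stepOp_iterate_tiltWeight {p a a₁ a₂ r : ℝ} (h0 : 0 ≤ p) (h1 : p < 1) (ha₁ : 0 < a₁)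
    (h₁ : a₁ < a) (h₂ : a < a₂) {m : ℕ} (n : ℕ) (hpos : ∀ j ≤ m, 0 < tiltBase p a₁ j) :
    a ^ n - ((m : ℝ) + 1) * (tiltRatio p a a₁ 0 m * a₁ ^ n) - tiltRatio p a a₂ r m * a₂ ^ n ≤
      (stepOp p)^[m] (indicator {v | 0 < v ∧ (v : ℝ) < r} (tiltWeight p a m)) n := by
  set R₁ := tiltRatio p a a₁ 0 m with hR₁
  set R₂ := tiltRatio p a a₂ r m with hR₂
  have hR₁0 : 0 < R₁ := Real.exp_pos _
  have hR₂0 : 0 < R₂ := Real.exp_pos _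
  have hpa : ∀ j ≤ m, 0 < tiltBase p a j := fun j hj =>
    (hpos j hj).trans_le (tiltBase_mono h1 j h₁.le)
  have hp2 : ∀ j ≤ m, 0 < tiltBase p a₂ j := fun j hj =>
    (hpa j hj).trans_le (tiltBase_mono h1 j h₂.le)
  set g := indicator {v : ℕ | 0 < v ∧ (v : ℝ) < r} (tiltWeight p a m) with hg
  -- `F` is subharmonic away from `0`, nonpositive at `0`, and below the target at time `m`: the
  -- `a₁`-term pays for absorption and the `a₂`-term for states from `r` upwards. The coefficient `m
  -- - k + 1` allows one error per absorption time; being polynomial, it does no harm.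
  set F : ℕ → ℕ → ℝ := fun k v => tiltWeight p a k v -
    ((m : ℝ) - k + 1) * R₁ * tiltWeight p a₁ k v - R₂ * tiltWeight p a₂ k v with hF
  -- Each base for `a` is at least that for `a₁`, so the ratio of the products increases in `k`, and
  -- `R₁` is its value at `m`.
  have hlog : ∀ k ≤ m, Real.exp (tiltLog p a k) ≤ R₁ * Real.exp (tiltLog p a₁ k) := by
    intro k hk
    rw [hR₁, tiltRatio, ← Real.exp_add, Real.exp_le_exp]
    have : ∀ j ∈ Finset.range m \ Finset.range k,
        Real.log (tiltBase p a₁ j) ≤ Real.log (tiltBase p a j) := fun j hj => by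
      simp only [Finset.mem_sdiff, Finset.mem_range] at hj
      exact Real.log_le_log (hpos j hj.1.le) (tiltBase_mono h1 j h₁.le)
    have h3 := Finset.sum_le_sum this
    have hsub : Finset.range k ⊆ Finset.range m := Finset.range_mono hk
    rw [Finset.sum_sdiff_eq_sub hsub, Finset.sum_sdiff_eq_sub hsub] at h3
    unfold tiltLog
    linarith
  have hF0 : ∀ k ≤ m, F k 0 ≤ 0 := by
    intro k hk
    simp only [hF, tiltWeight_zero_right]
    have e1 := hlog k hk
    have e2 : (0 : ℝ) ≤ (m : ℝ) - k := by
      have : (k : ℝ) ≤ m := by exact_mod_cast hk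
      linarith
    have e3 : 0 < Real.exp (tiltLog p a₁ k) := Real.exp_pos _
    have e4 : 0 < Real.exp (tiltLog p a₂ k) := Real.exp_pos _
    have e5 : 0 ≤ ((m : ℝ) - k) * (R₁ * Real.exp (tiltLog p a₁ k)) := by positivity
    have e6 : 0 < R₂ * Real.exp (tiltLog p a₂ k) := by positivity
    nlinarith
  have hend : F m ≤ g := by
    intro v
    by_cases hv0 : v = 0
    · subst hv0
      refine (hF0 m le_rfl).trans_eq ?_
      simp [hg]
    have p1 : 0 < R₁ * tiltWeight p a₁ m v := mul_pos hR₁0 (tiltWeight_pos _ _ _ _)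
    have p2 : 0 < R₂ * tiltWeight p a₂ m v := mul_pos hR₂0 (tiltWeight_pos _ _ _ _)
    by_cases hv : (v : ℝ) < r
    · rw [hg, indicator_of_mem (show v ∈ {v : ℕ | 0 < v ∧ (v : ℝ) < r} from
        ⟨Nat.pos_of_ne_zero hv0, hv⟩)]
      simp only [hF]
      nlinarith
    · rw [hg, indicator_of_notMem (fun h => hv h.2)]
      have := tiltWeight_le_of_inTail h1 (hpa m le_rfl) (hp2 m le_rfl)
        (Or.inl ⟨h₂, not_lt.1 hv⟩ : InTail a a₂ r v)
      simp only [hF]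
      nlinarith
  have main : ∀ d ≤ m, F (m - d) ≤ (stepOp p)^[d] g := by
    intro d
    induction d with
    | zero => intro _; exact hend
    | succ d ih =>
      intro hd
      rw [Function.iterate_succ_apply']
      intro v
      cases v with
      | zero =>
        rw [stepOp, stepOp_iterate_zero]
        refine (hF0 _ (by omega)).trans_eq ?_
        simp [hg]
      | succ v =>
        refine le_trans ?_ (stepOp_mono h0 h1.le (ih (by omega)) (v + 1))
        obtain ⟨k, hk⟩ : ∃ k, m - d = k + 1 := ⟨m - d - 1, by omega⟩
        have hk' : m - (d + 1) = k := by omega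
        rw [hk, hk']
        simp only [hF]
        rw [stepOp_sub, stepOp_sub, stepOp_smul, stepOp_smul]
        dsimp only
        rw [stepOp_tiltWeight h1 (hpa _ (by omega)) (hpa _ (by omega)),
          stepOp_tiltWeight h1 (hpos _ (by omega)) (hpos _ (by omega)),
          stepOp_tiltWeight h1 (hp2 _ (by omega)) (hp2 _ (by omega))]
        have : 0 < R₁ * tiltWeight p a₁ k (v + 1) := mul_pos hR₁0 (tiltWeight_pos _ _ _ _)
        push_cast
        nlinarith
  have := main m le_rfl n
  rw [Nat.sub_self] at this
  refine le_trans (le_of_eq ?_) this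
  simp only [hF]
  rw [tiltWeight_zero_left (ha₁.trans h₁), tiltWeight_zero_left ha₁,
    tiltWeight_zero_left (ha₁.trans (h₁.trans h₂))]
  push_cast
  ring

/-! ### Reduction of the greedy algorithm to the chain -/

section Run

open scoped ENNReal

/-- The expectation of a function under a `PMF`. -/
def pmfExp {α : Type*} (μ : PMF α) (f : α → ℝ≥0∞) : ℝ≥0∞ := ∑' a, μ a * f a

lemma pmfExp_bind {α β : Type*} (μ : PMF α) (κ : α → PMF β) (f : β → ℝ≥0∞) :
    pmfExp (μ.bind κ) f = pmfExp μ fun a => pmfExp (κ a) f := by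
  simp only [pmfExp, PMF.bind_apply, ← ENNReal.tsum_mul_right, ← ENNReal.tsum_mul_left]
  rw [ENNReal.tsum_comm]
  simp only [mul_assoc]

lemma pmfExp_pure {α : Type*} (a : α) (f : α → ℝ≥0∞) : pmfExp (PMF.pure a) f = f a := by
  rw [pmfExp, tsum_eq_single a]
  · simp
  · intro b hb; simp [hb]

lemma pmfExp_map {α β : Type*} (μ : PMF α) (g : α → β) (f : β → ℝ≥0∞) :
    pmfExp (μ.map g) f = pmfExp μ fun a => f (g a) := by
  rw [← PMF.bind_pure_comp, pmfExp_bind]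
  simp only [Function.comp, pmfExp_pure]

lemma pmfExp_uniformOfFinset {α : Type*} (s : Finset α) (hs : s.Nonempty) (f : α → ℝ≥0∞) :
    pmfExp (PMF.uniformOfFinset s hs) f = ∑ a ∈ s, (s.card : ℝ≥0∞)⁻¹ * f a := by
  rw [pmfExp, tsum_eq_sum (s := s)]
  · exact Finset.sum_congr rfl fun a ha => by rw [PMF.uniformOfFinset_apply, if_pos ha]
  · intro a ha; rw [PMF.uniformOfFinset_apply, if_neg ha, zero_mul]

lemma pmfExp_congr {α : Type*} (μ : PMF α) {f g : α → ℝ≥0∞} (h : ∀ a ∈ μ.support, f a = g a) :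
    pmfExp μ f = pmfExp μ g := by
  refine tsum_congr fun a => ?_
  by_cases ha : a ∈ μ.support
  · rw [h a ha]
  · rw [(PMF.apply_eq_zero_iff μ a).2 ha, zero_mul, zero_mul]

lemma pmfExp_indicator {α : Type*} (μ : PMF α) (s : Set α) :
    pmfExp μ (indicator s 1) = μ.toOuterMeasure s := by
  rw [PMF.toOuterMeasure_apply]
  refine tsum_congr fun a => ?_
  by_cases ha : a ∈ s <;> simp [ha]

variable {n : ℕ}

open Classical in
/-- The vertices of `A` that remain available once `v` is selected. -/
def availNext (G : SimpleGraph (Fin n)) (A : Finset (Fin n)) (v : Fin n) : Finset (Fin n) :=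
  A.filter fun w => w ≠ v ∧ ¬ G.Adj v w

lemma mem_availNext {G : SimpleGraph (Fin n)} {A : Finset (Fin n)} {v w : Fin n} :
    w ∈ availNext G A v ↔ w ∈ A ∧ w ≠ v ∧ ¬ G.Adj v w := by
  simp [availNext]

lemma availNext_subset (G : SimpleGraph (Fin n)) (A : Finset (Fin n)) (v : Fin n) :
    availNext G A v ⊆ A := fun _ h => (mem_availNext.1 h).1

lemma greedyAvail_nil (G : SimpleGraph (Fin n)) : greedyAvail G [] = Finset.univ := by
  simp [greedyAvail]

lemma greedyAvail_append (G : SimpleGraph (Fin n)) (l : List (Fin n)) (v : Fin n) :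
    greedyAvail G (l ++ [v]) = availNext G (greedyAvail G l) v := by
  ext w
  simp only [greedyAvail, availNext, Finset.mem_filter, Finset.mem_univ, true_and, List.mem_append,
    List.mem_singleton, or_imp, forall_and, not_or, forall_eq]
  tauto

lemma greedyAvail_anti (G : SimpleGraph (Fin n)) {l l' : List (Fin n)} (h : l ⊆ l') :
    greedyAvail G l' ⊆ greedyAvail G l := by
  intro w
  simp only [greedyAvail, Finset.mem_filter, Finset.mem_univ, true_and]
  exact fun hw => ⟨fun hl => hw.1 (h hl), fun v hv => hw.2 v (h hv)⟩

lemma numAvail_antitone (ω : SimpleGraph (Fin n) × List (Fin n)) : Antitone (numAvail ω) :=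
  fun _ _ h => Finset.card_le_card (greedyAvail_anti _ (List.take_subset_take_left _ h))

open Classical in
/-- The probability that a greedy run on `G` from the available set `A`, at time `j`, has
`i`-th size in `S i` for `j ≤ i ≤ j + r`. -/
def runVal (G : SimpleGraph (Fin n)) (S : ℕ → Set ℕ) : ℕ → ℕ → Finset (Fin n) → ℝ≥0∞
  | 0, j, A => indicator (S j) 1 A.card
  | r + 1, j, A => indicator (S j) 1 A.card *
      if A.Nonempty then ∑ v ∈ A, (A.card : ℝ≥0∞)⁻¹ * runVal G S r (j + 1) (availNext G A v)
      else runVal G S r (j + 1) A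

/-- A run is shorter than the number of steps only if it has stopped. In either case `l.take k = l`,
so the available set read off the prefix is the current one. -/
lemma greedyRun_support (G : SimpleGraph (Fin n)) (k : ℕ) {l : List (Fin n)}
    (hl : l ∈ (greedyRun G k).support) : l.length = k ∨ (greedyAvail G l = ∅ ∧ l.length ≤ k) := by
  induction k generalizing l with
  | zero =>
    simp only [greedyRun, PMF.support_pure, mem_singleton_iff] at hl
    simp [hl]
  | succ k ih =>
    rw [greedyRun, PMF.mem_support_bind_iff] at hl
    obtain ⟨l₀, h₀, hl⟩ := hl
    unfold greedyStep at hl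
    split_ifs at hl with h
    · rw [PMF.mem_support_map_iff] at hl
      obtain ⟨v, -, rfl⟩ := hl
      rcases ih h₀ with h1 | h1
      · left; simp [h1]
      · simp [h1.1] at h
    · simp only [PMF.support_pure, mem_singleton_iff] at hl
      subst hl
      refine Or.inr ⟨Finset.not_nonempty_iff_eq_empty.1 h, ?_⟩
      rcases ih h₀ with h1 | h1 <;> omega

open Classical in
/-- The indicator that the sizes before time `k` are in the sets `S i`. -/
def prefixInd (G : SimpleGraph (Fin n)) (S : ℕ → Set ℕ) (k : ℕ) (l : List (Fin n)) : ℝ≥0∞ :=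
  if ∀ i < k, (greedyAvail G (l.take i)).card ∈ S i then 1 else 0

lemma prefixInd_succ (G : SimpleGraph (Fin n)) (S : ℕ → Set ℕ) (k : ℕ) (l : List (Fin n)) :
    prefixInd G S (k + 1) l =
      prefixInd G S k l * indicator (S k) 1 (greedyAvail G (l.take k)).card := by
  classical
  simp only [prefixInd, Nat.forall_lt_succ_right, indicator_apply]
  split_ifs <;> simp_all

/-- `greedyRun` adds steps at the end of the run, whereas `runVal` unfolds them from the beginning.
Taking the first `k` steps from the law and the other `r` from the value function interpolates
between the two. -/
lemma pmfExp_greedyRun (G : SimpleGraph (Fin n)) (S : ℕ → Set ℕ) (k r : ℕ) :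
    pmfExp (greedyRun G k) (fun l => prefixInd G S k l * runVal G S r k (greedyAvail G l)) =
      runVal G S (k + r) 0 Finset.univ := by
  induction k generalizing r with
  | zero => simp [greedyRun, pmfExp_pure, prefixInd, greedyAvail_nil]
  | succ k ih =>
    rw [show k + 1 + r = k + (r + 1) by ring, ← ih, greedyRun, pmfExp_bind]
    refine pmfExp_congr _ fun l hl => ?_
    have hlen : l.length ≤ k := by rcases greedyRun_support G k hl with h | h <;> omega
    have htake : l.take k = l := List.take_of_length_le hlen
    unfold greedyStep
    split_ifs with h
    · have hk : l.length = k := by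
        rcases greedyRun_support G k hl with h' | h'
        · exact h'
        · simp [h'.1] at h
      have hpre : ∀ v : Fin n, prefixInd G S (k + 1) (l ++ [v]) =
          prefixInd G S k l * indicator (S k) 1 (greedyAvail G l).card := by
        intro v
        rw [← congrArg (greedyAvail G) htake, ← prefixInd_succ]
        unfold prefixInd
        congr 1
        refine propext (forall₂_congr fun i hi => ?_)
        rw [List.take_append_of_le_length (by omega)]
      rw [pmfExp_map, pmfExp_uniformOfFinset, runVal, if_pos h, Finset.mul_sum, Finset.mul_sum]
      refine Finset.sum_congr rfl fun v _ => ?_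
      rw [hpre, greedyAvail_append]
      ring
    · rw [pmfExp_pure, prefixInd_succ, htake, runVal, if_neg h, mul_assoc]

lemma greedyRun_toOuterMeasure (G : SimpleGraph (Fin n)) (S : ℕ → Set ℕ) :
    (greedyRun G n).toOuterMeasure {l | ∀ i ≤ n, numAvail (G, l) i ∈ S i} =
      runVal G S n 0 Finset.univ := by
  classical
  rw [← pmfExp_indicator]
  have := pmfExp_greedyRun G S n 0
  rw [add_zero] at this
  rw [← this]
  refine pmfExp_congr _ fun l hl => ?_
  have hlen : l.length ≤ n := by rcases greedyRun_support G n hl with h | h <;> omega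
  rw [runVal, ← congrArg (greedyAvail G) (List.take_of_length_le hlen), ← prefixInd_succ,
    prefixInd, indicator_apply]
  simp only [Nat.lt_succ_iff, mem_ofPred_eq, Pi.one_apply, numAvail]
  congr

/-- A run from `A` only inspects edges with both ends in `A`. This is what makes the future
independent of the edges already revealed. -/
lemma runVal_congr {G G' : SimpleGraph (Fin n)} (S : ℕ → Set ℕ) (r j : ℕ) {A : Finset (Fin n)}
    (h : ∀ v ∈ A, ∀ w ∈ A, (G.Adj v w ↔ G'.Adj v w)) : runVal G S r j A = runVal G' S r j A := by
  induction r generalizing j A with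
  | zero => rfl
  | succ r ih =>
    rw [runVal, runVal]
    congr 1
    split_ifs
    · refine Finset.sum_congr rfl fun v hv => ?_
      have : availNext G A v = availNext G' A v := by
        ext w
        rw [mem_availNext, mem_availNext]
        exact and_congr_right fun hw => by rw [h v hv w hw]
      rw [this, ih]
      have hsub := availNext_subset G' A v
      exact fun x hx y hy => h x (hsub hx) y (hsub hy)
    · exact ih _ h

end Run


/-! ### Deferred decisions: averaging the run over the random edges -/

section RandomGraph

open scoped ENNReal
open ProbabilityTheory unitInterval

variable {n : ℕ}

/-- The law of the indicators of the possible edges. -/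
def edgeLaw (n : ℕ) (p : I) : Measure (Sym2 (Fin n) → Prop) :=
  Measure.infinitePi fun e : Sym2 (Fin n) =>
    toNNReal p • Measure.dirac (e ∈ (Sym2.diagSet : Set (Sym2 (Fin n)))ᶜ) +
      toNNReal (σ p) • Measure.dirac False

/-- The graph with given edge indicators. -/
def edgeGraph (η : Sym2 (Fin n) → Prop) : SimpleGraph (Fin n) := .fromEdgeSet {e | η e}

lemma edgeGraph_adj {η : Sym2 (Fin n) → Prop} {v w : Fin n} :
    (edgeGraph η).Adj v w ↔ η s(v, w) ∧ v ≠ w := by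
  simp [edgeGraph]

lemma lintegral_binomialRandom (p : I) (f : SimpleGraph (Fin n) → ℝ≥0∞) :
    ∫⁻ G, f G ∂(SimpleGraph.binomialRandom (Fin n) p) = ∫⁻ η, f (edgeGraph η) ∂edgeLaw n p := by
  have hm : Measurable fun p : Sym2 (Fin n) → Prop => {i | p i} := Measurable.of_discrete
  rw [SimpleGraph.binomialRandom_eq_map, setBernoulli_eq_map,
    Measure.map_map SimpleGraph.measurable_fromEdgeSet hm,
    lintegral_map (measurable_of_countable f) (SimpleGraph.measurable_fromEdgeSet.comp hm)]
  rfl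

instance edgeLaw_isProbabilityMeasure (p : I) : IsProbabilityMeasure (edgeLaw n p) := by
  unfold edgeLaw; infer_instance

lemma iIndepFun_edgeLaw (p : I) :
    iIndepFun (fun (e : Sym2 (Fin n)) (η : Sym2 (Fin n) → Prop) => η e) (edgeLaw n p) :=
  iIndepFun_infinitePi (X := fun _ x => x) fun _ => measurable_id

/-- The edges between `v` and the set `U`. -/
def edgeStar (v : Fin n) (U : Finset (Fin n)) : Finset (Sym2 (Fin n)) := U.image fun w => s(v, w)

lemma mem_edgeStar {v w : Fin n} {U : Finset (Fin n)} : s(v, w) ∈ edgeStar v U ↔ w ∈ U := by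
  simp only [edgeStar, Finset.mem_image, Sym2.congr_right, exists_eq_right]

lemma forall_mem_edgeStar {v : Fin n} {U : Finset (Fin n)} {P : Sym2 (Fin n) → Prop} :
    (∀ e ∈ edgeStar v U, P e) ↔ ∀ w ∈ U, P s(v, w) := by
  simp only [edgeStar, Finset.forall_mem_image]

lemma availNext_eq_iff {η : Sym2 (Fin n) → Prop} {A B : Finset (Fin n)} {v : Fin n}
    (hB : B ⊆ A.erase v) :
    availNext (edgeGraph η) A v = B ↔
      η ∈ Set.pi (edgeStar v (A.erase v) : Set (Sym2 (Fin n)))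
        fun e => {x : Prop | x ↔ e ∈ edgeStar v (A.erase v \ B)} := by
  simp only [Set.mem_pi, Finset.mem_coe, mem_ofPred_eq]
  rw [forall_mem_edgeStar]
  simp only [mem_edgeStar]
  constructor
  · rintro rfl w hw
    rw [Finset.mem_erase] at hw
    simp only [Finset.mem_sdiff, Finset.mem_erase, mem_availNext, edgeGraph_adj]
    have := hw.1
    have := hw.1.symm
    tauto
  · intro h
    ext w
    rw [mem_availNext, edgeGraph_adj]
    constructor
    · rintro ⟨h1, h2, h3⟩
      have := h w (Finset.mem_erase.2 ⟨h2, h1⟩)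
      have h4 := h2.symm
      simp only [Finset.mem_sdiff, Finset.mem_erase] at this
      tauto
    · intro hw
      have h1 := hB hw
      have := h w h1
      rw [Finset.mem_erase] at h1
      simp only [Finset.mem_sdiff, Finset.mem_erase] at this
      tauto

lemma edgeLaw_availNext (p : I) {A B : Finset (Fin n)} {v : Fin n} (hB : B ⊆ A.erase v) :
    edgeLaw n p {η | availNext (edgeGraph η) A v = B} =
      ENNReal.ofReal ((1 - p : ℝ) ^ B.card * (p : ℝ) ^ ((A.erase v).card - B.card)) := by
  classical
  have : {η : Sym2 (Fin n) → Prop | availNext (edgeGraph η) A v = B} =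
      Set.pi (edgeStar v (A.erase v) : Set (Sym2 (Fin n)))
        fun e => {x : Prop | x ↔ e ∈ edgeStar v (A.erase v \ B)} := by
    ext η; exact availNext_eq_iff hB
  rw [this, edgeLaw, Measure.infinitePi_pi _ (fun _ _ => MeasurableSet.of_discrete), edgeStar,
    Finset.prod_image (fun x _ y _ h => Sym2.congr_right.1 h)]
  have hval : ∀ w ∈ A.erase v,
      (toNNReal p • Measure.dirac (s(v, w) ∈ (Sym2.diagSet : Set (Sym2 (Fin n)))ᶜ) +
        toNNReal (σ p) • Measure.dirac False : Measure Prop)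
          {x : Prop | x ↔ s(v, w) ∈ edgeStar v (A.erase v \ B)} =
        if w ∈ B then ENNReal.ofReal (1 - p) else ENNReal.ofReal p := by
    intro w hw
    have hvw : v ≠ w := (Finset.ne_of_mem_erase hw).symm
    have e1 : ((toNNReal p : NNReal) : ℝ≥0∞) = ENNReal.ofReal p := by
      rw [ENNReal.ofReal, unitInterval.toNNReal, Real.toNNReal_of_nonneg p.2.1]
      rfl
    have e2 : ((toNNReal (σ p) : NNReal) : ℝ≥0∞) = ENNReal.ofReal (1 - p) := by
      rw [ENNReal.ofReal, unitInterval.toNNReal, Real.toNNReal_of_nonneg (by linarith [p.2.2])]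
      rfl
    rw [Measure.add_apply, Measure.smul_apply, Measure.smul_apply,
      Measure.dirac_apply' _ MeasurableSet.of_discrete,
      Measure.dirac_apply' _ MeasurableSet.of_discrete, ← e1, ← e2]
    simp only [mem_edgeStar, Finset.mem_sdiff, hw, true_and]
    by_cases hwB : w ∈ B <;> simp [hwB, hvw, ENNReal.smul_def]
  rw [Finset.prod_congr rfl hval, Finset.prod_ite, Finset.prod_const, Finset.prod_const,
    Finset.filter_mem_eq_inter, Finset.inter_eq_right.2 hB, Finset.filter_notMem_eq_sdiff,
    Finset.card_sdiff_of_subset hB, ENNReal.ofReal_mul (pow_nonneg (by linarith [p.2.2]) _),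
    ENNReal.ofReal_pow (by linarith [p.2.2]), ENNReal.ofReal_pow p.2.1]

/-- The first function depends on the edges from `v` into `A`, the second on the edges inside `B`,
which does not contain `v`. -/
lemma indepFun_availNext_runVal (p : I) (S : ℕ → Set ℕ) (r j : ℕ) {A B : Finset (Fin n)} {v : Fin n}
    (hB : B ⊆ A.erase v) :
    IndepFun (fun η => indicator {η | availNext (edgeGraph η) A v = B} (1 : (Sym2 (Fin n) → Prop) → ℝ≥0∞) η)
      (fun η => runVal (edgeGraph η) S r j B) (edgeLaw n p) := by
  classical
  have hdisj : Disjoint (edgeStar v (A.erase v)) B.sym2 := by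
    rw [Finset.disjoint_left]
    intro e he he'
    simp only [edgeStar, Finset.mem_image] at he
    obtain ⟨w, -, rfl⟩ := he
    rw [Finset.mk_mem_sym2_iff] at he'
    exact Finset.notMem_erase v A (hB he'.1)
  have hind := (iIndepFun_edgeLaw (n := n) p).indepFun_finset _ _ hdisj
    (fun _ => Measurable.of_discrete)
  -- The other coordinates are filled with `False`; neither function sees them.
  let φ : (edgeStar v (A.erase v) → Prop) → ℝ≥0∞ := fun x =>
    indicator {η | availNext (edgeGraph η) A v = B} 1
      (fun e => if h : e ∈ edgeStar v (A.erase v) then x ⟨e, h⟩ else False)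
  let ψ : (B.sym2 → Prop) → ℝ≥0∞ := fun x =>
    runVal (edgeGraph (fun e => if h : e ∈ B.sym2 then x ⟨e, h⟩ else False)) S r j B
  have := hind.comp (φ := φ) (ψ := ψ) Measurable.of_discrete Measurable.of_discrete
  convert this using 1
  · funext η
    simp only [φ, Function.comp, indicator_apply, mem_ofPred_eq, availNext_eq_iff hB, Set.mem_pi]
    refine if_congr (forall₂_congr fun e he => ?_) rfl rfl
    simp only [Finset.mem_coe] at he
    simp [he]
  · funext η
    refine runVal_congr S r j fun x hx y hy => ?_
    rw [edgeGraph_adj, edgeGraph_adj, dif_pos (Finset.mk_mem_sym2_iff.2 ⟨hx, hy⟩)]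

/-- The probability that the chain started from `v` at time `j` is in `S i` for
`j ≤ i ≤ j + r`. -/
def chainVal (p : ℝ) (S : ℕ → Set ℕ) : ℕ → ℕ → ℕ → ℝ
  | 0, j => indicator (S j) 1
  | r + 1, j => indicator (S j) (stepOp p (chainVal p S r (j + 1)))

lemma chainVal_nonneg {p : ℝ} (h0 : 0 ≤ p) (h1 : p ≤ 1) (S : ℕ → Set ℕ) (r j v : ℕ) :
    0 ≤ chainVal p S r j v := by
  induction r generalizing j v with
  | zero => exact indicator_nonneg (fun _ _ => zero_le_one) _
  | succ r ih =>
    refine indicator_nonneg (fun v _ => ?_) _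
    have := stepOp_mono h0 h1 (f := fun _ => 0) (fun v => ih (j + 1) v) v
    refine le_trans (le_of_eq ?_) this
    cases v <;> simp [stepOp]

/-- Deferred decisions: the mean of `runVal` over the random graph depends on the size of the
available set only, and is given by the chain. -/
lemma lintegral_runVal (p : I) (S : ℕ → Set ℕ) (r j : ℕ) (A : Finset (Fin n)) :
    ∫⁻ η, runVal (edgeGraph η) S r j A ∂edgeLaw n p =
      ENNReal.ofReal (chainVal p S r j A.card) := by
  classical
  have hp0 : (0 : ℝ) ≤ p := p.2.1
  have hp1 : (0 : ℝ) ≤ 1 - p := by linarith [p.2.2]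
  induction r generalizing j A with
  | zero =>
    simp only [runVal, lintegral_const, measure_univ, mul_one, chainVal]
    by_cases h : A.card ∈ S j <;> simp [h]
  | succ r ih =>
    have key : A.card ∈ S j → ∫⁻ η, (if A.Nonempty then ∑ v ∈ A, (A.card : ℝ≥0∞)⁻¹ *
        runVal (edgeGraph η) S r (j + 1) (availNext (edgeGraph η) A v)
        else runVal (edgeGraph η) S r (j + 1) A) ∂edgeLaw n p =
        ENNReal.ofReal (stepOp p (chainVal p S r (j + 1)) A.card) := by
      intro _
      rcases A.eq_empty_or_nonempty with rfl | hA
      · simp only [Finset.not_nonempty_empty, if_false, ih]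
        rfl
      simp only [hA, if_true]
      rw [lintegral_finsetSum' _ fun _ _ => Measurable.of_discrete.aemeasurable]
      have hone : ∀ v ∈ A, ∫⁻ η, (A.card : ℝ≥0∞)⁻¹ *
          runVal (edgeGraph η) S r (j + 1) (availNext (edgeGraph η) A v) ∂edgeLaw n p =
          (A.card : ℝ≥0∞)⁻¹ * ENNReal.ofReal (stepOp p (chainVal p S r (j + 1)) A.card) := by
        intro v hv
        rw [lintegral_const_mul _ Measurable.of_discrete]
        congr 1
        -- Decomposition by the value `B` of the next available set, so that independence applies to
        -- each term.
        have hdec : ∀ η : Sym2 (Fin n) → Prop,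
            runVal (edgeGraph η) S r (j + 1) (availNext (edgeGraph η) A v) =
            ∑ B ∈ (A.erase v).powerset,
              (indicator {η | availNext (edgeGraph η) A v = B} (1 : (Sym2 (Fin n) → Prop) → ℝ≥0∞) *
                fun η => runVal (edgeGraph η) S r (j + 1) B) η := by
          intro η
          have hmem : availNext (edgeGraph η) A v ∈ (A.erase v).powerset := by
            rw [Finset.mem_powerset]
            intro w hw
            rw [mem_availNext] at hw
            exact Finset.mem_erase.2 ⟨hw.2.1, hw.1⟩
          rw [Finset.sum_eq_single_of_mem _ hmem]
          · simp
          · intro B _ hB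
            simp [hB.symm]
        simp only [hdec]
        rw [lintegral_finsetSum' _ fun _ _ => Measurable.of_discrete.aemeasurable]
        have hterm : ∀ B ∈ (A.erase v).powerset,
            ∫⁻ η, (indicator {η | availNext (edgeGraph η) A v = B} (1 : (Sym2 (Fin n) → Prop) → ℝ≥0∞) *
                fun η => runVal (edgeGraph η) S r (j + 1) B) η ∂edgeLaw n p =
            ENNReal.ofReal ((fun i => (1 - p : ℝ) ^ i * (p : ℝ) ^ ((A.erase v).card - i) *
              chainVal p S r (j + 1) i) B.card) := by
          intro B hB
          rw [Finset.mem_powerset] at hB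
          rw [lintegral_mul_eq_lintegral_mul_lintegral_of_indepFun Measurable.of_discrete
            Measurable.of_discrete (indepFun_availNext_runVal p S r (j + 1) hB),
            lintegral_indicator_one MeasurableSet.of_discrete, edgeLaw_availNext p hB, ih,
            ← ENNReal.ofReal_mul (by positivity)]
        rw [Finset.sum_congr rfl hterm, ← ENNReal.ofReal_sum_of_nonneg]
        -- Grouping the sets `B` by size produces the binomial coefficients of `stepOp`. The result
        -- does not depend on `v`, so the uniform choice of `v` averages a constant.
        · rw [Finset.sum_powerset_apply_card (fun i => (1 - p : ℝ) ^ i *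
            (p : ℝ) ^ ((A.erase v).card - i) * chainVal p S r (j + 1) i),
            ← Finset.card_erase_add_one hv, stepOp]
          congr 1
          refine Finset.sum_congr rfl fun i _ => ?_
          rw [nsmul_eq_mul]; ring
        · intro B _
          have := chainVal_nonneg hp0 p.2.2 S r (j + 1) B.card
          positivity
      rw [Finset.sum_congr rfl hone, Finset.sum_const, nsmul_eq_mul, ← mul_assoc,
        ENNReal.mul_inv_cancel (by simpa using hA.ne_empty) (by simp), one_mul]
    simp only [runVal]
    rw [lintegral_const_mul _ Measurable.of_discrete]
    by_cases h : A.card ∈ S j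
    · rw [key h, chainVal]; simp [h]
    · simp [chainVal, h]

lemma greedyLaw_toOuterMeasure (c : ℝ) (n : ℕ) (S : ℕ → Set ℕ) :
    (greedyLaw c n).toOuterMeasure {ω | ∀ i ≤ n, numAvail ω i ∈ S i} =
      ENNReal.ofReal (chainVal (edgeProb c n) S n 0 n) := by
  have h := lintegral_runVal (edgeProb c n) S n 0 (Finset.univ : Finset (Fin n))
  rw [Finset.card_univ, Fintype.card_fin] at h
  rw [← h, ← lintegral_binomialRandom (edgeProb c n) fun G => runVal G S n 0 Finset.univ,
    lintegral_countable', greedyLaw, PMF.toOuterMeasure_bind_apply]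
  refine tsum_congr fun G => ?_
  rw [PMF.toOuterMeasure_map_apply, mul_comm, Measure.toPMF_apply, ← greedyRun_toOuterMeasure]
  rfl

end RandomGraph

/-! ### Events of the algorithm as events of the chain -/

section Events

lemma chainVal_congr (p : ℝ) {S S' : ℕ → Set ℕ} (r j : ℕ)
    (h : ∀ i, j ≤ i → i ≤ j + r → S i = S' i) : chainVal p S r j = chainVal p S' r j := by
  induction r generalizing j with
  | zero => rw [chainVal, chainVal, h j le_rfl le_rfl]
  | succ r ih =>
    rw [chainVal, chainVal, h j le_rfl (by omega), ih (j + 1) fun i h1 h2 => h i (by omega) (by omega)]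

lemma chainVal_add_of_univ (p : ℝ) {S : ℕ → Set ℕ} (k r j : ℕ)
    (h : ∀ i, j ≤ i → i < j + k → S i = univ) :
    chainVal p S (k + r) j = (stepOp p)^[k] (chainVal p S r (j + k)) := by
  induction k generalizing j with
  | zero => simp
  | succ k ih =>
    rw [show k + 1 + r = k + r + 1 by ring, chainVal, h j le_rfl (by omega), indicator_univ,
      ih (j + 1) fun i h1 h2 => h i (by omega) (by omega), Function.iterate_succ_apply',
      show j + 1 + k = j + (k + 1) by ring]

lemma chainVal_univ (p : ℝ) (r j : ℕ) : chainVal p (fun _ => univ) r j = fun _ => 1 := by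
  have := chainVal_add_of_univ p (S := fun _ => univ) r 0 j (fun _ _ _ => rfl)
  rw [add_zero] at this
  rw [this, chainVal, indicator_univ]
  exact stepOp_iterate_one p r

lemma chainVal_eq_indicator (p : ℝ) {S S' : ℕ → Set ℕ} {A : Set ℕ} (r j : ℕ)
    (hA : S j = A ∩ S' j) (h : ∀ i, j < i → S i = S' i) :
    chainVal p S r j = indicator A (chainVal p S' r j) := by
  cases r with
  | zero => rw [chainVal, chainVal, hA, indicator_indicator]
  | succ r =>
    rw [chainVal, chainVal, hA, indicator_indicator,
      chainVal_congr p r (j + 1) fun i h1 _ => h i (by omega)]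

/-- The chain runs freely except for a cut at time `k` and one at time `m`; what follows `m` has
total mass `1`. The constraints are implications, so `k = m` needs no separate treatment. -/
lemma chainVal_two (p : ℝ) (A B : Set ℕ) {k m n : ℕ} (hkm : k ≤ m) (hmn : m ≤ n) :
    chainVal p (fun i => {v | (i = k → v ∈ A) ∧ (i = m → v ∈ B)}) n 0 =
      (stepOp p)^[k] (indicator A ((stepOp p)^[m - k] (indicator B 1))) := by
  have h1 := chainVal_add_of_univ p (S := fun i => {v | (i = k → v ∈ A) ∧ (i = m → v ∈ B)})
    k (n - k) 0 (fun i _ hi => by ext v; simp; omega)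
  rw [Nat.add_sub_cancel' (hkm.trans hmn), zero_add] at h1
  have h2 : chainVal p (fun i => {v | (i = k → v ∈ A) ∧ (i = m → v ∈ B)}) (n - k) k =
      indicator A (chainVal p (fun i => {v | i = m → v ∈ B}) (n - k) k) :=
    chainVal_eq_indicator p _ _ (by ext v; simp)
      fun i hi => by ext v; simp [hi.ne']
  have h3 := chainVal_add_of_univ p (S := fun i => {v | i = m → v ∈ B}) (m - k) (n - m) k
    (fun i _ hi => by ext v; simp; omega)
  rw [show m - k + (n - m) = n - k by omega, Nat.add_sub_cancel' hkm] at h3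
  have h4 : chainVal p (fun i => {v | i = m → v ∈ B}) (n - m) m =
      indicator B (chainVal p (fun _ => univ) (n - m) m) :=
    chainVal_eq_indicator p _ _ (by ext v; simp) fun i hi => by ext v; simp [hi.ne']
  rw [h1, h2, h3, h4, chainVal_univ]
  rfl

lemma edgeProb_coe {c : ℝ} {n : ℕ} (hc : 0 < c) (hn : c ≤ n) : (edgeProb c n : ℝ) = c / n := by
  have hn0 : (0 : ℝ) < n := hc.trans_le hn
  rw [edgeProb, Set.projIcc_of_mem zero_le_one ⟨by positivity, (div_le_one hn0).2 hn⟩]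

/-- The joint law of the numbers of available vertices at two times. -/
lemma greedyProb_two {c : ℝ} (hc : 0 < c) {k m n : ℕ} (hn : c ≤ n) (hkm : k ≤ m) (hmn : m ≤ n)
    (A B : Set ℕ) : greedyProb c n {ω | numAvail ω k ∈ A ∧ numAvail ω m ∈ B} =
      (stepOp (c / n))^[k] (indicator A ((stepOp (c / n))^[m - k] (indicator B 1))) n := by
  have hE : {ω : SimpleGraph (Fin n) × List (Fin n) | numAvail ω k ∈ A ∧ numAvail ω m ∈ B} =
      {ω | ∀ i ≤ n, numAvail ω i ∈ (fun i => {v | (i = k → v ∈ A) ∧ (i = m → v ∈ B)}) i} := by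
    ext ω
    simp only [mem_ofPred_eq]
    constructor
    · rintro ⟨h1, h2⟩ i _
      exact ⟨fun h => h ▸ h1, fun h => h ▸ h2⟩
    · intro h
      exact ⟨(h k (hkm.trans hmn)).1 rfl, (h m hmn).2 rfl⟩
  rw [greedyProb, hE, greedyLaw_toOuterMeasure, ENNReal.toReal_ofReal, chainVal_two _ _ _ hkm hmn,
    edgeProb_coe hc hn]
  exact chainVal_nonneg (edgeProb c n).2.1 (edgeProb c n).2.2 _ _ _ _

lemma greedyProb_one {c : ℝ} (hc : 0 < c) {m n : ℕ} (hn : c ≤ n) (hmn : m ≤ n)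
    (B : Set ℕ) : greedyProb c n {ω | numAvail ω m ∈ B} =
      (stepOp (c / n))^[m] (indicator B 1) n := by
  have := greedyProb_two hc hn le_rfl hmn univ B
  simpa using this

lemma greedyProb_ne_top (c : ℝ) (n : ℕ) (E : Set (SimpleGraph (Fin n) × List (Fin n))) :
    (greedyLaw c n).toOuterMeasure E ≠ ⊤ := by
  refine ne_top_of_le_ne_top ENNReal.one_ne_top ?_
  rw [PMF.toOuterMeasure_apply, ← (greedyLaw c n).tsum_coe]
  exact ENNReal.tsum_le_tsum fun a => indicator_le_self' (fun _ _ => zero_le) a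

lemma greedyProb_mono (c : ℝ) {n : ℕ} {E E' : Set (SimpleGraph (Fin n) × List (Fin n))}
    (h : E ⊆ E') : greedyProb c n E ≤ greedyProb c n E' :=
  ENNReal.toReal_mono (greedyProb_ne_top c n E') (measure_mono h)

lemma greedyProb_nonneg (c : ℝ) (n : ℕ) (E : Set (SimpleGraph (Fin n) × List (Fin n))) :
    0 ≤ greedyProb c n E := ENNReal.toReal_nonneg

lemma greedyProb_union_le (c : ℝ) {n : ℕ} (E E' : Set (SimpleGraph (Fin n) × List (Fin n))) :
    greedyProb c n (E ∪ E') ≤ greedyProb c n E + greedyProb c n E' := by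
  unfold greedyProb
  rw [← ENNReal.toReal_add (greedyProb_ne_top c n E) (greedyProb_ne_top c n E')]
  exact ENNReal.toReal_mono
    (ENNReal.add_ne_top.2 ⟨greedyProb_ne_top c n E, greedyProb_ne_top c n E'⟩) (measure_union_le _ _)

lemma greedyProb_numAvail_ne_zero {c : ℝ} (hc : 0 < c) {n : ℕ} (hn : c ≤ n) :
    greedyProb c n {ω | numAvail ω n ≠ 0} = 0 := by
  have h := greedyProb_one hc hn le_rfl {0}ᶜ
  refine h.trans ?_
  have : ∀ k (f g : ℕ → ℝ), (stepOp (c / n))^[k] (fun v => f v - g v) =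
      fun v => (stepOp (c / n))^[k] f v - (stepOp (c / n))^[k] g v := by
    intro k
    induction k with
    | zero => intros; rfl
    | succ k ih =>
      intro f g
      rw [Function.iterate_succ_apply, stepOp_sub, ih]; rfl
  have h2 : (indicator {0}ᶜ 1 : ℕ → ℝ) = fun v => (fun _ => 1) v - indicator {0} 1 v := by
    funext v
    by_cases hv : v = 0 <;> simp [hv]
  rw [h2, this, stepOp_iterate_one]
  dsimp only
  rw [stepOp_iterate_absorbed _ le_rfl, sub_self]

/-- The algorithm has stopped after `n` steps, so events may be compared on this event. -/
lemma greedyProb_congr {c : ℝ} (hc : 0 < c) {n : ℕ} (hn : c ≤ n)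
    {E E' : Set (SimpleGraph (Fin n) × List (Fin n))}
    (h : ∀ ω, numAvail ω n = 0 → (ω ∈ E ↔ ω ∈ E')) : greedyProb c n E = greedyProb c n E' := by
  have main : ∀ {E E' : Set (SimpleGraph (Fin n) × List (Fin n))},
      (∀ ω, numAvail ω n = 0 → (ω ∈ E ↔ ω ∈ E')) → greedyProb c n E ≤ greedyProb c n E' := by
    intro E E' h
    have hsub : E ⊆ E' ∪ {ω | numAvail ω n ≠ 0} := by
      intro ω hω
      by_cases h0 : numAvail ω n = 0
      · exact Or.inl ((h ω h0).1 hω)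
      · exact Or.inr h0
    have := (greedyProb_mono c hsub).trans (greedyProb_union_le c _ _)
    rwa [greedyProb_numAvail_ne_zero hc hn, add_zero] at this
  exact le_antisymm (main h) (main fun ω h0 => (h ω h0).symm)

/-- The time at which the deviation is decided. -/
def devTime (c : ℝ) (n : ℕ) (t : ℝ) : ℕ := if t < sCrit c then ⌊t * n⌋₊ else ⌈t * n⌉₊ - 1

/-- The hypothesis makes the infimum that of a nonempty set; otherwise it would take the default
value `0`. It holds almost surely. -/
lemma greedySize_le_iff {n : ℕ} {ω : SimpleGraph (Fin n) × List (Fin n)} (h : numAvail ω n = 0)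
    (m : ℕ) : greedySize ω ≤ m ↔ numAvail ω m = 0 := by
  have hne : {k : ℕ | numAvail ω k = 0}.Nonempty := ⟨n, h⟩
  constructor
  · intro hm
    have h0 : numAvail ω (greedySize ω) = 0 := Nat.sInf_mem hne
    have := numAvail_antitone ω hm
    omega
  · intro hm
    exact Nat.sInf_le hm

lemma mem_devEvent_iff {c t a : ℝ} {n : ℕ} (ht : 0 < t) (hn : 0 < n) (ha : a < 1 ↔ t < sCrit c)
    {ω : SimpleGraph (Fin n) × List (Fin n)} (h : numAvail ω n = 0) :
    ω ∈ devEvent c n t ↔ numAvail ω (devTime c n t) ∈ devStates a := by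
  have hn' : (0 : ℝ) < n := by exact_mod_cast hn
  simp only [devEvent, devTime, devStates, mem_ofPred_eq, ha]
  split_ifs with hlt
  · rw [← Nat.le_floor_iff (by positivity), greedySize_le_iff h]
    simp [hlt]
  -- `S_g ≥ ⌈tn⌉` is the failure of `S_g ≤ ⌈tn⌉ - 1`; positivity of the ceiling keeps the natural
  -- subtraction exact.
  · have h1 : 0 < ⌈t * n⌉₊ := Nat.ceil_pos.2 (by positivity)
    rw [← Nat.ceil_le, iff_false_right hlt, ← greedySize_le_iff h]
    omega

lemma greedyProb_devEvent {c t a : ℝ} (hc : 0 < c) {n : ℕ} (hn : c ≤ n) (ht : 0 < t)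
    (ha : a < 1 ↔ t < sCrit c) (hm : devTime c n t ≤ n) :
    greedyProb c n (devEvent c n t) =
      (stepOp (c / n))^[devTime c n t] (indicator (devStates a) 1) n := by
  have hn0 : 0 < n := by exact_mod_cast hc.trans_le hn
  rw [← greedyProb_one hc hn hm]
  exact greedyProb_congr hc hn fun ω h => mem_devEvent_iff ht hn0 ha h

lemma greedyProb_devEvent_inter {c t a : ℝ} (hc : 0 < c) {n : ℕ} (hn : c ≤ n) (ht : 0 < t)
    (ha : a < 1 ↔ t < sCrit c) {k : ℕ} (hk : k ≤ devTime c n t) (hm : devTime c n t ≤ n)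
    (A : Set ℕ) :
    greedyProb c n (devEvent c n t ∩ {ω | numAvail ω k ∈ A}) =
      (stepOp (c / n))^[k] (indicator A
        ((stepOp (c / n))^[devTime c n t - k] (indicator (devStates a) 1))) n := by
  have hn0 : 0 < n := by exact_mod_cast hc.trans_le hn
  rw [← greedyProb_two hc hn hk hm]
  refine greedyProb_congr hc hn fun ω h => ?_
  rw [mem_inter_iff, mem_devEvent_iff ht hn0 ha h, and_comm]
  rfl

end Events

/-! ### The parameter of the optimal trajectory -/

section Param

variable {c : ℝ}

lemma bParam_one (c : ℝ) : bParam c 1 = 1 := by simp [bParam]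

lemma hasDerivAt_bParam_exponent (c : ℝ) {a : ℝ} (ha : a ≠ 0) :
    HasDerivAt (fun a : ℝ => c * (1 - 1 / a)) (c / a ^ 2) a := by
  simp only [one_div]
  exact (((hasDerivAt_inv ha).const_sub 1).const_mul c).congr_deriv (by field_simp)

lemma hasDerivAt_bParam (c : ℝ) {a : ℝ} (ha : a ≠ 0) :
    HasDerivAt (bParam c) ((1 + c / a) * Real.exp (c * (1 - 1 / a))) a :=
  ((hasDerivAt_id a).mul (hasDerivAt_bParam_exponent c ha).exp).congr_deriv (by
    simp only [id]; field_simp)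

lemma hasDerivAt_deriv_bParam (c : ℝ) {a : ℝ} (ha : a ≠ 0) :
    HasDerivAt (fun a => (1 + c / a) * Real.exp (c * (1 - 1 / a)))
      (c ^ 2 / a ^ 3 * Real.exp (c * (1 - 1 / a))) a := by
  have h2 : HasDerivAt (fun a : ℝ => 1 + c / a) (-(c / a ^ 2)) a := by
    simp only [div_eq_mul_inv]
    exact (((hasDerivAt_inv ha).const_mul c).const_add 1).congr_deriv (by ring)
  exact (h2.mul (hasDerivAt_bParam_exponent c ha).exp).congr_deriv (by field_simp; ring)

/-- The second derivative is `c² a⁻³ e^{c(1-1/a)} > 0`. As `b = 1` at `a = 1`, the quotient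
`(b-1)/(a-1)` is a secant slope from that point and strictly increases in `a`. -/
lemma strictConvexOn_bParam (hc : 0 < c) : StrictConvexOn ℝ (Ioi 0) (bParam c) := by
  refine StrictMonoOn.strictConvexOn_of_deriv (convex_Ioi 0)
    (fun a ha => (hasDerivAt_bParam c (ne_of_gt ha)).continuousAt.continuousWithinAt) ?_
  rw [interior_Ioi]
  have : StrictMonoOn (fun a => (1 + c / a) * Real.exp (c * (1 - 1 / a))) (Ioi 0) := by
    refine strictMonoOn_of_deriv_pos (convex_Ioi 0)
      (fun a ha => (hasDerivAt_deriv_bParam c (ne_of_gt ha)).continuousAt.continuousWithinAt) ?_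
    intro a ha
    rw [interior_Ioi] at ha
    rw [(hasDerivAt_deriv_bParam c (ne_of_gt ha)).deriv]
    have : 0 < a := ha
    positivity
  exact this.congr fun a ha => (hasDerivAt_bParam c (ne_of_gt ha)).deriv.symm

/-- The slope of `bParam` from `1`. -/
def bSlope (c a : ℝ) : ℝ := (bParam c a - 1) / (a - 1)

lemma bSlope_eq_slope (c a : ℝ) : bSlope c a = slope (bParam c) 1 a := by
  rw [slope_def_field, bParam_one]; rfl

lemma bSlope_lt (hc : 0 < c) {a a' : ℝ} (ha0 : 0 < a) (ha : a ≠ 1) (ha' : a' ≠ 1) (h : a < a') :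
    bSlope c a < bSlope c a' := by
  have := (strictConvexOn_bParam hc).secant_strict_mono (a := 1) (x := a) (y := a')
    (mem_Ioi.2 one_pos) ha0 (ha0.trans h) ha ha' h
  rwa [bParam_one] at this

lemma hasDerivAt_bParam_one (c : ℝ) : HasDerivAt (bParam c) (1 + c) 1 := by
  simpa using hasDerivAt_bParam c one_ne_zero

lemma lt_bSlope (hc : 0 < c) {a : ℝ} (ha : 1 < a) : 1 + c < bSlope c a := by
  rw [bSlope_eq_slope]
  exact (strictConvexOn_bParam hc).lt_slope_of_hasDerivAt (mem_Ioi.2 one_pos)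
    (mem_Ioi.2 (one_pos.trans ha)) ha (hasDerivAt_bParam_one c)

lemma bSlope_lt_of_lt_one (hc : 0 < c) {a : ℝ} (ha0 : 0 < a) (ha : a < 1) :
    bSlope c a < 1 + c := by
  rw [bSlope_eq_slope, slope_comm]
  exact (strictConvexOn_bParam hc).slope_lt_of_hasDerivAt ha0
    (mem_Ioi.2 one_pos) ha (hasDerivAt_bParam_one c)

lemma bParam_pos {a : ℝ} (ha0 : 0 < a) : 0 < bParam c a := mul_pos ha0 (Real.exp_pos _)

lemma bParam_le_of_lt_one (hc : 0 < c) {a : ℝ} (ha0 : 0 < a) (ha : a < 1) : bParam c a ≤ a := by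
  refine mul_le_of_le_one_right ha0.le (Real.exp_le_one_iff.2 ?_)
  have : 1 < 1 / a := by rw [lt_div_iff₀ ha0]; linarith
  nlinarith

lemma bSlope_pos (hc : 0 < c) {a : ℝ} (ha0 : 0 < a) (ha : a ≠ 1) : 0 < bSlope c a := by
  rcases lt_or_gt_of_ne ha with h | h
  · have := bParam_le_of_lt_one hc ha0 h
    exact div_pos_of_neg_of_neg (by linarith) (by linarith)
  · linarith [lt_bSlope hc h]

/-- The density `s` whose parameter is `a`. -/
def paramTime (c a : ℝ) : ℝ := (1 / c) * Real.log (bSlope c a)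

lemma isParam_iff {s a : ℝ} : IsParam c s a ↔ 0 < a ∧ a ≠ 1 ∧ s = paramTime c a := Iff.rfl

lemma paramTime_lt (hc : 0 < c) {a a' : ℝ} (ha0 : 0 < a) (ha : a ≠ 1) (ha' : a' ≠ 1) (h : a < a') :
    paramTime c a < paramTime c a' :=
  mul_lt_mul_of_pos_left (Real.log_lt_log (bSlope_pos hc ha0 ha) (bSlope_lt hc ha0 ha ha' h))
    (by positivity)

lemma lt_one_iff_paramTime (hc : 0 < c) {a : ℝ} (ha0 : 0 < a) (ha : a ≠ 1) :
    a < 1 ↔ paramTime c a < sCrit c := by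
  constructor
  · intro h
    exact mul_lt_mul_of_pos_left (Real.log_lt_log (bSlope_pos hc ha0 ha)
      (bSlope_lt_of_lt_one hc ha0 h)) (by positivity)
  · intro h
    by_contra h'
    have h1 : 1 < a := lt_of_le_of_ne (not_lt.1 h') ha.symm
    have : sCrit c < paramTime c a := mul_lt_mul_of_pos_left
      (Real.log_lt_log (by linarith) (lt_bSlope hc h1)) (by positivity)
    exact lt_asymm h this

lemma exp_mul_paramTime (hc : 0 < c) {a : ℝ} (ha0 : 0 < a) (ha : a ≠ 1) :
    (a - 1) * Real.exp (c * paramTime c a) = bParam c a - 1 := by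
  have : c * paramTime c a = Real.log (bSlope c a) := by rw [paramTime]; field_simp
  rw [this, Real.exp_log (bSlope_pos hc ha0 ha), bSlope]
  have : a - 1 ≠ 0 := sub_ne_zero.2 ha
  field_simp

lemma continuousAt_bParam {a : ℝ} (ha : a ≠ 0) : ContinuousAt (bParam c) a :=
  (hasDerivAt_bParam c ha).continuousAt

lemma continuousAt_bSlope {a : ℝ} (ha0 : a ≠ 0) (ha : a ≠ 1) : ContinuousAt (bSlope c) a :=
  ((continuousAt_bParam ha0).sub continuousAt_const).div
    (continuousAt_id.sub continuousAt_const) (sub_ne_zero.2 ha)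

lemma continuousAt_paramTime (hc : 0 < c) {a : ℝ} (ha0 : 0 < a) (ha : a ≠ 1) :
    ContinuousAt (paramTime c) a :=
  continuousAt_const.mul ((continuousAt_bSlope ha0.ne' ha).log (bSlope_pos hc ha0 ha).ne')

lemma tendsto_bSlope_zero (hc : 0 < c) : Tendsto (bSlope c) (𝓝[>] 0) (𝓝 1) := by
  have h0 : Tendsto (bParam c) (𝓝[>] 0) (𝓝 0) := by
    refine tendsto_of_tendsto_of_tendsto_of_le_of_le' (h := fun a => a) tendsto_const_nhds
      (tendsto_id.mono_left nhdsWithin_le_nhds) ?_ ?_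
    · filter_upwards [self_mem_nhdsWithin] with a ha using (bParam_pos ha).le
    · filter_upwards [Ioo_mem_nhdsGT (zero_lt_one' ℝ)] with a ha
        using bParam_le_of_lt_one hc ha.1 ha.2
  have h1 : Tendsto (fun a : ℝ => a - 1) (𝓝[>] 0) (𝓝 (0 - 1)) :=
    (tendsto_id.mono_left nhdsWithin_le_nhds).sub_const 1
  have h2 := (h0.sub_const 1).div h1 (by norm_num)
  rw [zero_sub, div_self (by norm_num)] at h2
  exact h2

lemma tendsto_bSlope_one (c : ℝ) : Tendsto (bSlope c) (𝓝[≠] 1) (𝓝 (1 + c)) := by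
  have := (hasDerivAt_bParam_one c).tendsto_slope
  rwa [← funext (bSlope_eq_slope c)] at this

lemma tendsto_bSlope_atTop (c : ℝ) : Tendsto (bSlope c) atTop (𝓝 (Real.exp c)) := by
  have hi : Tendsto (fun a : ℝ => 1 / a) atTop (𝓝 0) := by
    simpa using tendsto_inv_atTop_zero (𝕜 := ℝ)
  have h1 : Tendsto (fun a : ℝ => (Real.exp (c * (1 - 1 / a)) - 1 / a) / (1 - 1 / a)) atTop
      (𝓝 ((Real.exp (c * (1 - 0)) - 0) / (1 - 0))) :=
    (((Real.continuous_exp.tendsto _).comp ((hi.const_sub 1).const_mul c)).sub hi).div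
      (hi.const_sub 1) (by norm_num)
  simp only [sub_zero, mul_one, div_one] at h1
  refine h1.congr' ?_
  filter_upwards [eventually_gt_atTop 1] with a ha
  have h2 : a - 1 ≠ 0 := by linarith
  have h3 : a ≠ 0 := by linarith
  rw [bSlope, bParam]
  generalize Real.exp (c * (1 - 1 / a)) = e
  field_simp

/-- The slope runs from `1` to the tangent slope `1 + c` over `(0, 1)`, and from `1 + c` to `e^c`
over `(1, ∞)`. The missing value `1 + c` is `e^{c s_c}`. -/
lemma exists_bSlope_eq (hc : 0 < c) {E : ℝ} (h1 : 1 < E) (hE : E < Real.exp c) (hne : E ≠ 1 + c) :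
    ∃ a, 0 < a ∧ a ≠ 1 ∧ bSlope c a = E := by
  rcases lt_or_gt_of_ne hne with h | h
  · have hcont : ContinuousOn (bSlope c) (Ioo 0 1) := fun a ha =>
      (continuousAt_bSlope ha.1.ne' ha.2.ne).continuousWithinAt
    have l1 : 𝓝[>] (0 : ℝ) ≤ 𝓟 (Ioo 0 1) := le_principal_iff.2 (Ioo_mem_nhdsGT one_pos)
    have l2 : 𝓝[<] (1 : ℝ) ≤ 𝓟 (Ioo 0 1) := le_principal_iff.2 (Ioo_mem_nhdsLT one_pos)
    obtain ⟨a, ha, rfl⟩ := isPreconnected_Ioo.intermediate_value_Ioo l1 l2 hcont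
      (tendsto_bSlope_zero hc) ((tendsto_bSlope_one c).mono_left
        (nhdsWithin_mono _ fun _ h => ne_of_lt h)) ⟨h1, h⟩
    exact ⟨a, ha.1, ha.2.ne, rfl⟩
  · have hcont : ContinuousOn (bSlope c) (Ioi 1) := fun a ha =>
      (continuousAt_bSlope (one_pos.trans ha).ne' (ne_of_gt ha)).continuousWithinAt
    have l1 : 𝓝[>] (1 : ℝ) ≤ 𝓟 (Ioi 1) := inf_le_right
    have l2 : (atTop : Filter ℝ) ≤ 𝓟 (Ioi 1) := le_principal_iff.2 (Ioi_mem_atTop 1)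
    obtain ⟨a, ha, rfl⟩ := isPreconnected_Ioi.intermediate_value_Ioo l1 l2 hcont
      ((tendsto_bSlope_one c).mono_left (nhdsWithin_mono _ fun _ h => ne_of_gt h))
      (tendsto_bSlope_atTop c) ⟨h, hE⟩
    exact ⟨a, one_pos.trans ha, ne_of_gt ha, rfl⟩

lemma existsUnique_isParam (hc : 0 < c) {s : ℝ} (hs0 : 0 < s) (hs1 : s < 1) (hsc : s ≠ sCrit c) :
    ∃! a : ℝ, IsParam c s a := by
  have hne : Real.exp (c * s) ≠ 1 + c := by
    intro h
    apply hsc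
    rw [sCrit, ← h, Real.log_exp]
    field_simp
  obtain ⟨a, ha0, ha, he⟩ := exists_bSlope_eq hc (Real.one_lt_exp_iff.2 (mul_pos hc hs0))
    (Real.exp_lt_exp.2 (by nlinarith)) hne
  refine ⟨a, isParam_iff.2 ⟨ha0, ha, ?_⟩, ?_⟩
  · rw [paramTime, he, Real.log_exp]
    field_simp
  · intro a' h'
    obtain ⟨h0', h1', hs'⟩ := isParam_iff.1 h'
    have hs : s = paramTime c a := by rw [paramTime, he, Real.log_exp]; field_simp
    rcases lt_trichotomy a' a with h | h | h
    · have := paramTime_lt hc h0' h1' ha h; linarith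
    · exact h
    · have := paramTime_lt hc ha0 ha h1' h; linarith

end Param

/-! ### The optimal trajectory -/

section Trajectory

variable {c s a x y : ℝ}

/-- `e^{-θ}` for the optimal tilt `θ`. -/
def tiltCurve (c a x : ℝ) : ℝ := 1 + (a - 1) * Real.exp (c * x)

lemma tiltCurve_zero (c a : ℝ) : tiltCurve c a 0 = a := by simp [tiltCurve]

/-- For `a < 1` the curve decreases and eventually becomes negative, so positivity has to be carried
back from the final time. -/
lemma tiltCurve_pos (hc : 0 < c) (hxy : x ≤ y)
    (hy : 0 < tiltCurve c a y) : 0 < tiltCurve c a x := by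
  unfold tiltCurve at *
  rcases le_total a 1 with h | h
  · have : Real.exp (c * x) ≤ Real.exp (c * y) := Real.exp_le_exp.2 (by nlinarith)
    nlinarith
  · have : 0 < Real.exp (c * x) := Real.exp_pos _
    nlinarith

lemma tiltCurve_param (hc : 0 < c) (h : IsParam c s a) : tiltCurve c a s = bParam c a := by
  obtain ⟨h0, h1, hs⟩ := isParam_iff.1 h
  rw [tiltCurve, hs, exp_mul_paramTime hc h0 h1]; ring

lemma tiltCurve_param_pos (hc : 0 < c) (h : IsParam c s a) : 0 < tiltCurve c a s := by
  rw [tiltCurve_param hc h]; exact bParam_pos h.1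

lemma tiltCurve_pos_of_param (hc : 0 < c) (h : IsParam c s a) (hxs : x ≤ s) :
    0 < tiltCurve c a x :=
  tiltCurve_pos hc hxs (tiltCurve_param_pos hc h)

lemma hasDerivAt_exp_mul (c x : ℝ) :
    HasDerivAt (fun x => Real.exp (c * x)) (c * Real.exp (c * x)) x :=
  (((hasDerivAt_id x).const_mul c).exp).congr_deriv (by simp [mul_comm])

lemma hasDerivAt_tiltCurve (c a x : ℝ) :
    HasDerivAt (tiltCurve c a) (c * (tiltCurve c a x - 1)) x :=
  (((hasDerivAt_exp_mul c x).const_mul (a - 1)).const_add 1).congr_deriv (by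
    rw [tiltCurve]; ring)

lemma continuous_tiltCurve (c a : ℝ) : Continuous (tiltCurve c a) := by
  unfold tiltCurve; fun_prop

/-- A primitive of `e^{cx} / tiltCurve c a x`. -/
def tiltInt (c a x : ℝ) : ℝ := Real.log (tiltCurve c a x / a) / (c * (a - 1))

lemma tiltInt_zero (ha : a ≠ 0) : tiltInt c a 0 = 0 := by simp [tiltInt, tiltCurve_zero, ha]

lemma hasDerivAt_tiltInt (hc : 0 < c) (ha : 0 < a) (ha1 : a ≠ 1) (hu : 0 < tiltCurve c a x) :
    HasDerivAt (tiltInt c a) (Real.exp (c * x) / tiltCurve c a x) x := by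
  have h := (((hasDerivAt_tiltCurve c a x).div_const a).log (div_pos hu ha).ne').div_const
    (c * (a - 1))
  refine h.congr_deriv ?_
  have h1 : a - 1 ≠ 0 := sub_ne_zero.2 ha1
  have h2 : tiltCurve c a x - 1 = (a - 1) * Real.exp (c * x) := by rw [tiltCurve]; ring
  rw [h2]
  field_simp

lemma tiltInt_param (hc : 0 < c) (h : IsParam c s a) : tiltInt c a s = 1 / a := by
  have h0 := h.1
  have h1 : a - 1 ≠ 0 := sub_ne_zero.2 h.2.1
  rw [tiltInt, tiltCurve_param hc h, bParam, mul_div_cancel_left₀ _ h0.ne', Real.log_exp]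
  field_simp

lemma integral_tiltInt (hc : 0 < c) (ha : 0 < a) (ha1 : a ≠ 1) (hx : 0 ≤ x)
    (hu : 0 < tiltCurve c a x) :
    ∫ t in (0 : ℝ)..x, Real.exp (c * t) / tiltCurve c a t = tiltInt c a x := by
  have hpos : ∀ t ∈ uIcc 0 x, 0 < tiltCurve c a t := fun t ht => by
    rw [uIcc_of_le hx] at ht
    exact tiltCurve_pos hc ht.2 hu
  rw [intervalIntegral.integral_eq_sub_of_hasDerivAt
    (fun t ht => hasDerivAt_tiltInt hc ha ha1 (hpos t ht)), tiltInt_zero ha.ne', sub_zero]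
  refine ContinuousOn.intervalIntegrable (ContinuousOn.div (by fun_prop)
    (continuous_tiltCurve c a).continuousOn fun t ht => (hpos t ht).ne')

/-- Since `e^{cx}/u` is the derivative of `log u` in `a`, this form says that `ŷ(x)` is the level
`v` at which the `a`-derivative of `log a - ∫₀ˣ log u - v log u(x)` vanishes. -/
lemma yHat_eq (c a x : ℝ) :
    yHat c a x = tiltCurve c a x / Real.exp (c * x) * (1 / a - tiltInt c a x) := by
  rw [yHat, tiltInt, tiltCurve]; ring

/-- The Poisson rate `c ŷ` is tilted to `c ŷ e^θ` with `e^θ = 1/u`. -/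
lemma hasDerivAt_yHat (hc : 0 < c) (ha : 0 < a) (ha1 : a ≠ 1) (hu : 0 < tiltCurve c a x) :
    HasDerivAt (yHat c a) (-1 - c * yHat c a x / tiltCurve c a x) x := by
  have h1 := (hasDerivAt_tiltCurve c a x).div (hasDerivAt_exp_mul c x) (Real.exp_pos _).ne'
  have h2 := h1.mul ((hasDerivAt_tiltInt hc ha ha1 hu).const_sub (1 / a))
  refine (h2.congr_deriv ?_).congr_of_eventuallyEq (Eventually.of_forall (yHat_eq c a))
  rw [yHat_eq]
  simp only [Pi.div_apply]
  have h3 : Real.exp (c * x) ≠ 0 := (Real.exp_pos _).ne'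
  generalize 1 / a - tiltInt c a x = k
  field_simp
  ring

lemma yHat_zero (ha : a ≠ 0) : yHat c a 0 = 1 := by
  rw [yHat_eq, tiltInt_zero ha, tiltCurve_zero]; simp [ha]

lemma yHat_param (hc : 0 < c) (h : IsParam c s a) : yHat c a s = 0 := by
  rw [yHat_eq, tiltInt_param hc h]; simp

lemma tiltInt_strictMonoOn (hc : 0 < c) (h : IsParam c s a) :
    StrictMonoOn (tiltInt c a) (Icc 0 s) := by
  refine strictMonoOn_of_deriv_pos (convex_Icc 0 s) (fun x hx =>
    (hasDerivAt_tiltInt hc h.1 h.2.1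
      (tiltCurve_pos_of_param hc h hx.2)).continuousAt.continuousWithinAt) fun x hx => ?_
  rw [interior_Icc] at hx
  have hu := tiltCurve_pos_of_param hc h hx.2.le
  rw [(hasDerivAt_tiltInt hc h.1 h.2.1 hu).deriv]
  positivity

lemma yHat_pos (hc : 0 < c) (h : IsParam c s a) (hx : 0 ≤ x) (hxs : x < s) : 0 < yHat c a x := by
  have hu := tiltCurve_pos_of_param hc h hxs.le
  have := tiltInt_strictMonoOn hc h ⟨hx, hxs.le⟩ ⟨hx.trans hxs.le, le_rfl⟩ hxs
  rw [tiltInt_param hc h] at this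
  rw [yHat_eq]
  have : 0 < 1 / a - tiltInt c a x := by linarith
  positivity

lemma continuousOn_yHat (hc : 0 < c) (h : IsParam c s a) : ContinuousOn (yHat c a) (Icc 0 s) :=
  fun _ hx => (hasDerivAt_yHat hc h.1 h.2.1
      (tiltCurve_pos_of_param hc h hx.2)).continuousAt.continuousWithinAt

lemma yHat_strictAntiOn (hc : 0 < c) (h : IsParam c s a) : StrictAntiOn (yHat c a) (Icc 0 s) := by
  refine strictAntiOn_of_deriv_neg (convex_Icc 0 s) (continuousOn_yHat hc h) fun x hx => ?_
  rw [interior_Icc] at hx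
  have hu := tiltCurve_pos_of_param hc h hx.2.le
  rw [(hasDerivAt_yHat hc h.1 h.2.1 hu).deriv]
  have := div_pos (mul_pos hc (yHat_pos hc h hx.1.le hx.2)) hu
  linarith

lemma isTrajectory_yHat (hc : 0 < c) (h : IsParam c s a) : IsTrajectory s (yHat c a) :=
  ⟨yHat_zero h.1.ne', yHat_param hc h, (yHat_strictAntiOn hc h).antitoneOn⟩

/-! ### The cost along the optimal trajectory -/

lemma ellHat_eq_mul (hc : 0 < c) (ha : 0 < a) (ha1 : a ≠ 1) (hu : 0 < tiltCurve c a x) :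
    ellHat c a x = c * yHat c a x / tiltCurve c a x *
      (1 - tiltCurve c a x + Real.log (tiltCurve c a x)) := by
  have hd : 1 + deriv (yHat c a) x = -(c * yHat c a x / tiltCurve c a x) := by
    rw [(hasDerivAt_yHat hc ha ha1 hu).deriv]; ring
  rw [ellHat, hd]
  -- At a zero of `ŷ`, such as `x = s`, the prefactor vanishes on both sides, whatever the default
  -- values of the quotient and the logarithm.
  by_cases hy : yHat c a x = 0
  · simp [hy]
  · have : c * yHat c a x / -(c * yHat c a x / tiltCurve c a x) = -tiltCurve c a x := by
      field_simp
    rw [this, neg_neg, neg_neg, sub_eq_add_neg]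

lemma ellHat_closed_form (hc : 0 < c) (ha : 0 < a) (ha1 : a ≠ 1) (hu : 0 < tiltCurve c a x) :
    ellHat c a x = (Real.log ((1 + (a - 1) * Real.exp (c * x)) / a) - c * (a - 1) / a) *
      (1 - Real.log (1 + (a - 1) * Real.exp (c * x)) / ((a - 1) * Real.exp (c * x))) := by
  have hu' : 0 < 1 + (a - 1) * Real.exp (c * x) := hu
  rw [ellHat_eq_mul hc ha ha1 hu, yHat_eq, tiltInt]
  simp only [tiltCurve]
  have h1 : a - 1 ≠ 0 := sub_ne_zero.2 ha1
  have h3 : Real.exp (c * x) ≠ 0 := (Real.exp_pos _).ne'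
  generalize Real.log ((1 + (a - 1) * Real.exp (c * x)) / a) = l₁
  generalize Real.log (1 + (a - 1) * Real.exp (c * x)) = l₂
  have h2 : 1 + (a - 1) * Real.exp (c * x) ≠ 0 := hu'.ne'
  generalize Real.exp (c * x) = e at *
  field_simp
  ring

lemma le_poissonLegendre (lam ξ θ : ℝ) :
    ((θ * ξ - lam * (Real.exp θ - 1) : ℝ) : EReal) ≤ poissonLegendre lam ξ :=
  le_iSup (fun θ : ℝ => ((θ * ξ - lam * (Real.exp θ - 1) : ℝ) : EReal)) θ

/-- The supremum is attained at `θ` because `exp` lies above its tangent there. -/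
lemma poissonLegendre_eq {lam : ℝ} (hl : 0 ≤ lam) (θ : ℝ) :
    poissonLegendre lam (lam * Real.exp θ) =
      ((θ * (lam * Real.exp θ) - lam * (Real.exp θ - 1) : ℝ) : EReal) := by
  refine le_antisymm (iSup_le fun t => EReal.coe_le_coe_iff.2 ?_) (le_poissonLegendre _ _ θ)
  have h1 : (t - θ) + 1 ≤ Real.exp (t - θ) := Real.add_one_le_exp _
  have h2 : Real.exp t = Real.exp θ * Real.exp (t - θ) := by rw [← Real.exp_add]; ring_nf
  have h3 := mul_le_mul_of_nonneg_left h1 (mul_nonneg hl (Real.exp_pos θ).le)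
  nlinarith

/-- The integrand that bounds the cost from below. -/
def calib (c a : ℝ) (y : ℝ → ℝ) (x : ℝ) : ℝ :=
  -Real.log (tiltCurve c a x) * -(1 + deriv y x) - c * y x * ((tiltCurve c a x)⁻¹ - 1)

lemma calib_yHat (hc : 0 < c) (ha : 0 < a) (ha1 : a ≠ 1) (hu : 0 < tiltCurve c a x) :
    calib c a (yHat c a) x = -ellHat c a x := by
  rw [ellHat_eq_mul hc ha ha1 hu, calib, (hasDerivAt_yHat hc ha ha1 hu).deriv]
  field_simp
  ring

lemma poissonLegendre_yHat (hc : 0 < c) (ha : 0 < a) (ha1 : a ≠ 1) (hu : 0 < tiltCurve c a x)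
    (hy : 0 ≤ yHat c a x) :
    poissonLegendre (c * yHat c a x) (-(1 + deriv (yHat c a) x)) =
      ((-ellHat c a x : ℝ) : EReal) := by
  have he : Real.exp (-Real.log (tiltCurve c a x)) = (tiltCurve c a x)⁻¹ := by
    rw [Real.exp_neg, Real.exp_log hu]
  have hξ : -(1 + deriv (yHat c a) x) = c * yHat c a x * Real.exp (-Real.log (tiltCurve c a x)) := by
    rw [(hasDerivAt_yHat hc ha ha1 hu).deriv, he]; ring
  rw [← calib_yHat hc ha ha1 hu, calib, hξ, poissonLegendre_eq (by positivity), he]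

lemma continuousOn_log_tiltCurve (hc : 0 < c) (hu : 0 < tiltCurve c a x) :
    ContinuousOn (fun t => Real.log (tiltCurve c a t)) (Icc 0 x) :=
  (continuous_tiltCurve c a).continuousOn.log fun _ ht => (tiltCurve_pos hc ht.2 hu).ne'

lemma absolutelyContinuous_of_hasDerivAt {f f' : ℝ → ℝ} {p q : ℝ} (hpq : p ≤ q)
    (h : ∀ x ∈ Icc p q, HasDerivAt f (f' x) x) (hf' : ContinuousOn f' (Icc p q)) :
    AbsolutelyContinuousOnInterval f p q := by
  obtain ⟨C, hC⟩ := isCompact_Icc.exists_bound_of_continuousOn hf'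
  have : LipschitzOnWith (Real.toNNReal C) f (uIcc p q) := by
    rw [uIcc_of_le hpq]
    refine (convex_Icc p q).lipschitzOnWith_of_nnnorm_hasDerivWithin_le
      (fun x hx => (h x hx).hasDerivWithinAt) fun x hx => ?_
    rw [← NNReal.coe_le_coe, coe_nnnorm]
    exact (hC x hx).trans (Real.le_coe_toNNReal C)
  exact this.absolutelyContinuousOnInterval

lemma absolutelyContinuous_log_tiltCurve (hc : 0 < c) (h : IsParam c s a) (hs : 0 ≤ s) :
    AbsolutelyContinuousOnInterval (fun t => Real.log (tiltCurve c a t)) 0 s := by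
  refine absolutelyContinuous_of_hasDerivAt hs
    (fun x hx => (hasDerivAt_tiltCurve c a x).log (tiltCurve_pos_of_param hc h hx.2).ne') ?_
  have := (continuous_tiltCurve c a).continuousOn (s := Icc 0 s)
  exact ContinuousOn.div (by fun_prop) this
    fun x hx => (tiltCurve_pos_of_param hc h hx.2).ne'

lemma continuousOn_ellHat (hc : 0 < c) (h : IsParam c s a) :
    ContinuousOn (ellHat c a) (Icc 0 s) := by
  have hu : ∀ x ∈ Icc 0 s, 0 < tiltCurve c a x := fun x hx =>
    tiltCurve_pos_of_param hc h hx.2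
  have hE : EqOn (fun x => c * yHat c a x / tiltCurve c a x *
      (1 - tiltCurve c a x + Real.log (tiltCurve c a x))) (ellHat c a) (Icc 0 s) :=
    fun x hx => (ellHat_eq_mul hc h.1 h.2.1 (hu x hx)).symm
  refine ContinuousOn.congr ?_ hE.symm
  have h1 := continuousOn_yHat hc h
  have h2 := (continuous_tiltCurve c a).continuousOn (s := Icc 0 s)
  have h3 : ContinuousOn (fun t => Real.log (tiltCurve c a t)) (Icc 0 s) :=
    continuousOn_log_tiltCurve hc (tiltCurve_param_pos hc h)
  exact ((h1.const_mul c).div h2 fun x hx => (hu x hx).ne').mul ((continuousOn_const.sub h2).add h3)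

lemma absolutelyContinuous_yHat (hc : 0 < c) (h : IsParam c s a) (hs : 0 ≤ s) :
    AbsolutelyContinuousOnInterval (yHat c a) 0 s := by
  have hu : ∀ x ∈ Icc 0 s, 0 < tiltCurve c a x := fun x hx =>
    tiltCurve_pos_of_param hc h hx.2
  refine absolutelyContinuous_of_hasDerivAt hs
    (fun x hx => hasDerivAt_yHat hc h.1 h.2.1 (hu x hx)) ?_
  exact continuousOn_const.sub (((continuousOn_yHat hc h).const_mul c).div
    (continuous_tiltCurve c a).continuousOn fun x hx => (hu x hx).ne')

lemma intervalIntegrable_calib (hc : 0 < c) (h : IsParam c s a) (hs : 0 ≤ s) {y : ℝ → ℝ}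
    (hy : AbsolutelyContinuousOnInterval y 0 s) : IntervalIntegrable (calib c a y) volume 0 s := by
  have hu : ∀ x ∈ uIcc 0 s, 0 < tiltCurve c a x := fun x hx => by
    rw [uIcc_of_le hs] at hx
    exact tiltCurve_pos_of_param hc h hx.2
  have h1 : ContinuousOn (fun x => -Real.log (tiltCurve c a x)) (uIcc 0 s) :=
    ((continuous_tiltCurve c a).continuousOn.log fun x hx => (hu x hx).ne').neg
  have h2 : ContinuousOn (fun x => c * y x * ((tiltCurve c a x)⁻¹ - 1)) (uIcc 0 s) :=
    (hy.continuousOn.const_mul c).mul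
      (((continuous_tiltCurve c a).continuousOn.inv₀ fun x hx => (hu x hx).ne').sub
        continuousOn_const)
  have h3 : IntervalIntegrable (fun x => -(1 + deriv y x)) volume 0 s :=
    (intervalIntegrable_const.add hy.intervalIntegrable_deriv).neg
  exact (h3.continuousOn_mul h1).sub h2.intervalIntegrable

/-- The lower bound integrates to a quantity that is the same for all trajectories. -/
lemma integral_calib (hc : 0 < c) (h : IsParam c s a) (hs : 0 ≤ s) {y : ℝ → ℝ}
    (hy : AbsolutelyContinuousOnInterval y 0 s) (hy0 : y 0 = 1) (hys : y s = 0) :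
    ∫ x in (0 : ℝ)..s, calib c a y x =
      (∫ x in (0 : ℝ)..s, Real.log (tiltCurve c a x)) - Real.log a := by
  have hu : ∀ x ∈ Icc 0 s, 0 < tiltCurve c a x := fun x hx =>
    tiltCurve_pos_of_param hc h hx.2
  have hL := absolutelyContinuous_log_tiltCurve hc h hs
  -- Since `(log u)' = c (1 - 1/u)`, the integrand is `log u + (y log u)'` wherever `y` is
  -- differentiable; integration by parts leaves boundary values only.
  have hfun : ∀ x ∈ uIcc 0 s, calib c a y x = Real.log (tiltCurve c a x) +
      (deriv y x * Real.log (tiltCurve c a x) +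
        y x * deriv (fun t => Real.log (tiltCurve c a t)) x) := by
    intro x hx
    rw [uIcc_of_le hs] at hx
    have hux := hu x hx
    rw [((hasDerivAt_tiltCurve c a x).log hux.ne').deriv, calib]
    field_simp
    ring
  rw [intervalIntegral.integral_congr hfun, intervalIntegral.integral_add,
    hy.integral_deriv_mul_eq_sub hL, hy0, hys, tiltCurve_zero]
  · ring
  · exact hL.continuousOn.intervalIntegrable
  · exact (hy.intervalIntegrable_deriv.mul_continuousOn hL.continuousOn).add
      (hL.intervalIntegrable_deriv.continuousOn_mul hy.continuousOn)

lemma integral_ellHat (hc : 0 < c) (h : IsParam c s a) (hs : 0 ≤ s) :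
    ∫ x in (0 : ℝ)..s, ellHat c a x =
      Real.log a - ∫ x in (0 : ℝ)..s, Real.log (tiltCurve c a x) := by
  have h1 := integral_calib hc h hs (absolutelyContinuous_yHat hc h hs) (yHat_zero h.1.ne')
    (yHat_param hc h)
  have h2 : ∫ x in (0 : ℝ)..s, calib c a (yHat c a) x = ∫ x in (0 : ℝ)..s, -ellHat c a x := by
    refine intervalIntegral.integral_congr fun x hx => ?_
    rw [uIcc_of_le hs] at hx
    exact calib_yHat hc h.1 h.2.1 (tiltCurve_pos_of_param hc h hx.2)
  rw [h2, intervalIntegral.integral_neg] at h1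
  linarith

/-- `F` will be the Legendre transform along a trajectory. No measurability of it is required,
because the bound is by the positive part of the integrable `f`. -/
lemma ofReal_integral_le_lintegral {f : ℝ → ℝ} {F : ℝ → ENNReal} (hs : 0 ≤ s)
    (hf : IntervalIntegrable f volume 0 s)
    (h : ∀ x ∈ Icc 0 s, ENNReal.ofReal (f x) ≤ F x) :
    ENNReal.ofReal (∫ x in (0 : ℝ)..s, f x) ≤ ∫⁻ x in Icc 0 s, F x := by
  rw [intervalIntegral.integral_of_le hs, ← integral_Icc_eq_integral_Ioc]
  have hi : IntegrableOn f (Icc 0 s) := (intervalIntegrable_iff_integrableOn_Icc_of_le hs).1 hf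
  have h1 : ∫ x in Icc 0 s, f x ≤ ∫ x in Icc 0 s, max (f x) 0 :=
    integral_mono hi hi.pos_part fun x => le_max_left _ _
  refine (ENNReal.ofReal_le_ofReal h1).trans ?_
  rw [ofReal_integral_eq_lintegral_ofReal hi.pos_part (ae_of_all _ fun x => le_max_right _ _)]
  refine setLIntegral_mono' measurableSet_Icc fun x hx => ?_
  refine le_trans (le_of_eq ?_) (h x hx)
  rcases le_total (f x) 0 with h' | h'
  · rw [max_eq_right h', ENNReal.ofReal_zero, ENNReal.ofReal_of_nonpos h']
  · rw [max_eq_left h']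

lemma trajCost_yHat (hc : 0 < c) (h : IsParam c s a) (hs : 0 ≤ s) :
    trajCost c s (yHat c a) = ENNReal.ofReal (-∫ x in (0 : ℝ)..s, ellHat c a x) := by
  rw [trajCost, if_pos (absolutelyContinuous_yHat hc h hs)]
  have hval : ∀ x ∈ Icc 0 s, poissonLegendre (c * yHat c a x) (-(1 + deriv (yHat c a) x)) =
      ((-ellHat c a x : ℝ) : EReal) := fun x hx => by
    refine poissonLegendre_yHat hc h.1 h.2.1 (tiltCurve_pos_of_param hc h hx.2) ?_
    rcases hx.2.lt_or_eq with h' | h'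
    · exact (yHat_pos hc h hx.1 h').le
    · rw [h', yHat_param hc h]
  have hnonneg : ∀ x ∈ Icc 0 s, 0 ≤ -ellHat c a x := fun x hx => by
    have := le_poissonLegendre (c * yHat c a x) (-(1 + deriv (yHat c a) x)) 0
    rw [hval x hx, EReal.coe_le_coe_iff] at this
    simpa using this
  rw [setLIntegral_congr_fun measurableSet_Icc (fun x hx => by
    rw [hval x hx, EReal.toENNReal_of_ne_top (EReal.coe_ne_top _), EReal.toReal_coe]),
    ← intervalIntegral.integral_neg, intervalIntegral.integral_of_le hs,
    ← integral_Icc_eq_integral_Ioc, ofReal_integral_eq_lintegral_ofReal]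
  · exact ((continuousOn_ellHat hc h).neg).integrableOn_Icc
  · exact (ae_restrict_iff' measurableSet_Icc).2 (ae_of_all _ hnonneg)

end Trajectory

/-! ### Minimality and uniqueness of the optimal trajectory -/

section Minimizer

variable {c s a x : ℝ} {y : ℝ → ℝ}

lemma ofReal_le_toENNReal_poissonLegendre (lam ξ θ : ℝ) {r : ℝ}
    (hr : r ≤ θ * ξ - lam * (Real.exp θ - 1)) :
    ENNReal.ofReal r ≤ (poissonLegendre lam ξ).toENNReal := by
  have h : ((r : ℝ) : EReal) ≤ poissonLegendre lam ξ :=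
    (EReal.coe_le_coe_iff.2 hr).trans (le_poissonLegendre lam ξ θ)
  have := EReal.toENNReal_le_toENNReal h
  rwa [EReal.toENNReal_of_ne_top (EReal.coe_ne_top _), EReal.toReal_coe] at this

lemma exp_neg_log_tiltCurve (hu : 0 < tiltCurve c a x) :
    Real.exp (-Real.log (tiltCurve c a x)) = (tiltCurve c a x)⁻¹ := by
  rw [Real.exp_neg, Real.exp_log hu]

lemma integral_calib_eq (hc : 0 < c) (h : IsParam c s a) (hs : 0 ≤ s)
    (hy : AbsolutelyContinuousOnInterval y 0 s) (hy0 : y 0 = 1) (hys : y s = 0) :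
    ∫ x in (0 : ℝ)..s, calib c a y x = -∫ x in (0 : ℝ)..s, ellHat c a x := by
  rw [integral_calib hc h hs hy hy0 hys, integral_ellHat hc h hs]; ring

lemma trajCost_yHat_le (hc : 0 < c) (h : IsParam c s a) (hs : 0 ≤ s) (hy : IsTrajectory s y) :
    trajCost c s (yHat c a) ≤ trajCost c s y := by
  by_cases hac : AbsolutelyContinuousOnInterval y 0 s
  · rw [trajCost_yHat hc h hs, ← integral_calib_eq hc h hs hac hy.1 hy.2.1, trajCost, if_pos hac]
    refine ofReal_integral_le_lintegral hs (intervalIntegrable_calib hc h hs hac) fun x hx => ?_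
    refine ofReal_le_toENNReal_poissonLegendre _ _ (-Real.log (tiltCurve c a x)) ?_
    rw [exp_neg_log_tiltCurve (tiltCurve_pos_of_param hc h hx.2), calib]
  · rw [trajCost, trajCost, if_neg hac]
    exact le_top

lemma hasDerivAt_exp_div_tiltCurve (hu : 0 < tiltCurve c a x) :
    HasDerivAt (fun t => Real.exp (c * t) / tiltCurve c a t)
      (Real.exp (c * x) / tiltCurve c a x * (c / tiltCurve c a x)) x := by
  refine ((hasDerivAt_exp_mul c x).div (hasDerivAt_tiltCurve c a x) hu.ne').congr_deriv ?_
  field_simp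
  ring

lemma ellHat_integral_nonpos (hc : 0 < c) (h : IsParam c s a) (hs : 0 ≤ s) :
    0 ≤ -∫ x in (0 : ℝ)..s, ellHat c a x := by
  rw [← intervalIntegral.integral_neg]
  refine intervalIntegral.integral_nonneg hs fun x hx => ?_
  have hu := tiltCurve_pos_of_param hc h hx.2
  have hy : 0 ≤ yHat c a x := by
    rcases hx.2.lt_or_eq with h' | h'
    · exact (yHat_pos hc h hx.1 h').le
    · rw [h', yHat_param hc h]
  rw [ellHat_eq_mul hc h.1 h.2.1 hu]
  have := Real.log_le_sub_one_of_pos hu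
  have h2 : 0 ≤ c * yHat c a x / tiltCurve c a x := by positivity
  nlinarith

/-- First-order condition: dividing by small `δ` of either sign leaves `A ≤ 0` and `-A ≤ 0`. -/
lemma eq_zero_of_mul_le_sq {A B M : ℝ} (hM : 0 < M)
    (h : ∀ δ : ℝ, |δ| * M ≤ 1 → δ * A - δ ^ 2 * B ≤ 0) : A = 0 := by
  have hlim : ∀ σ : ℝ, |σ| = 1 → σ * A ≤ 0 := by
    intro σ hσ
    have hev : ∀ᶠ t : ℝ in 𝓝[>] 0, σ * A ≤ t * B := by
      have : Ioo 0 (1 / M) ∈ 𝓝[>] (0 : ℝ) := Ioo_mem_nhdsGT (by positivity)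
      filter_upwards [this] with t ht
      have h1 := h (t * σ) (by
        rw [abs_mul, hσ, mul_one, abs_of_pos ht.1]
        have := (lt_div_iff₀ hM).1 ht.2
        linarith)
      have hsq : σ ^ 2 = 1 := by rw [← sq_abs, hσ, one_pow]
      have h2 : t * (σ * A - t * B) ≤ 0 := by
        calc t * (σ * A - t * B) = t * σ * A - (t * σ) ^ 2 * B := by rw [mul_pow, hsq]; ring
          _ ≤ 0 := h1
      have := nonpos_of_mul_nonpos_right h2 ht.1
      linarith
    have ht : Tendsto (fun t : ℝ => t * B) (𝓝[>] 0) (𝓝 (0 * B)) :=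
      (tendsto_id.mono_left nhdsWithin_le_nhds).mul_const B
    have := ge_of_tendsto ht hev
    linarith
  have h1 := hlim 1 (by simp)
  have h2 := hlim (-1) (by simp)
  linarith

/-- If the cost is minimal, then perturbing `θ = -log u` to `θ + δ w` on `[0, x]` cannot raise the
calibrated lower bound to first order in `δ`. For a suitable `w` the first-order term is a total
derivative plus a known function, and its vanishing determines `y(x)`. -/
lemma eqOn_yHat_of_trajCost_eq (hc : 0 < c) (h : IsParam c s a) (hs : 0 ≤ s)
    (hy : IsTrajectory s y) (heq : trajCost c s y = trajCost c s (yHat c a)) :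
    EqOn y (yHat c a) (Icc 0 s) := by
  have hac : AbsolutelyContinuousOnInterval y 0 s := by
    by_contra hac
    rw [trajCost_yHat hc h hs, trajCost, if_neg hac] at heq
    exact ENNReal.ofReal_ne_top heq.symm
  rw [trajCost_yHat hc h hs, trajCost, if_pos hac] at heq
  have hu : ∀ t ∈ Icc 0 s, 0 < tiltCurve c a t := fun t ht => tiltCurve_pos_of_param hc h ht.2
  have hynn : ∀ t ∈ Icc 0 s, 0 ≤ y t := fun t ht => by
    rw [← hy.2.1]; exact hy.2.2 ht ⟨hs, le_rfl⟩ ht.2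
  intro x hx
  have hux := hu x hx
  -- The integrating factor of `y' = -1 - c y / u`: it satisfies `w' = w c / u`.
  set w : ℝ → ℝ := fun t => Real.exp (c * t) / tiltCurve c a t with hw
  have hucont := (continuous_tiltCurve c a).continuousOn (s := Icc 0 s)
  have hwcont : ContinuousOn w (Icc 0 s) :=
    ContinuousOn.div (by fun_prop) hucont fun t ht => (hu t ht).ne'
  have hwac : AbsolutelyContinuousOnInterval w 0 x := by
    refine absolutelyContinuous_of_hasDerivAt hx.1 (fun t ht =>
      hasDerivAt_exp_div_tiltCurve (hu t ⟨ht.1, ht.2.trans hx.2⟩)) ?_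
    have hsub : Icc 0 x ⊆ Icc 0 s := Icc_subset_Icc_right hx.2
    exact (hwcont.mul (continuousOn_const.div hucont fun t ht => (hu t ht).ne')).mono hsub
  have hyac : AbsolutelyContinuousOnInterval y 0 x :=
    hac.mono (by rw [uIcc_of_le hx.1, uIcc_of_le hs]; exact Icc_subset_Icc_right hx.2)
  set p : ℝ → ℝ := fun t => w t * (-(1 + deriv y t) - c * y t / tiltCurve c a t) with hp
  set r : ℝ → ℝ := fun t => w t ^ 2 * (c * y t / tiltCurve c a t) with hr
  have hucc : uIcc 0 s = Icc 0 s := uIcc_of_le hs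
  have hycont : ContinuousOn y (Icc 0 s) := hucc ▸ hac.continuousOn
  have hquot : ContinuousOn (fun t => c * y t / tiltCurve c a t) (Icc 0 s) :=
    (hycont.const_mul c).div hucont fun t ht => (hu t ht).ne'
  have hpint : IntervalIntegrable p volume 0 s := by
    refine IntervalIntegrable.continuousOn_mul (IntervalIntegrable.sub
      (intervalIntegrable_const.add hac.intervalIntegrable_deriv).neg
      (ContinuousOn.intervalIntegrable (hucc ▸ hquot))) (hucc ▸ hwcont)
  have hrint : IntervalIntegrable r volume 0 s :=
    ContinuousOn.intervalIntegrable (hucc ▸ (hwcont.pow 2).mul hquot)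
  have hsub : uIcc 0 x ⊆ uIcc 0 s := by
    rw [uIcc_of_le hx.1, hucc]; exact Icc_subset_Icc_right hx.2
  obtain ⟨M, hM⟩ := isCompact_Icc.exists_bound_of_continuousOn hwcont
  have hM1 : ∀ t ∈ Icc 0 s, |w t| ≤ |M| + 1 := fun t ht => by
    have := hM t ht; rw [Real.norm_eq_abs] at this; linarith [le_abs_self M]
  have hA : ∫ t in (0 : ℝ)..x, p t = 0 := by
    refine eq_zero_of_mul_le_sq (B := ∫ t in (0 : ℝ)..x, r t) (M := |M| + 1) (by positivity) ?_
    intro δ hδ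
    -- The gain over the calibration on `[0, x]`, by `e^τ ≤ 1 + τ + τ²` for `|τ| ≤ 1` with `τ = δ
    -- w`.
    set g : ℝ → ℝ := fun t => δ * p t - δ ^ 2 * r t with hg
    have hgint : IntervalIntegrable g volume 0 s :=
      (hpint.const_mul δ).sub (hrint.const_mul (δ ^ 2))
    have hgi : IntervalIntegrable (indicator {t | t ≤ x} g) volume 0 s := by
      rw [intervalIntegrable_iff_integrableOn_Ioc_of_le hs] at hgint ⊢
      exact hgint.indicator measurableSet_Iic
    have hcal := intervalIntegrable_calib hc h hs hac
    have hle := ofReal_integral_le_lintegral hs (hcal.add hgi)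
      (F := fun t => (poissonLegendre (c * y t) (-(1 + deriv y t))).toENNReal) (by
      intro t ht
      have hut := hu t ht
      by_cases htx : t ≤ x
      · refine ofReal_le_toENNReal_poissonLegendre _ _
          (-Real.log (tiltCurve c a t) + δ * w t) ?_
        rw [indicator_of_mem (show t ∈ {t | t ≤ x} from htx), Real.exp_add,
          exp_neg_log_tiltCurve hut]
        have hsmall : |δ * w t| ≤ 1 := by
          rw [abs_mul]
          exact (mul_le_mul_of_nonneg_left (hM1 t ht) (abs_nonneg δ)).trans hδ
        have hexp := (abs_le.1 (Real.abs_exp_sub_one_sub_id_le hsmall)).2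
        have hq : 0 ≤ c * y t * (tiltCurve c a t)⁻¹ :=
          mul_nonneg (mul_nonneg hc.le (hynn t ht)) (inv_nonneg.2 hut.le)
        have hmul := mul_le_mul_of_nonneg_left hexp hq
        simp only [hg, hp, hr, calib, div_eq_mul_inv]
        generalize Real.exp (δ * w t) = E at hmul
        nlinarith
      · refine ofReal_le_toENNReal_poissonLegendre _ _ (-Real.log (tiltCurve c a t)) ?_
        rw [indicator_of_notMem (show t ∉ {t | t ≤ x} from htx),
          exp_neg_log_tiltCurve hut, calib, add_zero])
    rw [heq, intervalIntegral.integral_add hcal hgi, intervalIntegral.integral_indicator hx,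
      integral_calib_eq hc h hs hac hy.1 hy.2.1, intervalIntegral.integral_sub
        ((hpint.mono_set hsub).const_mul δ) ((hrint.mono_set hsub).const_mul (δ ^ 2)),
      intervalIntegral.integral_const_mul, intervalIntegral.integral_const_mul,
      ENNReal.ofReal_le_ofReal_iff (ellHat_integral_nonpos hc h hs)] at hle
    linarith
  -- Thus `p = -w - (y w)'`, and `∫ p = 0` reads `y(x) w(x) = 1/a - tiltInt c a x`, which is the
  -- formula for `ŷ(x)`.
  have hpeq : ∀ t ∈ uIcc 0 x, p t = -w t - (deriv y t * w t + y t * deriv w t) := by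
    intro t ht
    rw [uIcc_of_le hx.1] at ht
    have hut := hu t ⟨ht.1, ht.2.trans hx.2⟩
    rw [(hasDerivAt_exp_div_tiltCurve hut).deriv]
    simp only [hp, hw]
    ring
  have hwint : IntervalIntegrable (fun t => -w t) volume 0 x :=
    hwac.continuousOn.intervalIntegrable.neg
  rw [intervalIntegral.integral_congr hpeq, intervalIntegral.integral_sub hwint
    ((hyac.intervalIntegrable_deriv.mul_continuousOn hwac.continuousOn).add
      (hwac.intervalIntegrable_deriv.continuousOn_mul hyac.continuousOn)),
    hyac.integral_deriv_mul_eq_sub hwac, intervalIntegral.integral_neg,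
    integral_tiltInt hc h.1 h.2.1 hx.1 hux, hy.1] at hA
  have hw0 : w 0 = 1 / a := by simp [hw, tiltCurve_zero]
  have hwx : w x = Real.exp (c * x) / tiltCurve c a x := rfl
  rw [yHat_eq, ← sub_eq_zero]
  have he : Real.exp (c * x) ≠ 0 := (Real.exp_pos _).ne'
  rw [hw0, hwx] at hA
  have : 1 / a - tiltInt c a x = y x * (Real.exp (c * x) / tiltCurve c a x) := by linarith
  rw [this]
  field_simp
  ring

end Minimizer

/-! ### Asymptotics of the tilts -/

section Asymptotics

variable {c a x v : ℝ}

/-- The rate at which `n` steps of size `1 / n` compound to an exponential. -/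
def logRate (c : ℝ) (n : ℕ) : ℝ := -(n * Real.log (1 - c / n))

lemma tendsto_logRate (c : ℝ) : Tendsto (logRate c) atTop (𝓝 c) := by
  have h := ((Real.tendsto_mul_log_one_add_div_atTop (-c)).comp
    tendsto_natCast_atTop_atTop).neg
  rw [neg_neg] at h
  refine h.congr fun n => ?_
  simp only [Function.comp, logRate, neg_div, sub_eq_add_neg]

lemma tiltBase_eq_tiltCurve {n : ℕ} (hn : c < n) (hn0 : 0 < n) (a : ℝ) (j : ℕ) :
    tiltBase (c / n) a j = tiltCurve (logRate c n) a (j / n) := by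
  have hn' : (0 : ℝ) < n := by exact_mod_cast hn0
  have h1 : 0 < 1 - c / n := by
    have := (div_lt_one hn').2 hn
    linarith
  have h2 : logRate c n * (j / n) = j * Real.log (1 - c / n)⁻¹ := by
    rw [Real.log_inv, logRate]; field_simp
  rw [tiltBase, tiltCurve, h2, mul_comm (j : ℝ), Real.exp_mul, Real.exp_log (inv_pos.2 h1),
    Real.rpow_natCast]

/-- Moves the rate into the argument, so that replacing `logRate c n` by its limit `c` only needs
continuity in one variable. -/
lemma tiltCurve_eq_one_mul (c a x : ℝ) : tiltCurve c a x = tiltCurve 1 a (c * x) := by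
  simp [tiltCurve]

/-- The error of a Riemann sum of a monotone function. -/
lemma abs_sum_sub_integral_le {g : ℝ → ℝ} {m : ℕ}
    (hg : MonotoneOn g (Icc 0 (m : ℝ)) ∨ AntitoneOn g (Icc 0 (m : ℝ))) :
    |∑ j ∈ Finset.range m, g j - ∫ t in (0 : ℝ)..m, g t| ≤ |g m - g 0| := by
  have hs : ∑ j ∈ Finset.range m, g ((j + 1 : ℕ) : ℝ) = ∑ j ∈ Finset.range m, g j + (g m - g 0) := by
    have := Finset.sum_range_sub (fun j : ℕ => g j) m
    rw [Finset.sum_sub_distrib] at this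
    simp only [Nat.cast_zero] at this
    linarith
  rcases hg with h | h
  · rw [← zero_add (m : ℝ)] at h
    have h1 := h.sum_le_integral
    have h2 := h.integral_le_sum
    simp only [zero_add] at h1 h2
    rw [hs] at h2
    rw [abs_of_nonpos (by linarith)]
    exact le_trans (by linarith) (le_abs_self _)
  · rw [← zero_add (m : ℝ)] at h
    have h1 := h.sum_le_integral
    have h2 := h.integral_le_sum
    simp only [zero_add] at h1 h2
    rw [hs] at h1
    rw [abs_of_nonneg (by linarith)]
    exact le_trans (by linarith) (neg_le_abs _)

lemma tiltCurve_mono_or_anti (hc : 0 < c) (a : ℝ) :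
    Monotone (tiltCurve c a) ∨ Antitone (tiltCurve c a) := by
  have he : Monotone fun x => Real.exp (c * x) := fun x y h => Real.exp_le_exp.2 (by nlinarith)
  rcases le_total 1 a with h | h
  · exact Or.inl fun x y hxy => by
      have := he hxy; simp only at this; unfold tiltCurve; nlinarith
  · exact Or.inr fun x y hxy => by
      have := he hxy; simp only at this; unfold tiltCurve; nlinarith

lemma tendsto_tiltBase {m : ℕ → ℕ}
    (hmx : Tendsto (fun n => (m n : ℝ) / n) atTop (𝓝 x)) (a : ℝ) :
    Tendsto (fun n : ℕ => tiltBase (c / n) a (m n)) atTop (𝓝 (tiltCurve c a x)) := by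
  have h1 : Tendsto (fun n : ℕ => tiltCurve 1 a (logRate c n * (m n / n))) atTop
      (𝓝 (tiltCurve 1 a (c * x))) :=
    ((continuous_tiltCurve 1 a).tendsto _).comp ((tendsto_logRate c).mul hmx)
  rw [tiltCurve_eq_one_mul c]
  refine h1.congr' ?_
  filter_upwards [eventually_gt_atTop 0, tendsto_natCast_atTop_atTop.eventually_gt_atTop c]
    with n hn hcn
  rw [tiltBase_eq_tiltCurve hcn hn, ← tiltCurve_eq_one_mul]

lemma eventually_tiltBase_pos (hc : 0 < c) {m : ℕ → ℕ}
    (hmx : Tendsto (fun n => (m n : ℝ) / n) atTop (𝓝 x)) (hu : 0 < tiltCurve c a x) :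
    ∀ᶠ n : ℕ in atTop, ∀ j ≤ m n, 0 < tiltBase (c / n) a j := by
  filter_upwards [eventually_gt_atTop 0, tendsto_natCast_atTop_atTop.eventually_gt_atTop c,
    (tendsto_tiltBase hmx a).eventually_const_lt hu,
    (tendsto_logRate c).eventually_const_lt hc] with n hn hcn hpos hrate j hj
  rw [tiltBase_eq_tiltCurve hcn hn] at hpos ⊢
  refine tiltCurve_pos hrate ?_ hpos
  have : (j : ℝ) ≤ m n := by exact_mod_cast hj
  gcongr

/-- The integral of the logarithm of `tiltCurve`. -/
def logInt (c a x : ℝ) : ℝ := ∫ t in (0 : ℝ)..x, Real.log (tiltCurve c a t)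

lemma logInt_eq_one (hc : c ≠ 0) (a x : ℝ) : logInt c a x = c⁻¹ * logInt 1 a (c * x) := by
  unfold logInt
  have := intervalIntegral.integral_comp_mul_left (a := 0) (b := x)
    (fun t => Real.log (tiltCurve 1 a t)) hc
  simp only [← tiltCurve_eq_one_mul, mul_zero, smul_eq_mul] at this
  exact this

lemma continuousAt_logInt (hc : 0 < c) (hx : 0 ≤ x) (hu : 0 < tiltCurve c a x) :
    ContinuousAt (logInt c a) x := by
  have hcont : ContinuousOn (fun t => Real.log (tiltCurve c a t)) (uIcc 0 x) := by
    rw [uIcc_of_le hx]; exact continuousOn_log_tiltCurve hc hu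
  refine (intervalIntegral.integral_hasDerivAt_right hcont.intervalIntegrable ?_ ?_).continuousAt
  · exact (Real.measurable_log.comp
      (continuous_tiltCurve c a).measurable).stronglyMeasurable.stronglyMeasurableAtFilter
  · exact (continuous_tiltCurve c a).continuousAt.log hu.ne'

/-- The bases are exact values of the curve with rate `logRate c n`, so the sum is a Riemann sum of
a monotone function. Its error is at most the total increment, which stays bounded and disappears on
division by `n`. -/
lemma tendsto_tiltLog (hc : 0 < c) (hx : 0 ≤ x) (hu : 0 < tiltCurve c a x) {m : ℕ → ℕ}
    (hmx : Tendsto (fun n => (m n : ℝ) / n) atTop (𝓝 x)) :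
    Tendsto (fun n : ℕ => tiltLog (c / n) a (m n) / n) atTop (𝓝 (logInt c a x)) := by
  have hrate := tendsto_logRate c
  have hbase := tendsto_tiltBase (c := c) hmx a
  have hmain : Tendsto (fun n : ℕ => (logRate c n)⁻¹ * logInt 1 a (logRate c n * (m n / n))) atTop
      (𝓝 (c⁻¹ * logInt 1 a (c * x))) := by
    refine (hrate.inv₀ hc.ne').mul ?_
    refine (continuousAt_logInt one_pos (by positivity) ?_).tendsto.comp (hrate.mul hmx)
    rwa [← tiltCurve_eq_one_mul]
  rw [← logInt_eq_one hc.ne'] at hmain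
  have herr : Tendsto (fun n : ℕ => |Real.log (tiltBase (c / n) a (m n)) - Real.log a| / n) atTop
      (𝓝 0) := by
    have h1 : Tendsto (fun n : ℕ => |Real.log (tiltBase (c / n) a (m n)) - Real.log a|) atTop
        (𝓝 |Real.log (tiltCurve c a x) - Real.log a|) :=
      ((hbase.log hu.ne').sub_const _).abs
    exact h1.div_atTop tendsto_natCast_atTop_atTop
  have hdiff : Tendsto (fun n : ℕ => tiltLog (c / n) a (m n) / n -
      (logRate c n)⁻¹ * logInt 1 a (logRate c n * (m n / n))) atTop (𝓝 0) := by
    refine squeeze_zero_norm' ?_ herr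
    filter_upwards [eventually_gt_atTop 0, tendsto_natCast_atTop_atTop.eventually_gt_atTop c,
      eventually_tiltBase_pos hc hmx hu, hrate.eventually_const_lt hc] with n hn hcn hpos hrn
    have hn' : (0 : ℝ) < n := by exact_mod_cast hn
    set κ := logRate c n with hκ
    set g : ℝ → ℝ := fun t => Real.log (tiltCurve κ a (t / n)) with hg
    have hum := hpos (m n) le_rfl
    rw [tiltBase_eq_tiltCurve hcn hn] at hum
    have hup : ∀ t ∈ Icc 0 (m n : ℝ), 0 < tiltCurve κ a (t / n) := fun t ht =>
      tiltCurve_pos hrn (by have := ht.2; gcongr) hum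
    have hmono : MonotoneOn g (Icc 0 (m n : ℝ)) ∨ AntitoneOn g (Icc 0 (m n : ℝ)) := by
      rcases tiltCurve_mono_or_anti hrn a with h | h
      · exact Or.inl fun t ht t' ht' htt' => Real.log_le_log (hup t ht) (h (by gcongr))
      · exact Or.inr fun t ht t' ht' htt' => Real.log_le_log (hup t' ht') (h (by gcongr))
    have hsum := abs_sum_sub_integral_le hmono
    have hint : ∫ t in (0 : ℝ)..m n, g t = n * (κ⁻¹ * logInt 1 a (κ * (m n / n))) := by
      rw [← logInt_eq_one hrn.ne', logInt]
      have := intervalIntegral.integral_comp_div (a := 0) (b := (m n : ℝ))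
        (fun t => Real.log (tiltCurve κ a t)) hn'.ne'
      rw [zero_div, smul_eq_mul] at this
      exact this
    have h0 : g 0 = Real.log a := by simp [hg, tiltCurve_zero]
    have hgm : g (m n) = Real.log (tiltBase (c / n) a (m n)) := by
      rw [tiltBase_eq_tiltCurve hcn hn]
    have htl : ∑ j ∈ Finset.range (m n), g j = tiltLog (c / n) a (m n) :=
      Finset.sum_congr rfl fun j _ => by rw [tiltBase_eq_tiltCurve hcn hn]
    rw [hint, h0, hgm, htl] at hsum
    rw [Real.norm_eq_abs]
    refine le_trans (le_of_eq ?_) (div_le_div_of_nonneg_right hsum hn'.le)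
    rw [← abs_of_pos hn', ← abs_div, abs_of_pos hn']
    congr 1
    field_simp
  have := hdiff.add hmain
  simpa using this

/-- The exponential rate of a state `v n` at time `x n` under the tilt `a`. -/
def tiltRate (c a x v : ℝ) : ℝ := Real.log a - logInt c a x - v * Real.log (tiltCurve c a x)

/-- Concavity of `log`: the term `log a` is bounded by its tangent at `a`, the terms in `log u`,
which enter with a minus sign, by their tangents at `a'`. This replaces differentiating the integral
in the parameter. -/
lemma tiltRate_sub_le {a' : ℝ} (hc : 0 < c) (ha : 0 < a) (ha' : 0 < a') (ha1' : a' ≠ 1)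
    (hx : 0 ≤ x) (hu : 0 < tiltCurve c a x) (hu' : 0 < tiltCurve c a' x) (hv : 0 ≤ v) :
    tiltRate c a' x v - tiltRate c a x v ≤
      (a' - a) * (1 / a - tiltInt c a' x - v * (Real.exp (c * x) / tiltCurve c a' x)) := by
  have key : ∀ t, 0 < tiltCurve c a t → 0 < tiltCurve c a' t →
      (a' - a) * (Real.exp (c * t) / tiltCurve c a' t) ≤
        Real.log (tiltCurve c a' t) - Real.log (tiltCurve c a t) := by
    intro t h h'
    have h1 := Real.log_le_sub_one_of_pos (div_pos h h')
    rw [Real.log_div h.ne' h'.ne'] at h1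
    have h2 : tiltCurve c a t / tiltCurve c a' t - 1 =
        -((a' - a) * (Real.exp (c * t) / tiltCurve c a' t)) := by
      field_simp
      rw [tiltCurve, tiltCurve]; ring
    linarith
  have h1 : Real.log a' - Real.log a ≤ (a' - a) * (1 / a) := by
    have h := Real.log_le_sub_one_of_pos (div_pos ha' ha)
    rw [Real.log_div ha'.ne' ha.ne'] at h
    have : a' / a - 1 = (a' - a) * (1 / a) := by field_simp
    linarith
  have h2 : (a' - a) * tiltInt c a' x ≤ logInt c a' x - logInt c a x := by
    rw [← integral_tiltInt hc ha' ha1' hx hu', logInt, logInt,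
      ← intervalIntegral.integral_const_mul, ← intervalIntegral.integral_sub]
    · refine intervalIntegral.integral_mono_on hx ?_ ?_ fun t ht =>
        key t (tiltCurve_pos hc ht.2 hu) (tiltCurve_pos hc ht.2 hu')
      · refine ContinuousOn.intervalIntegrable (continuousOn_const.mul (ContinuousOn.div
          (by fun_prop) (continuous_tiltCurve c a').continuousOn fun t ht => ?_))
        rw [uIcc_of_le hx] at ht
        exact (tiltCurve_pos hc ht.2 hu').ne'
      · refine ContinuousOn.intervalIntegrable ?_
        rw [uIcc_of_le hx]
        exact (continuousOn_log_tiltCurve hc hu').sub (continuousOn_log_tiltCurve hc hu)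
    all_goals
      refine ContinuousOn.intervalIntegrable ?_
      rw [uIcc_of_le hx]
      exact continuousOn_log_tiltCurve hc (by assumption)
  have h3 := mul_le_mul_of_nonneg_left (key x hu hu') hv
  unfold tiltRate
  nlinarith

lemma continuousAt_tiltCurve_param (c a x : ℝ) : ContinuousAt (fun a => tiltCurve c a x) a := by
  unfold tiltCurve; fun_prop

lemma tendsto_tiltRate_slope (hc : 0 < c) (ha : 0 < a) (ha1 : a ≠ 1)
    (hu : 0 < tiltCurve c a x) (v : ℝ) :
    Tendsto (fun a' => 1 / a - tiltInt c a' x - v * (Real.exp (c * x) / tiltCurve c a' x)) (𝓝 a)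
      (𝓝 ((yHat c a x - v) * (Real.exp (c * x) / tiltCurve c a x))) := by
  have h1 : ContinuousAt (fun a' => tiltInt c a' x) a := by
    unfold tiltInt
    refine ContinuousAt.div (((continuousAt_tiltCurve_param c a x).div continuousAt_id
      ha.ne').log (div_pos hu ha).ne') (by fun_prop) (mul_ne_zero hc.ne' (sub_ne_zero.2 ha1))
  have h2 : ContinuousAt
      (fun a' => 1 / a - tiltInt c a' x - v * (Real.exp (c * x) / tiltCurve c a' x)) a :=
    (continuousAt_const.sub h1).sub (continuousAt_const.mul
      (continuousAt_const.div (continuousAt_tiltCurve_param c a x) hu.ne'))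
  have h3 := h2.tendsto
  convert h3 using 2
  rw [yHat_eq]
  have h3 : Real.exp (c * x) ≠ 0 := (Real.exp_pos _).ne'
  field_simp

lemma eventually_tilt_nhds (ha : 0 < a) (ha1 : a ≠ 1) (hu : 0 < tiltCurve c a x) :
    ∀ᶠ a' in 𝓝 a, 0 < a' ∧ a' ≠ 1 ∧ (1 < a ↔ 1 < a') ∧ 0 < tiltCurve c a' x := by
  have h4 := (continuousAt_tiltCurve_param c a x).tendsto.eventually_const_lt hu
  rcases lt_or_gt_of_ne ha1 with h | h
  · filter_upwards [eventually_gt_nhds ha, eventually_lt_nhds h, h4] with a' h1 h2 h3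
    exact ⟨h1, h2.ne, by constructor <;> intro <;> linarith, h3⟩
  · filter_upwards [eventually_gt_nhds ha, eventually_gt_nhds h, h4] with a' h1 h2 h3
    exact ⟨h1, h2.ne', by constructor <;> intro <;> linarith, h3⟩

/-- The slope factor in `tiltRate_sub_le` tends to a positive multiple of `ŷ(x) - v` as `a' → a`, so
above `ŷ` a slightly larger parameter has smaller rate. -/
lemma exists_tilt_gt (hc : 0 < c) (ha : 0 < a) (ha1 : a ≠ 1) (hx : 0 ≤ x)
    (hu : 0 < tiltCurve c a x) (hv : 0 ≤ v) (hlt : yHat c a x < v) :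
    ∃ a', a < a' ∧ (1 < a ↔ 1 < a') ∧ 0 < tiltCurve c a' x ∧
      tiltRate c a' x v < tiltRate c a x v := by
  have hneg : (yHat c a x - v) * (Real.exp (c * x) / tiltCurve c a x) < 0 :=
    mul_neg_of_neg_of_pos (by linarith) (by positivity)
  have hev := ((tendsto_tiltRate_slope hc ha ha1 hu v).eventually_lt_const hneg).and
    (eventually_tilt_nhds ha ha1 hu)
  obtain ⟨a', ⟨h1, h2, h3, h4, h5⟩, h6⟩ := ((hev.filter_mono nhdsWithin_le_nhds).and
    (self_mem_nhdsWithin (s := Ioi a))).exists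
  refine ⟨a', h6, h4, h5, ?_⟩
  have := tiltRate_sub_le hc ha h2 h3 hx hu h5 hv
  have h7 : 0 < a' - a := sub_pos.2 h6
  nlinarith

lemma exists_tilt_lt (hc : 0 < c) (ha : 0 < a) (ha1 : a ≠ 1) (hx : 0 ≤ x)
    (hu : 0 < tiltCurve c a x) (hv : 0 ≤ v) (hlt : v < yHat c a x) :
    ∃ a', 0 < a' ∧ a' < a ∧ (1 < a ↔ 1 < a') ∧ 0 < tiltCurve c a' x ∧
      tiltRate c a' x v < tiltRate c a x v := by
  have hpos : 0 < (yHat c a x - v) * (Real.exp (c * x) / tiltCurve c a x) :=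
    mul_pos (by linarith) (by positivity)
  have hev := ((tendsto_tiltRate_slope hc ha ha1 hu v).eventually_const_lt hpos).and
    (eventually_tilt_nhds ha ha1 hu)
  obtain ⟨a', ⟨h1, h2, h3, h4, h5⟩, h6⟩ := ((hev.filter_mono nhdsWithin_le_nhds).and
    (self_mem_nhdsWithin (s := Iio a))).exists
  refine ⟨a', h2, h6, h4, h5, ?_⟩
  have := tiltRate_sub_le hc ha h2 h3 hx hu h5 hv
  have h7 : a' - a < 0 := sub_neg.2 h6
  nlinarith

lemma pow_eq_exp_log {n : ℕ} (ha : 0 < a) : a ^ n = Real.exp (n * Real.log a) := by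
  rw [mul_comm, Real.exp_mul, Real.exp_log ha, Real.rpow_natCast]

/-- A tilt of smaller rate is exponentially negligible. -/
lemma exists_tiltRatio_le {a' : ℝ} (hc : 0 < c) (ha : 0 < a) (ha' : 0 < a') (hx : 0 ≤ x)
    (hu : 0 < tiltCurve c a x) (hu' : 0 < tiltCurve c a' x)
    (hlt : tiltRate c a' x v < tiltRate c a x v) {m : ℕ → ℕ}
    (hmx : Tendsto (fun n => (m n : ℝ) / n) atTop (𝓝 x)) :
    ∃ δ > 0, ∀ᶠ n : ℕ in atTop,
      tiltRatio (c / n) a a' (n * v) (m n) * a' ^ n ≤ a ^ n * Real.exp (-δ * n) := by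
  refine ⟨(tiltRate c a x v - tiltRate c a' x v) / 2, by linarith, ?_⟩
  have hl := (tendsto_tiltBase hmx a).log hu.ne'
  have hl' := (tendsto_tiltBase hmx a').log hu'.ne'
  have hS := tendsto_tiltLog hc hx hu hmx
  have hS' := tendsto_tiltLog hc hx hu' hmx
  have hlim := (((hl.sub hl').const_mul v).add (hS.sub hS')).add_const (Real.log a' - Real.log a)
  have hval : v * (Real.log (tiltCurve c a x) - Real.log (tiltCurve c a' x)) +
      (logInt c a x - logInt c a' x) + (Real.log a' - Real.log a) <
      -((tiltRate c a x v - tiltRate c a' x v) / 2) := by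
    unfold tiltRate at *; linarith
  filter_upwards [hlim.eventually_lt_const hval, eventually_gt_atTop 0] with n hn hn0
  have hn' : (0 : ℝ) < n := by exact_mod_cast hn0
  rw [tiltRatio, pow_eq_exp_log ha, pow_eq_exp_log ha', ← Real.exp_add, ← Real.exp_add,
    Real.exp_le_exp]
  have h1 := mul_lt_mul_of_pos_left hn hn'
  have h2 : ∀ S S' : ℝ, n * (v * (Real.log (tiltBase (c / n) a (m n)) -
      Real.log (tiltBase (c / n) a' (m n))) + (S / n - S' / n) + (Real.log a' - Real.log a)) =
      n * v * (Real.log (tiltBase (c / n) a (m n)) - Real.log (tiltBase (c / n) a' (m n))) +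
      (S - S') + n * (Real.log a' - Real.log a) := by
    intro S S'; field_simp
  rw [h2] at h1
  linarith

end Asymptotics

/-! ### Bounds on the deviation probability -/

section LowerBound

variable {c a x v s : ℝ}

lemma tendsto_div_of_abs_sub_le {m : ℕ → ℕ} {t : ℕ → ℝ} (ht : Tendsto t atTop (𝓝 x))
    (h : ∀ᶠ n : ℕ in atTop, |(m n : ℝ) - t n * n| ≤ 1) :
    Tendsto (fun n => (m n : ℝ) / n) atTop (𝓝 x) := by
  have h1 : Tendsto (fun n : ℕ => (m n : ℝ) / n - t n) atTop (𝓝 0) := by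
    refine squeeze_zero_norm' ?_ tendsto_one_div_atTop_nhds_zero_nat
    filter_upwards [h, eventually_gt_atTop 0] with n hn hn0
    have hn' : (0 : ℝ) < n := by exact_mod_cast hn0
    rw [Real.norm_eq_abs, show (m n : ℝ) / n - t n = ((m n : ℝ) - t n * n) / n by field_simp,
      abs_div, abs_of_pos hn']
    gcongr
  simpa using h1.add ht

lemma tendsto_floor_div (hx : 0 ≤ x) :
    Tendsto (fun n : ℕ => (⌊x * n⌋₊ : ℝ) / n) atTop (𝓝 x) := by
  refine tendsto_div_of_abs_sub_le (t := fun _ => x) tendsto_const_nhds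
    (Eventually.of_forall fun n => ?_)
  have h1 := Nat.floor_le (show 0 ≤ x * n by positivity)
  have h2 := Nat.lt_floor_add_one (x * n)
  rw [abs_le]; constructor <;> linarith

lemma tendsto_mul_exp_neg {δ : ℝ} (hδ : 0 < δ) :
    Tendsto (fun n : ℕ => (n : ℝ) * Real.exp (-δ * n)) atTop (𝓝 0) := by
  have h := (Real.tendsto_pow_mul_exp_neg_atTop_nhds_zero 1).comp
    ((tendsto_natCast_atTop_atTop (R := ℝ)).const_mul_atTop hδ)
  have h2 := h.const_mul δ⁻¹
  rw [mul_zero] at h2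
  refine h2.congr fun n => ?_
  simp only [Function.comp, pow_one]
  rw [neg_mul]
  field_simp

lemma tendsto_exp_neg_mul {δ : ℝ} (hδ : 0 < δ) :
    Tendsto (fun n : ℕ => Real.exp (-δ * n)) atTop (𝓝 0) := by
  refine Real.tendsto_exp_atBot.comp ?_
  exact (tendsto_natCast_atTop_atTop (R := ℝ)).const_mul_atTop_of_neg (by linarith)

lemma div_natCast_mem {n : ℕ} (hc : 0 < c) (hn : c < n) : 0 ≤ c / n ∧ c / n < 1 :=
  ⟨by positivity, (div_lt_one (hc.trans hn)).2 hn⟩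

/-- The chain is alive and below `v n` at a time close to `x n` with probability at least
exponentially close to the tilted rate. -/
lemma eventually_exp_le_stepOp_iterate (hc : 0 < c) (ha : 0 < a) (ha1 : a ≠ 1) (hx : 0 ≤ x)
    (hu : 0 < tiltCurve c a x) (hy : 0 < yHat c a x) (hyv : yHat c a x < v) {m : ℕ → ℕ}
    (hmx : Tendsto (fun n => (m n : ℝ) / n) atTop (𝓝 x)) {L : ℝ}
    (hL : L < Real.log a - logInt c a x - v * |Real.log (tiltCurve c a x)|) :
    ∀ᶠ n : ℕ in atTop, Real.exp (n * L) ≤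
      (stepOp (c / n))^[m n] (indicator {w | 0 < w ∧ (w : ℝ) < n * v} 1) n := by
  have hv : 0 ≤ v := (hy.trans hyv).le
  -- Level `0 < ŷ(x)` controls absorption and level `v > ŷ(x)` controls large states; both errors
  -- are exponentially small relative to `a ^ n`.
  obtain ⟨a₁, ha₁, h₁, -, hu₁, hr₁⟩ := exists_tilt_lt hc ha ha1 hx hu le_rfl hy
  obtain ⟨a₂, h₂, -, hu₂, hr₂⟩ := exists_tilt_gt hc ha ha1 hx hu hv hyv
  obtain ⟨δ₁, hδ₁, hev₁⟩ := exists_tiltRatio_le hc ha ha₁ hx hu hu₁ hr₁ hmx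
  obtain ⟨δ₂, hδ₂, hev₂⟩ := exists_tiltRatio_le hc ha (ha.trans h₂) hx hu hu₂ hr₂ hmx
  have herr : Tendsto (fun n : ℕ => ((m n : ℝ) + 1) * Real.exp (-δ₁ * n) + Real.exp (-δ₂ * n))
      atTop (𝓝 0) := by
    have h := ((hmx.mul (tendsto_mul_exp_neg hδ₁)).add (tendsto_exp_neg_mul hδ₁)).add
      (tendsto_exp_neg_mul hδ₂)
    simp only [mul_zero, add_zero] at h
    refine h.congr' ?_
    filter_upwards [eventually_gt_atTop 0] with n hn
    have hn' : (n : ℝ) ≠ 0 := by positivity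
    field_simp
  have hlim := ((tendsto_const_nhds (x := Real.log a)).sub (tendsto_tiltLog hc hx hu hmx)).sub
    (((tendsto_tiltBase hmx a).log hu.ne').abs.const_mul v)
  have hlim2 := hlim.sub (tendsto_const_div_atTop_nhds_zero_nat (Real.log 2))
  rw [sub_zero] at hlim2
  filter_upwards [hev₁, hev₂, herr.eventually_lt_const (show (0 : ℝ) < 1 / 2 by norm_num),
    hlim2.eventually_const_lt hL, eventually_tiltBase_pos hc hmx hu₁,
    eventually_gt_atTop 0, tendsto_natCast_atTop_atTop.eventually_gt_atTop c]
    with n e₁ e₂ e₃ e₄ hpos hn0 hcn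
  have hn' : (0 : ℝ) < n := by exact_mod_cast hn0
  obtain ⟨hp0, hp1⟩ := div_natCast_mem hc hcn
  have key := le_stepOp_iterate_tiltWeight (r := n * v) hp0 hp1 ha₁ h₁ h₂ n hpos
  rw [mul_zero] at e₁
  have han : 0 < a ^ n := by positivity
  have e₅ : a ^ n / 2 ≤ (stepOp (c / n))^[m n]
      (indicator {w | 0 < w ∧ (w : ℝ) < n * v} (tiltWeight (c / n) a (m n))) n := by
    refine le_trans ?_ key
    have f1 := mul_le_mul_of_nonneg_left e₁ (show (0 : ℝ) ≤ (m n : ℝ) + 1 by positivity)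
    have f2 := mul_lt_mul_of_pos_left e₃ han
    nlinarith
  set z := tiltBase (c / n) a (m n) with hz
  -- Undoing the tilt: on the event the weight is at most this constant, so a lower bound on its
  -- mean bounds the probability from below.
  have hind : indicator {w : ℕ | 0 < w ∧ (w : ℝ) < n * v} (tiltWeight (c / n) a (m n)) ≤
      fun w => Real.exp (n * v * |Real.log z| + tiltLog (c / n) a (m n)) *
        indicator {w : ℕ | 0 < w ∧ (w : ℝ) < n * v} 1 w := by
    intro w
    by_cases hw : 0 < w ∧ (w : ℝ) < n * v
    · rw [indicator_of_mem (show w ∈ {w : ℕ | 0 < w ∧ (w : ℝ) < n * v} from hw)]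
      dsimp only
      rw [indicator_of_mem (show w ∈ {w : ℕ | 0 < w ∧ (w : ℝ) < n * v} from hw), Pi.one_apply,
        mul_one, tiltWeight, Real.exp_le_exp]
      have g1 : (w : ℝ) * Real.log z ≤ w * |Real.log z| :=
        mul_le_mul_of_nonneg_left (le_abs_self _) (Nat.cast_nonneg w)
      have g2 : (w : ℝ) * |Real.log z| ≤ n * v * |Real.log z| :=
        mul_le_mul_of_nonneg_right hw.2.le (abs_nonneg _)
      linarith
    · rw [indicator_of_notMem (show w ∉ {w : ℕ | 0 < w ∧ (w : ℝ) < n * v} from hw)]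
      dsimp only
      rw [indicator_of_notMem (show w ∉ {w : ℕ | 0 < w ∧ (w : ℝ) < n * v} from hw), mul_zero]
  have e₆ := e₅.trans (stepOp_iterate_mono hp0 hp1.le (m n) hind n)
  rw [stepOp_iterate_smul] at e₆
  dsimp only at e₆
  have e₇ : Real.exp (n * L) * Real.exp (n * v * |Real.log z| + tiltLog (c / n) a (m n)) ≤
      a ^ n / 2 := by
    have h2 : (2 : ℝ) = Real.exp (Real.log 2) := (Real.exp_log two_pos).symm
    rw [pow_eq_exp_log ha, h2, ← Real.exp_sub, ← Real.exp_add, Real.exp_le_exp]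
    have h3 := mul_lt_mul_of_pos_left e₄ hn'
    have h4 : ∀ S l : ℝ, (n : ℝ) * (Real.log a - S / n - v * |Real.log z| - l / n) =
        n * Real.log a - S - n * v * |Real.log z| - l := by intro S l; field_simp
    rw [h4] at h3
    linarith
  have e₈ := e₇.trans e₆
  rw [mul_comm] at e₈
  exact le_of_mul_le_mul_left e₈ (Real.exp_pos _)

lemma devStates_of_lt (h : a < 1) : devStates a = {0} := by ext w; simp [devStates, h]

lemma devStates_of_gt (h : 1 < a) : devStates a = {0}ᶜ := by
  ext w; simp [devStates, not_lt.2 h.le]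

lemma stepOp_iterate_nonneg {p : ℝ} (h0 : 0 ≤ p) (h1 : p ≤ 1) (k : ℕ) {f : ℕ → ℝ} (hf : 0 ≤ f) :
    0 ≤ (stepOp p)^[k] f := by
  have := stepOp_iterate_mono h0 h1 k hf
  refine le_trans (le_of_eq ?_) this
  have h := stepOp_iterate_smul p 0 k f
  simp only [zero_mul] at h
  exact h.symm

/-- Being alive and below `r` at time `k` forces the deviation at time `m`. -/
lemma stepOp_iterate_near_le {p r : ℝ} (h0 : 0 ≤ p) (h1 : p ≤ 1) {k m : ℕ}
    (h : (a < 1 ∧ k + r ≤ m) ∨ (1 < a ∧ m ≤ k)) (n : ℕ) :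
    (stepOp p)^[k] (indicator {w | 0 < w ∧ (w : ℝ) < r} 1) n ≤
      (stepOp p)^[m] (indicator (devStates a) 1) n := by
  rcases h with ⟨ha, hkm⟩ | ⟨ha, hmk⟩
  · rw [devStates_of_lt ha]
    -- For `r ≤ 0` the event is empty, and `k ≤ m` need not follow from `k + r ≤ m`.
    rcases le_total r 0 with hr | hr
    · have : {w : ℕ | 0 < w ∧ (w : ℝ) < r} = ∅ := by
        ext w
        simp only [mem_ofPred_eq, mem_empty_iff_false, iff_false, not_and, not_lt]
        exact fun _ => hr.trans (Nat.cast_nonneg w)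
      rw [this, indicator_empty]
      have hz := stepOp_iterate_smul p 0 k (fun _ => 0)
      simp only [zero_mul] at hz
      have e : (stepOp p)^[k] (fun _ => 0) n = 0 := congrFun hz n
      rw [e]
      exact stepOp_iterate_nonneg h0 h1 m (indicator_nonneg fun _ _ => zero_le_one) n
    have hkm' : k ≤ m := by
      have : (k : ℝ) ≤ m := by linarith
      exact_mod_cast this
    rw [← Nat.add_sub_cancel' hkm', Function.iterate_add_apply]
    refine stepOp_iterate_mono h0 h1 k (fun w => ?_) n
    by_cases hw : 0 < w ∧ (w : ℝ) < r
    · rw [indicator_of_mem (show w ∈ {w : ℕ | 0 < w ∧ (w : ℝ) < r} from hw),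
        stepOp_iterate_absorbed]
      · rfl
      · have : ((k + w : ℕ) : ℝ) ≤ m := by push_cast; linarith [hw.2]
        have : k + w ≤ m := by exact_mod_cast this
        omega
    · rw [indicator_of_notMem (show w ∉ {w : ℕ | 0 < w ∧ (w : ℝ) < r} from hw)]
      exact stepOp_iterate_nonneg h0 h1 _ (indicator_nonneg fun _ _ => zero_le_one) w
  · rw [devStates_of_gt ha]
    have hsub : indicator {w : ℕ | 0 < w ∧ (w : ℝ) < r} (1 : ℕ → ℝ) ≤ indicator {0}ᶜ 1 :=
      indicator_le_indicator_of_subset (fun w hw => Nat.pos_iff_ne_zero.1 hw.1)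
        fun _ => zero_le_one
    refine (stepOp_iterate_mono h0 h1 k hsub n).trans ?_
    rw [← Nat.add_sub_cancel' hmk, Function.iterate_add_apply]
    exact stepOp_iterate_mono h0 h1 m (stepOp_iterate_indicator_antitone h0 h1 _) n

lemma tiltRate_zero_right (c a x : ℝ) : tiltRate c a x 0 = Real.log a - logInt c a x := by
  simp [tiltRate]

/-- Near `a` there are tilts whose own optimal cost is close to that of `a`. -/
lemma eventually_lt_tiltRate_paramTime (hc : 0 < c) (h : IsParam c s a) (hs : 0 < s) {L : ℝ}
    (hL : L < Real.log a - logInt c a s) :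
    ∀ᶠ a' in 𝓝 a, L < Real.log a' - logInt c a' (paramTime c a') := by
  obtain ⟨ha, ha1, hsa⟩ := isParam_iff.1 h
  have hus := tiltCurve_param_pos hc h
  have hcp : Tendsto (paramTime c) (𝓝 a) (𝓝 s) := hsa ▸ (continuousAt_paramTime hc ha ha1).tendsto
  -- Comparing rates with `a` as the reference parameter leaves only functions with `a` fixed and
  -- the time varying; joint continuity of `logInt` is not needed.
  have hlow : Tendsto (fun a' => Real.log a - logInt c a (paramTime c a') -
      (a - a') * (1 / a' - tiltInt c a (paramTime c a'))) (𝓝 a)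
      (𝓝 (Real.log a - logInt c a s - (a - a) * (1 / a - tiltInt c a s))) := by
    have h1 := (continuousAt_logInt hc hs.le hus).tendsto.comp hcp
    have h2 := (hasDerivAt_tiltInt hc ha ha1 hus).continuousAt.tendsto.comp hcp
    have h3 : Tendsto (fun a' : ℝ => 1 / a') (𝓝 a) (𝓝 (1 / a)) :=
      (continuousAt_const.div continuousAt_id ha.ne').tendsto
    exact (tendsto_const_nhds.sub h1).sub ((tendsto_const_nhds.sub tendsto_id).mul (h3.sub h2))
  rw [sub_self, zero_mul, sub_zero] at hlow
  have hu' : Tendsto (fun a' => tiltCurve c a (paramTime c a')) (𝓝 a) (𝓝 (tiltCurve c a s)) :=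
    ((continuous_tiltCurve c a).tendsto s).comp hcp
  filter_upwards [hlow.eventually_const_lt hL, hu'.eventually_const_lt hus,
    hcp.eventually_const_lt hs, eventually_tilt_nhds ha ha1 hus] with a' h1 h2 h3 h4
  have hp : IsParam c (paramTime c a') a' := isParam_iff.2 ⟨h4.1, h4.2.1, rfl⟩
  have := tiltRate_sub_le (v := 0) hc h4.1 ha ha1 h3.le (tiltCurve_param_pos hc hp) h2 le_rfl
  rw [tiltRate_zero_right, tiltRate_zero_right] at this
  simp only [zero_mul, sub_zero] at this
  linarith

/-- A tilt and a time slightly before its absorption that realize the deviation cheaply. -/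
lemma exists_near_optimal (hc : 0 < c) (h : IsParam c s a) (hs : 0 < s) {L : ℝ}
    (hL : L < Real.log a - logInt c a s) :
    ∃ a' x v, 0 < a' ∧ a' ≠ 1 ∧ 0 ≤ x ∧ 0 < tiltCurve c a' x ∧ 0 < yHat c a' x ∧ yHat c a' x < v ∧
      L < Real.log a' - logInt c a' x - v * |Real.log (tiltCurve c a' x)| ∧
      ((a < 1 ∧ x + v < s) ∨ (1 < a ∧ s < x)) := by
  obtain ⟨ha, ha1, hsa⟩ := isParam_iff.1 h
  have hus := tiltCurve_param_pos hc h
  have hcp : Tendsto (paramTime c) (𝓝 a) (𝓝 s) := hsa ▸ (continuousAt_paramTime hc ha ha1).tendsto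
  have hev := ((eventually_lt_tiltRate_paramTime hc h hs hL).and
    (hcp.eventually_const_lt hs)).and (eventually_tilt_nhds ha ha1 hus)
  -- The parameter moves away from `1` locally, so the optimal trajectory of `a'` ends before `s`
  -- when an early end is wanted and after `s` when a late end is wanted.
  obtain ⟨a', ha0', ha1', hs0', hL', hside⟩ : ∃ a', 0 < a' ∧ a' ≠ 1 ∧ 0 < paramTime c a' ∧
      L < Real.log a' - logInt c a' (paramTime c a') ∧
      ((a < 1 ∧ paramTime c a' < s) ∨ (1 < a ∧ s < paramTime c a')) := by
    rcases lt_or_gt_of_ne ha1 with hlt | hgt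
    · obtain ⟨a', ⟨⟨h1, h2⟩, h3⟩, h4⟩ := ((hev.filter_mono nhdsWithin_le_nhds).and
        (self_mem_nhdsWithin (s := Iio a))).exists
      exact ⟨a', h3.1, h3.2.1, h2, h1, Or.inl ⟨hlt, hsa ▸ paramTime_lt hc h3.1 h3.2.1 ha1 h4⟩⟩
    · obtain ⟨a', ⟨⟨h1, h2⟩, h3⟩, h4⟩ := ((hev.filter_mono nhdsWithin_le_nhds).and
        (self_mem_nhdsWithin (s := Ioi a))).exists
      exact ⟨a', h3.1, h3.2.1, h2, h1, Or.inr ⟨hgt, hsa ▸ paramTime_lt hc ha ha1 h3.2.1 h4⟩⟩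
  set s' := paramTime c a' with hs'
  have hp : IsParam c s' a' := isParam_iff.2 ⟨ha0', ha1', rfl⟩
  have hus' := tiltCurve_param_pos hc hp
  obtain ⟨v, hv0, hvL, hvs⟩ : ∃ v, 0 < v ∧
      L < Real.log a' - logInt c a' s' - v * |Real.log (tiltCurve c a' s')| ∧
      ((a < 1 ∧ s' + v < s) ∨ (1 < a ∧ s < s')) := by
    have h1 : Tendsto (fun v : ℝ => Real.log a' - logInt c a' s' -
        v * |Real.log (tiltCurve c a' s')|) (𝓝 0) (𝓝 (Real.log a' - logInt c a' s')) := by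
      have : Continuous (fun v : ℝ => Real.log a' - logInt c a' s' -
        v * |Real.log (tiltCurve c a' s')|) := by fun_prop
      simpa using this.tendsto 0
    have h2 : ∀ᶠ v : ℝ in 𝓝 0, (a < 1 ∧ s' + v < s) ∨ (1 < a ∧ s < s') := by
      rcases hside with h' | h'
      · have : Tendsto (fun v : ℝ => s' + v) (𝓝 0) (𝓝 s') := by
          simpa using (tendsto_const_nhds (x := s')).add (tendsto_id (α := ℝ) (x := 𝓝 0))
        filter_upwards [this.eventually_lt_const h'.2] with v hv using Or.inl ⟨h'.1, hv⟩
      · exact Eventually.of_forall fun _ => Or.inr h'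
    obtain ⟨v, ⟨h3, h4⟩, h5⟩ := ((((h1.eventually_const_lt hL').and h2).filter_mono
      nhdsWithin_le_nhds).and (self_mem_nhdsWithin (s := Ioi (0 : ℝ)))).exists
    exact ⟨v, h5, h3, h4⟩
  have hy : Tendsto (yHat c a') (𝓝 s') (𝓝 0) := by
    have := (hasDerivAt_yHat hc ha0' ha1' hus').continuousAt.tendsto
    rwa [yHat_param hc hp] at this
  have hlim : Tendsto (fun x => Real.log a' - logInt c a' x -
      v * |Real.log (tiltCurve c a' x)|) (𝓝 s')
      (𝓝 (Real.log a' - logInt c a' s' - v * |Real.log (tiltCurve c a' s')|)) :=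
    (tendsto_const_nhds.sub (continuousAt_logInt hc hs0'.le hus').tendsto).sub
      ((((continuous_tiltCurve c a').tendsto s').log hus'.ne').abs.const_mul v)
  have hx : ∀ᶠ x in 𝓝 s', (a < 1 ∧ s' + v < s) ∨ (1 < a ∧ s < x) := by
    rcases hvs with h' | h'
    · exact Eventually.of_forall fun _ => Or.inl h'
    · filter_upwards [eventually_gt_nhds h'.2] with x hx using Or.inr ⟨h'.1, hx⟩
  -- Just before `s'` the trajectory of `a'` is positive but already below `v`.
  obtain ⟨x, ⟨⟨⟨⟨h1, h2⟩, h3⟩, h4⟩, h5⟩⟩ := (((((hy.eventually_lt_const hv0).and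
    (hlim.eventually_const_lt hvL)).and hx).and (eventually_gt_nhds hs0')).filter_mono
      nhdsWithin_le_nhds |>.and (self_mem_nhdsWithin (s := Iio s'))).exists
  have h5' : x < s' := h5
  refine ⟨a', x, v, ha0', ha1', h4.le, tiltCurve_pos_of_param hc hp h5'.le,
    yHat_pos hc hp h4.le h5', h1, h2, ?_⟩
  rcases h3 with h' | h'
  · exact Or.inl ⟨h'.1, by linarith [h'.2]⟩
  · exact Or.inr h'

end LowerBound

/-! ### The exponential rate of the deviation probability -/

section Deviation

variable {c a s : ℝ} {sn : ℕ → ℝ}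

lemma tendsto_devTime (hs : 0 < s) (hsn : Tendsto sn atTop (𝓝 s)) :
    Tendsto (fun n => (devTime c n (sn n) : ℝ) / n) atTop (𝓝 s) := by
  refine tendsto_div_of_abs_sub_le hsn ?_
  filter_upwards [hsn.eventually_const_lt hs, eventually_gt_atTop 0] with n hn hn0
  have hn' : (0 : ℝ) < n := by exact_mod_cast hn0
  have hpos : 0 < sn n * n := mul_pos hn hn'
  unfold devTime
  split_ifs
  · have h1 := Nat.floor_le hpos.le
    have h2 := Nat.lt_floor_add_one (sn n * n)
    rw [abs_le]; constructor <;> linarith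
  · have h1 := Nat.le_ceil (sn n * n)
    have h2 := Nat.ceil_lt_add_one hpos.le
    have h3 : 1 ≤ ⌈sn n * n⌉₊ := Nat.ceil_pos.2 hpos
    rw [Nat.cast_sub h3, Nat.cast_one, abs_le]
    constructor <;> linarith

lemma eventually_devTime_le (hs : 0 < s) (hs1 : s < 1) (hsn : Tendsto sn atTop (𝓝 s)) :
    ∀ᶠ n in atTop, devTime c n (sn n) ≤ n := by
  filter_upwards [(tendsto_devTime (c := c) hs hsn).eventually_lt_const hs1,
    eventually_gt_atTop 0] with n hn hn0
  have hn' : (0 : ℝ) < n := by exact_mod_cast hn0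
  rw [div_lt_one hn'] at hn
  exact_mod_cast hn.le

lemma eventually_side (hc : 0 < c) (h : IsParam c s a) (hsn : Tendsto sn atTop (𝓝 s))
    (hsc : s ≠ sCrit c) : ∀ᶠ n in atTop, (a < 1 ↔ sn n < sCrit c) := by
  have hside : a < 1 ↔ s < sCrit c := by
    rw [lt_one_iff_paramTime hc h.1 h.2.1, ← (isParam_iff.1 h).2.2]
  rcases lt_or_gt_of_ne hsc with h' | h'
  · filter_upwards [hsn.eventually_lt_const h'] with n hn
    exact iff_of_true (hside.2 h') hn
  · filter_upwards [hsn.eventually_const_lt h'] with n hn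
    exact iff_of_false (fun h2 => lt_asymm h' (hside.1 h2)) hn.le.not_gt

/-- Being alive with fewer than `vn` vertices at time `xn` is likely enough. It ensures absorption
by `(x + v) n` for early stopping, and survival past `sn` for late stopping. -/
lemma eventually_exp_le_greedyProb (hc : 0 < c) (h : IsParam c s a) (hs : 0 < s) (hs1 : s < 1)
    (hsc : s ≠ sCrit c) (hsn : Tendsto sn atTop (𝓝 s)) {L : ℝ}
    (hL : L < Real.log a - logInt c a s) :
    ∀ᶠ n : ℕ in atTop, Real.exp (n * L) ≤ greedyProb c n (devEvent c n (sn n)) := by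
  obtain ⟨a', x, v, ha', ha1', hx, hu, hy, hyv, hL', hside⟩ := exists_near_optimal hc h hs hL
  have hk := tendsto_floor_div hx
  have hdev := tendsto_devTime (c := c) hs hsn
  have hgeo : ∀ᶠ n : ℕ in atTop, (a < 1 ∧ (⌊x * n⌋₊ : ℝ) + n * v ≤ devTime c n (sn n)) ∨
      (1 < a ∧ devTime c n (sn n) ≤ ⌊x * n⌋₊) := by
    rcases hside with ⟨h1, h2⟩ | ⟨h1, h2⟩
    · filter_upwards [(hdev.sub (hk.add_const v)).eventually_const_lt (sub_pos.2 h2),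
        eventually_gt_atTop 0] with n hn hn0
      have hn' : (0 : ℝ) < n := by exact_mod_cast hn0
      refine Or.inl ⟨h1, ?_⟩
      have h3 := mul_pos hn' hn
      have h4 : ∀ A B : ℝ, (n : ℝ) * (A / n - (B / n + v)) = A - (B + n * v) := by
        intro A B; field_simp
      rw [h4] at h3
      linarith
    · filter_upwards [(hk.sub hdev).eventually_const_lt (sub_pos.2 h2),
        eventually_gt_atTop 0] with n hn hn0
      have hn' : (0 : ℝ) < n := by exact_mod_cast hn0
      refine Or.inr ⟨h1, ?_⟩
      rw [← sub_div] at hn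
      have h3 : (devTime c n (sn n) : ℝ) < ⌊x * n⌋₊ := by
        have := (div_pos_iff_of_pos_right hn').1 hn
        linarith
      exact_mod_cast h3.le
  filter_upwards [eventually_exp_le_stepOp_iterate hc ha' ha1' hx hu hy hyv hk hL', hgeo,
    eventually_side hc h hsn hsc, eventually_devTime_le (c := c) hs hs1 hsn,
    hsn.eventually_const_lt hs, tendsto_natCast_atTop_atTop.eventually_gt_atTop c]
    with n e1 e2 e3 e4 e5 e6
  obtain ⟨hp0, hp1⟩ := div_natCast_mem hc e6
  rw [greedyProb_devEvent hc e6.le e5 e3 e4]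
  exact e1.trans (stepOp_iterate_near_le hp0 hp1.le e2 n)

lemma eventually_rate_le (hc : 0 < c) (h : IsParam c s a) (hs : 0 < s)
    (hsn : Tendsto sn atTop (𝓝 s)) {U : ℝ} (hU : Real.log a - logInt c a s < U) :
    ∀ᶠ n : ℕ in atTop, Real.exp (-tiltLog (c / n) a (devTime c n (sn n))) * a ^ n ≤
      Real.exp (n * U) := by
  have hlim := (tendsto_const_nhds (x := Real.log a)).sub (tendsto_tiltLog hc hs.le
    (tiltCurve_param_pos hc h) (tendsto_devTime (c := c) hs hsn))
  filter_upwards [hlim.eventually_lt_const hU, eventually_gt_atTop 0] with n hn hn0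
  have hn' : (0 : ℝ) < n := by exact_mod_cast hn0
  rw [pow_eq_exp_log h.1, ← Real.exp_add, Real.exp_le_exp]
  have h1 := mul_lt_mul_of_pos_left hn hn'
  have h2 : ∀ S : ℝ, (n : ℝ) * (Real.log a - S / n) = n * Real.log a - S := by
    intro S; field_simp
  rw [h2] at h1
  linarith

lemma eventually_greedyProb_le_exp (hc : 0 < c) (h : IsParam c s a) (hs : 0 < s) (hs1 : s < 1)
    (hsc : s ≠ sCrit c) (hsn : Tendsto sn atTop (𝓝 s)) {U : ℝ}
    (hU : Real.log a - logInt c a s < U) :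
    ∀ᶠ n : ℕ in atTop, greedyProb c n (devEvent c n (sn n)) ≤ Real.exp (n * U) := by
  filter_upwards [eventually_rate_le hc h hs hsn hU,
    eventually_tiltBase_pos hc (tendsto_devTime (c := c) hs hsn) (tiltCurve_param_pos hc h),
    eventually_side hc h hsn hsc, eventually_devTime_le (c := c) hs hs1 hsn,
    hsn.eventually_const_lt hs, tendsto_natCast_atTop_atTop.eventually_gt_atTop c]
    with n e1 e2 e3 e4 e5 e6
  obtain ⟨hp0, hp1⟩ := div_natCast_mem hc e6
  rw [greedyProb_devEvent hc e6.le e5 e3 e4]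
  exact (stepOp_iterate_devStates_le_pow hp0 hp1 h.1 h.2.1 _ n e2).trans e1

lemma eventually_greedyProb_pos (hc : 0 < c) (h : IsParam c s a) (hs : 0 < s) (hs1 : s < 1)
    (hsc : s ≠ sCrit c) (hsn : Tendsto sn atTop (𝓝 s)) :
    ∀ᶠ n : ℕ in atTop, 0 < greedyProb c n (devEvent c n (sn n)) := by
  filter_upwards [eventually_exp_le_greedyProb hc h hs hs1 hsc hsn (sub_one_lt _)] with n hn
  exact (Real.exp_pos _).trans_le hn

lemma tendsto_log_greedyProb (hc : 0 < c) (h : IsParam c s a) (hs : 0 < s) (hs1 : s < 1)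
    (hsc : s ≠ sCrit c) (hsn : Tendsto sn atTop (𝓝 s)) :
    Tendsto (fun n : ℕ => (1 / (n : ℝ)) * Real.log (greedyProb c n (devEvent c n (sn n))))
      atTop (𝓝 (Real.log a - logInt c a s)) := by
  refine tendsto_order.2 ⟨fun L hL => ?_, fun U hU => ?_⟩
  · obtain ⟨L', h1, h2⟩ := exists_between hL
    filter_upwards [eventually_exp_le_greedyProb hc h hs hs1 hsc hsn h2,
      eventually_gt_atTop 0] with n hn hn0
    have hn' : (0 : ℝ) < n := by exact_mod_cast hn0
    have := Real.log_le_log (Real.exp_pos _) hn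
    rw [Real.log_exp] at this
    rw [one_div, ← div_eq_inv_mul, lt_div_iff₀ hn']
    nlinarith
  · obtain ⟨U', h1, h2⟩ := exists_between hU
    filter_upwards [eventually_greedyProb_le_exp hc h hs hs1 hsc hsn h1,
      eventually_greedyProb_pos hc h hs hs1 hsc hsn, eventually_gt_atTop 0] with n hn hp hn0
    have hn' : (0 : ℝ) < n := by exact_mod_cast hn0
    have := Real.log_le_log hp hn
    rw [Real.log_exp] at this
    rw [one_div, ← div_eq_inv_mul, div_lt_iff₀ hn']
    nlinarith

end Deviation

/-! ### Events that are exponentially unlikely given the deviation -/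

/-- Given the deviation, the events `E n` have exponentially small probability. -/
def ExpNegligible (c : ℝ) (sn : ℕ → ℝ) (E : ∀ n, Set (SimpleGraph (Fin n) × List (Fin n))) : Prop :=
  ∃ δ : ℝ, 0 < δ ∧ ∀ᶠ n : ℕ in atTop, greedyProb c n (devEvent c n (sn n) ∩ E n) ≤
    Real.exp (-δ * n) * greedyProb c n (devEvent c n (sn n))

section Negligible

variable {c a s : ℝ} {sn : ℕ → ℝ} {E E' : ∀ n, Set (SimpleGraph (Fin n) × List (Fin n))}

lemma ExpNegligible.mono (h : ExpNegligible c sn E') (hE : ∀ᶠ n in atTop, E n ⊆ E' n) :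
    ExpNegligible c sn E := by
  obtain ⟨δ, hδ, h⟩ := h
  refine ⟨δ, hδ, ?_⟩
  filter_upwards [h, hE] with n h1 h2
  exact (greedyProb_mono c (inter_subset_inter_right _ h2)).trans h1

lemma expNegligible_empty : ExpNegligible c sn fun _ => ∅ := by
  refine ⟨1, one_pos, Eventually.of_forall fun n => ?_⟩
  have : greedyProb c n ∅ = 0 := by simp [greedyProb]
  rw [inter_empty, this]
  exact mul_nonneg (Real.exp_pos _).le (greedyProb_nonneg _ _ _)

lemma ExpNegligible.union (h : ExpNegligible c sn E) (h' : ExpNegligible c sn E') :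
    ExpNegligible c sn fun n => E n ∪ E' n := by
  obtain ⟨δ, hδ, h⟩ := h
  obtain ⟨δ', hδ', h'⟩ := h'
  -- Half of the smaller exponent is given up to absorb the factor `2` of the union bound.
  set ρ := min δ δ' / 2 with hρ
  have hρ0 : 0 < ρ := by have := lt_min hδ hδ'; positivity
  refine ⟨ρ, hρ0, ?_⟩
  filter_upwards [h, h', (tendsto_exp_neg_mul hρ0).eventually_lt_const
    (show (0 : ℝ) < 1 / 2 by norm_num)] with n h1 h2 h3
  set P := greedyProb c n (devEvent c n (sn n))
  have hP : 0 ≤ P := greedyProb_nonneg _ _ _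
  have hle : ∀ d, min δ δ' ≤ d → Real.exp (-d * n) ≤ Real.exp (-ρ * n) * (1 / 2) := by
    intro d hd
    refine le_trans ?_ (mul_le_mul_of_nonneg_left h3.le (Real.exp_pos _).le)
    rw [← Real.exp_add, Real.exp_le_exp]
    have : (0 : ℝ) ≤ n := Nat.cast_nonneg n
    nlinarith
  rw [inter_union_distrib_left]
  refine (greedyProb_union_le c _ _).trans ?_
  have h4 := mul_le_mul_of_nonneg_right (hle δ (min_le_left _ _)) hP
  have h5 := mul_le_mul_of_nonneg_right (hle δ' (min_le_right _ _)) hP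
  linarith

lemma expNegligible_biUnion {ι : Type*} (t : Finset ι)
    {F : ι → ∀ n, Set (SimpleGraph (Fin n) × List (Fin n))}
    (h : ∀ i ∈ t, ExpNegligible c sn (F i)) :
    ExpNegligible c sn fun n => ⋃ i ∈ t, F i n := by
  classical
  induction t using Finset.induction_on with
  | empty => simpa using expNegligible_empty
  | insert i t hi ih =>
    simp only [Finset.set_biUnion_insert]
    exact (h i (Finset.mem_insert_self i t)).union
      (ih fun j hj => h j (Finset.mem_insert_of_mem hj))

/-- The tail gains `e^{-δn}` over the upper bound for the deviation. The upper and lower bounds are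
taken within `δ/4` of the rate, so `δ/2` survives the division. -/
lemma expNegligible_inTail (hc : 0 < c) (h : IsParam c s a) (hs : 0 < s) (hs1 : s < 1)
    (hsc : s ≠ sCrit c) (hsn : Tendsto sn atTop (𝓝 s)) {a' x v : ℝ} (hx : 0 ≤ x) (hxs : x < s)
    (ha' : 0 < a') (hside : 1 < a ↔ 1 < a') (hu' : 0 < tiltCurve c a' x)
    (hlt : tiltRate c a' x v < tiltRate c a x v) :
    ExpNegligible c sn fun n => {ω | numAvail ω ⌊x * n⌋₊ ∈ {w | InTail a a' (n * v) w}} := by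
  have hk := tendsto_floor_div hx
  have hdev := tendsto_devTime (c := c) hs hsn
  obtain ⟨δ, hδ, hev⟩ := exists_tiltRatio_le hc h.1 ha' hx (tiltCurve_pos_of_param hc h hxs.le)
    hu' hlt hk
  set I := Real.log a - logInt c a s with hI
  refine ⟨δ / 2, by positivity, ?_⟩
  filter_upwards [hev, eventually_rate_le hc h hs hsn (show I < I + δ / 4 by linarith),
    eventually_exp_le_greedyProb hc h hs hs1 hsc hsn (show I - δ / 4 < I by linarith),
    eventually_tiltBase_pos hc hdev (tiltCurve_param_pos hc h),
    eventually_tiltBase_pos hc hk hu',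
    eventually_side hc h hsn hsc, eventually_devTime_le (c := c) hs hs1 hsn,
    hsn.eventually_const_lt hs, tendsto_natCast_atTop_atTop.eventually_gt_atTop c,
    (hdev.sub hk).eventually_const_lt (sub_pos.2 hxs), eventually_gt_atTop 0]
    with n e1 e2 e3 e4 e5 e6 e7 e8 e9 e10 hn0
  have hn' : (0 : ℝ) < n := by exact_mod_cast hn0
  have hkm : ⌊x * n⌋₊ ≤ devTime c n (sn n) := by
    rw [← sub_div] at e10
    have h3 : (⌊x * n⌋₊ : ℝ) < devTime c n (sn n) := by
      have := (div_pos_iff_of_pos_right hn').1 e10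
      linarith
    exact_mod_cast h3.le
  obtain ⟨hp0, hp1⟩ := div_natCast_mem hc e9
  refine (greedyProb_devEvent_inter hc e9.le e8 e6 hkm e7 {w | InTail a a' (n * v) w}).trans_le ?_
  have f1 := stepOp_iterate_tail_le (r := n * v) hp0 hp1 h.2.1 ha' hside n hkm e4 e5
  have f2 := mul_le_mul_of_nonneg_left e1
    (Real.exp_pos (-tiltLog (c / n) a (devTime c n (sn n)))).le
  have f3 := mul_le_mul_of_nonneg_right e2 (Real.exp_pos (-δ * n)).le
  have f4 := mul_le_mul_of_nonneg_left e3 (Real.exp_pos (-(δ / 2) * n)).le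
  have f5 : Real.exp (n * (I + δ / 4)) * Real.exp (-δ * n) =
      Real.exp (-(δ / 2) * n) * Real.exp (n * (I - δ / 4)) := by
    rw [← Real.exp_add, ← Real.exp_add]; ring_nf
  refine f1.trans (f2.trans (le_trans (le_of_eq ?_) (f3.trans (f5.trans_le f4))))
  ring

/-- Given the deviation, the process is close to the optimal trajectory at a fixed time. -/
lemma expNegligible_abs_sub (hc : 0 < c) (h : IsParam c s a) (hs : 0 < s) (hs1 : s < 1)
    (hsc : s ≠ sCrit c) (hsn : Tendsto sn atTop (𝓝 s)) {x η : ℝ} (hx : 0 ≤ x) (hxs : x < s)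
    (hη : 0 < η) :
    ExpNegligible c sn fun n => {ω | η ≤ |(numAvail ω ⌊x * n⌋₊ : ℝ) / n - yHat c a x|} := by
  have hu := tiltCurve_pos_of_param hc h hxs.le
  have hy := yHat_pos hc h hx hxs
  have hup : ExpNegligible c sn
      fun n => {ω | yHat c a x + η ≤ (numAvail ω ⌊x * n⌋₊ : ℝ) / n} := by
    obtain ⟨a', h1, h2, h3, h4⟩ := exists_tilt_gt hc h.1 h.2.1 hx hu
      (show 0 ≤ yHat c a x + η by positivity) (by linarith)
    refine (expNegligible_inTail hc h hs hs1 hsc hsn hx hxs (h.1.trans h1) h2 h3 h4).mono ?_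
    filter_upwards [eventually_gt_atTop 0] with n hn0 ω hω
    have hn' : (0 : ℝ) < n := by exact_mod_cast hn0
    exact Or.inl ⟨h1, by rw [mul_comm (n : ℝ)]; exact (le_div_iff₀ hn').1 hω⟩
  have hlow : ExpNegligible c sn
      fun n => {ω | (numAvail ω ⌊x * n⌋₊ : ℝ) / n ≤ yHat c a x - η} := by
    -- A negative level is never reached, and the tilt comparison needs a nonnegative one.
    rcases lt_or_ge (yHat c a x - η) 0 with hneg | hnn
    · refine expNegligible_empty.mono (Eventually.of_forall fun n ω hω => ?_)
      have h1 : (numAvail ω ⌊x * n⌋₊ : ℝ) / n ≤ yHat c a x - η := hω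
      have h2 : 0 ≤ (numAvail ω ⌊x * n⌋₊ : ℝ) / n := by positivity
      exact absurd (h2.trans h1) hneg.not_ge
    obtain ⟨a', h0, h1, h2, h3, h4⟩ := exists_tilt_lt hc h.1 h.2.1 hx hu hnn (by linarith)
    refine (expNegligible_inTail hc h hs hs1 hsc hsn hx hxs h0 h2 h3 h4).mono ?_
    filter_upwards [eventually_gt_atTop 0] with n hn0 ω hω
    have hn' : (0 : ℝ) < n := by exact_mod_cast hn0
    exact Or.inr ⟨h1, by rw [mul_comm (n : ℝ)]; exact (div_le_iff₀ hn').1 hω⟩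
  refine (hup.union hlow).mono (Eventually.of_forall fun n ω hω => ?_)
  rcases le_abs.1 (show η ≤ |(numAvail ω ⌊x * n⌋₊ : ℝ) / n - yHat c a x| from hω) with h' | h'
  · exact Or.inl (show yHat c a x + η ≤ (numAvail ω ⌊x * n⌋₊ : ℝ) / n by linarith)
  · exact Or.inr (show (numAvail ω ⌊x * n⌋₊ : ℝ) / n ≤ yHat c a x - η by linarith)

lemma exists_mul_le_le {h x : ℝ} (hx : 0 ≤ x) (N : ℕ) (hxN : x ≤ (N + 1) * h) :
    ∃ i ≤ N, i * h ≤ x ∧ x ≤ (i + 1) * h := by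
  induction N with
  | zero => exact ⟨0, le_rfl, by simpa using hx, by simpa using hxN⟩
  | succ N ih =>
    rcases le_total x ((N + 1) * h) with h1 | h1
    · obtain ⟨i, h2, h3⟩ := ih h1
      exact ⟨i, h2.trans N.le_succ, h3⟩
    · exact ⟨N + 1, le_rfl, by push_cast; exact h1, hxN⟩

/-- A finite grid in `[0, s)` of mesh below `ρ`. -/
lemma exists_grid {ρ : ℝ} (hs : 0 < s) (hρ : 0 < ρ) :
    ∃ t : Finset ℝ, (∀ p ∈ t, 0 ≤ p ∧ p < s) ∧ ∀ x ∈ Icc 0 s,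
      (∃ p ∈ t, p ≤ x ∧ x - p < ρ) ∧ (s - x < ρ ∨ ∃ q ∈ t, x ≤ q ∧ q - x < ρ) := by
  obtain ⟨N, hN⟩ := exists_nat_gt (s / ρ)
  have hN1 : (0 : ℝ) < N + 1 := by positivity
  set h := s / (N + 1) with hh
  have hh0 : 0 < h := by positivity
  have hhs : (N + 1) * h = s := by rw [hh]; field_simp
  have hhρ : h < ρ := by
    rw [hh, div_lt_iff₀ hN1]
    rw [div_lt_iff₀ hρ] at hN
    nlinarith
  refine ⟨(Finset.range (N + 1)).image fun i : ℕ => i * h, ?_, fun x hx => ?_⟩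
  · intro p hp
    obtain ⟨i, hi, rfl⟩ := Finset.mem_image.1 hp
    have : (i : ℝ) < N + 1 := by exact_mod_cast Finset.mem_range.1 hi
    exact ⟨by positivity, by nlinarith⟩
  · obtain ⟨i, hi, h1, h2⟩ := exists_mul_le_le hx.1 N (hhs ▸ hx.2)
    refine ⟨⟨i * h, Finset.mem_image_of_mem _ (Finset.mem_range.2 (by omega)), h1, by linarith⟩, ?_⟩
    rcases hi.lt_or_eq with hi | rfl
    · refine Or.inr ⟨((i + 1 : ℕ) : ℝ) * h,
        Finset.mem_image_of_mem _ (Finset.mem_range.2 (by omega)), ?_, ?_⟩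
      · push_cast; exact h2
      · push_cast; linarith
    · exact Or.inl (by linarith)

/-- Both the process and `ŷ` decrease, so closeness at the points of a fine finite grid implies
uniform closeness. -/
lemma expNegligible_farEvent (hc : 0 < c) (h : IsParam c s a) (hs : 0 < s) (hs1 : s < 1)
    (hsc : s ≠ sCrit c) (hsn : Tendsto sn atTop (𝓝 s)) {ε : ℝ} (hε : 0 < ε) :
    ExpNegligible c sn fun n => farEvent n s ε (yHat c a) := by
  obtain ⟨ρ, hρ, huc⟩ := Metric.uniformContinuousOn_iff.1
    (isCompact_Icc.uniformContinuousOn_of_continuous (continuousOn_yHat hc h)) (ε / 2) (half_pos hε)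
  obtain ⟨t, ht, hgrid⟩ := exists_grid hs hρ
  have key := expNegligible_biUnion (sn := sn) (c := c) t
    (F := fun p n => {ω | ε / 2 ≤ |(numAvail ω ⌊p * n⌋₊ : ℝ) / n - yHat c a p|})
    fun p hp => expNegligible_abs_sub hc h hs hs1 hsc hsn (ht p hp).1 (ht p hp).2 (half_pos hε)
  refine key.mono (Eventually.of_forall fun n ω hω => ?_)
  obtain ⟨x, hx, hfar⟩ := hω
  by_contra hcon
  have hclose : ∀ p ∈ t, |(numAvail ω ⌊p * n⌋₊ : ℝ) / n - yHat c a p| < ε / 2 := by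
    intro p hp
    by_contra h2
    exact hcon (mem_iUnion₂.2 ⟨p, hp, not_lt.1 h2⟩)
  have hmono : ∀ p q : ℝ, p ≤ q →
      (numAvail ω ⌊q * n⌋₊ : ℝ) / n ≤ (numAvail ω ⌊p * n⌋₊ : ℝ) / n := by
    intro p q hpq
    have : numAvail ω ⌊q * n⌋₊ ≤ numAvail ω ⌊p * n⌋₊ :=
      numAvail_antitone ω (Nat.floor_mono (mul_le_mul_of_nonneg_right hpq (Nat.cast_nonneg n)))
    gcongr
  have hosc : ∀ p q : ℝ, p ∈ Icc 0 s → q ∈ Icc 0 s → p ≤ q → q - p < ρ →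
      yHat c a p < yHat c a q + ε / 2 := by
    intro p q hp hq hpq hd
    have := huc p hp q hq (by rw [Real.dist_eq, abs_sub_comm, abs_of_nonneg] <;> linarith)
    rw [Real.dist_eq] at this
    linarith [(abs_lt.1 this).2]
  obtain ⟨⟨p, hp, hpx, hpd⟩, hright⟩ := hgrid x hx
  rcases le_abs.1 hfar with h' | h'
  · have h1 := hmono p x hpx
    have h2 := (abs_lt.1 (hclose p hp)).2
    have h3 := hosc p x ⟨(ht p hp).1, (ht p hp).2.le⟩ hx hpx hpd
    linarith
  · rcases hright with hd | ⟨q, hq, hxq, hqd⟩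
    -- No grid point to the right is needed near `s`: there `ŷ < ε/2`, and the process is
    -- nonnegative.
    · have h3 := hosc x s hx ⟨hs.le, le_rfl⟩ hx.2 hd
      rw [yHat_param hc h] at h3
      have h4 : 0 ≤ (numAvail ω ⌊x * n⌋₊ : ℝ) / n := by positivity
      linarith
    · have h1 := hmono x q hxq
      have h2 := (abs_lt.1 (hclose q hq)).1
      have h3 := hosc x q hx ⟨(ht q hq).1, (ht q hq).2.le⟩ hxq hqd
      linarith

end Negligible

end

theorem theorem2 (c s : ℝ) (hc : 0 < c) (hs0 : 0 < s) (hs1 : s < 1) (hsc : s ≠ sCrit c) :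
    -- the parameter `a_s` exists and is unique
    (∃! a : ℝ, IsParam c s a) ∧
    ∀ a : ℝ, IsParam c s a →
      -- `ŷ_s` decreases from `1` to `0` over `[0, s]`, and is the unique such trajectory of
      -- least cost
      (IsTrajectory s (yHat c a) ∧ StrictAntiOn (yHat c a) (Icc 0 s) ∧
        ∀ y : ℝ → ℝ, IsTrajectory s y →
          trajCost c s (yHat c a) ≤ trajCost c s y ∧
          (trajCost c s y = trajCost c s (yHat c a) → EqOn y (yHat c a) (Icc 0 s))) ∧
      -- `ℓ_s` is minus the Poisson Legendre transform along `ŷ_s`, and has a closed form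
      (∀ x ∈ Ico 0 s,
        DifferentiableAt ℝ (yHat c a) x ∧
        poissonLegendre (c * yHat c a x) (-(1 + deriv (yHat c a) x)) = ((-ellHat c a x : ℝ) : EReal) ∧
        ellHat c a x =
          (Real.log ((1 + (a - 1) * Real.exp (c * x)) / a) - c * (a - 1) / a) *
            (1 - Real.log (1 + (a - 1) * Real.exp (c * x)) / ((a - 1) * Real.exp (c * x)))) ∧
      IntervalIntegrable (ellHat c a) volume 0 s ∧
      trajCost c s (yHat c a) = ENNReal.ofReal (-∫ x in (0 : ℝ)..s, ellHat c a x) ∧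
      -- the asymptotics of the process
      ∀ sn : ℕ → ℝ, Tendsto sn atTop (𝓝 s) →
        -- the exponential rate of the deviation probability
        (∀ᶠ n : ℕ in atTop, 0 < greedyProb c n (devEvent c n (sn n))) ∧
        Tendsto (fun n : ℕ => (1 / (n : ℝ)) * Real.log (greedyProb c n (devEvent c n (sn n))))
          atTop (𝓝 (∫ x in (0 : ℝ)..s, ellHat c a x)) ∧
        -- up to an exponentially small proportion, the deviation is realized along `ŷ_s`
        ∀ ε : ℝ, 0 < ε → ∃ δ : ℝ, 0 < δ ∧ ∀ᶠ n : ℕ in atTop,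
          greedyProb c n (devEvent c n (sn n) ∩ farEvent n s ε (yHat c a)) ≤
            Real.exp (-δ * n) * greedyProb c n (devEvent c n (sn n)) := by
  refine ⟨existsUnique_isParam hc hs0 hs1 hsc, fun a h => ?_⟩
  have hu : ∀ x ∈ Ico 0 s, 0 < tiltCurve c a x := fun x hx => tiltCurve_pos_of_param hc h hx.2.le
  refine ⟨⟨isTrajectory_yHat hc h, yHat_strictAntiOn hc h, fun y hy =>
    ⟨trajCost_yHat_le hc h hs0.le hy, eqOn_yHat_of_trajCost_eq hc h hs0.le hy⟩⟩,
    fun x hx => ⟨(hasDerivAt_yHat hc h.1 h.2.1 (hu x hx)).differentiableAt,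
      poissonLegendre_yHat hc h.1 h.2.1 (hu x hx) (yHat_pos hc h hx.1 hx.2).le,
      ellHat_closed_form hc h.1 h.2.1 (hu x hx)⟩, ?_, trajCost_yHat hc h hs0.le,
    fun sn hsn => ⟨eventually_greedyProb_pos hc h hs0 hs1 hsc hsn, ?_,
      fun ε hε => expNegligible_farEvent hc h hs0 hs1 hsc hsn hε⟩⟩
  · refine ContinuousOn.intervalIntegrable ?_
    rw [uIcc_of_le hs0.le]
    exact continuousOn_ellHat hc h
  · rw [integral_ellHat hc h hs0.le]
    exact tendsto_log_greedyProb hc h hs0 hs1 hsc hsn
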